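/- Let $n\ge 3$, $1<\alpha<2$, $\omega>0$. Let $E_\alpha(z)=\sum_{k\ge 0} z^k/\Gamma(\alpha k+1)$ be the Mittag-Leffler function, put $i^\alpha=e^{i\pi\alpha/2}$ and $\varphi_\omega(t)=E_\alpha(i^\alpha\omega^\alpha t^\alpha)$ for $t\ge 0$, and let $$\mathbb D_t^{(\alpha)}u(t,x)=\frac{1}{\Gamma(2-\alpha)}\frac{\partial}{\partial t}\int_0^t (t-\tau)^{1-\alpha}u'_\tau(\tau,x)\,d\tau-\frac{t^{1-\alpha}u'_t(0,x)}{\Gamma(2-\alpha)}$$ be the Caputo-Dzhrbashyan derivative of order $\alpha$. Let $F,u^0,u^1:\mathbb R^n\to\mathbb C$ be bounded and integrable, where $F$ is locally Hölder continuous; $u^0\in C^1$ has bounded first derivatives that are Hölder continuous with an exponent $\gamma>\frac{2-\alpha}{\alpha}$; and $u^1$ is Hölder continuous with some positive exponent. Let $u(t,x)$, $t\ge 0$, $x\in\mathbb R^n$, be the classical solution of the Cauchy problem $$\mathbb D_t^{(\alpha)}u-\Delta u=\varphi_\omega(t)F(x)\quad (t>0),\qquad u(0,x)=u^0(x),\quad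 \frac{\partial u}{\partial t}(0,x)=u^1(x),$$ that is bounded on $[0,T]\times\mathbb R^n$ for every $T>0$. Here a classical solution is a function $u$ that is $C^1$ in $(t,x)$ on $[0,\infty)\times\mathbb R^n$, is $C^2$ in $x$ for each $t>0$ with $\Delta u$ continuous on $(0,\infty)\times\mathbb R^n$, is such that for each $x$ the function $t\mapsto\frac{1}{\Gamma(2-\alpha)}\int_0^t(t-\tau)^{1-\alpha}u'_\tau(\tau,x)\,d\tau$ is continuously differentiable for $t>0$, and satisfies the equation and the initial conditions. Then $F\in L_2(\mathbb R^n)$, and there is a function $v$ in the Sobolev space $H^2(\mathbb R^n)$ that satisfies $$\Delta v-i^\alpha\omega^\alpha v=-F$$ and $$\frac{u(t,x)}{E_\alpha(i^\alpha\omega^\alpha t^\alpha)}\longrightarrow v(x),\qquad t\to\infty,\quad\text{for every }x\in\mathbb R^n.$$ -/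

import Mathlib

open Set Filter Topology MeasureTheory
open scoped NNReal ENNReal SchwartzMap Laplacian

/-- The Mittag-Leffler function `E_α(z) = ∑ z ^ k / Γ(α k + 1)`. -/
noncomputable def mittagLeffler (α : ℝ) (z : ℂ) : ℂ :=
  ∑' k : ℕ, z ^ k / (Real.Gamma (α * k + 1) : ℂ)

/-- The number `i ^ α ω ^ α` (principal value of the power, `i ^ α = exp (i π α / 2)`). -/
noncomputable def iomegaPow (α ω : ℝ) : ℂ :=
  Complex.I ^ (α : ℂ) * ((ω ^ α : ℝ) : ℂ)

/-- The oscillation `φ_ω(t) = E_α(i ^ α ω ^ α t ^ α)`, `t ≥ 0`. -/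
noncomputable def mlOscillation (α ω t : ℝ) : ℂ :=
  mittagLeffler α (iomegaPow α ω * ((t ^ α : ℝ) : ℂ))

/-- The derivative on the half-line `[0, ∞)` (one-sided at `0`). -/
noncomputable def halfLineDeriv (y : ℝ → ℂ) (t : ℝ) : ℂ :=
  derivWithin y (Ici 0) t

/-- The fractional integral `1 / Γ(2 - α) ∫₀ᵗ (t - τ) ^ (1 - α) y'(τ) dτ` of the derivative of a
function `y` on `[0, ∞)`. -/
noncomputable def fracIntegralDeriv (α : ℝ) (y : ℝ → ℂ) (t : ℝ) : ℂ :=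
  ((1 / Real.Gamma (2 - α) : ℝ) : ℂ) *
    ∫ τ in (0 : ℝ)..t, (((t - τ) ^ (1 - α) : ℝ) : ℂ) * halfLineDeriv y τ

/-- The Caputo-Dzhrbashyan derivative of order `α ∈ (1, 2)` at `t > 0`:
`1 / Γ(2 - α) d/dt ∫₀ᵗ (t - τ) ^ (1 - α) y'(τ) dτ - t ^ (1 - α) y'(0) / Γ(2 - α)`. -/
noncomputable def caputoDeriv (α : ℝ) (y : ℝ → ℂ) (t : ℝ) : ℂ :=
  deriv (fracIntegralDeriv α y) t
    - ((t ^ (1 - α) / Real.Gamma (2 - α) : ℝ) : ℂ) * halfLineDeriv y 0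

/-- Classical solutions on `[0, ∞) × ℝⁿ` of the Cauchy problem
`D_t^{(α)} u - Δ u = f` for `t > 0`, `u(0, ·) = u⁰`, `∂ₜ u(0, ·) = u¹`.
Only the values `u t x` with `t ≥ 0` matter. -/
structure IsClassicalSolution {n : ℕ} (α : ℝ) (f : ℝ → EuclideanSpace ℝ (Fin n) → ℂ)
    (u₀ u₁ : EuclideanSpace ℝ (Fin n) → ℂ) (u : ℝ → EuclideanSpace ℝ (Fin n) → ℂ) : Prop where
  /-- `u` is `C¹` in `(t, x)`, up to `t = 0`. -/
  contDiffOn_one : ContDiffOn ℝ 1 (fun p : ℝ × EuclideanSpace ℝ (Fin n) => u p.1 p.2)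
    (Ici 0 ×ˢ univ)
  /-- `u` is `C²` in `x` for each `t > 0`. -/
  contDiff_two : ∀ t : ℝ, 0 < t → ContDiff ℝ 2 (u t)
  /-- `Δ u` is continuous in `(t, x)` for `t > 0`. -/
  continuousOn_laplacian : ContinuousOn
    (fun p : ℝ × EuclideanSpace ℝ (Fin n) => (Δ (u p.1)) p.2) (Ioi 0 ×ˢ univ)
  /-- The fractional integral is continuously differentiable in `t > 0` for each `x`. -/
  contDiffOn_fracIntegral : ∀ x, ContDiffOn ℝ 1 (fracIntegralDeriv α (fun τ => u τ x)) (Ioi 0)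
  /-- The equation. -/
  equation : ∀ t : ℝ, 0 < t → ∀ x, caputoDeriv α (fun τ => u τ x) t - (Δ (u t)) x = f t x
  /-- The first initial condition. -/
  initial_zero : ∀ x, u 0 x = u₀ x
  /-- The second initial condition. -/
  initial_one : ∀ x, halfLineDeriv (fun τ => u τ x) 0 = u₁ x

/-- Local Hölder continuity: near every point the function is Hölder continuous with some positive
exponent (which may depend on the point). -/
def LocallyHolderContinuous {X Y : Type*} [PseudoEMetricSpace X] [PseudoEMetricSpace Y]
    (F : X → Y) : Prop :=
  ∀ x, ∃ s ∈ 𝓝 x, ∃ C δ : ℝ≥0, 0 < δ ∧ HolderOnWith C δ F s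

/-! ### The Gamma function and Mittag-Leffler series -/

/-! Write z = i^α ω^α and let I^α be the Riemann-Liouville integral. Since arg z = πα/2 lies
strictly between π/2 and π, z is off the spectrum (-∞, 0] of Δ, and the limit amplitude is v = (z -
Δ)⁻¹F, realised as a Laplace integral of the heat kernel along a complex ray (`resolventExt`,
`exists_memSobolev_resolventExt`). The oscillation satisfies φ = 1 + z I^α φ
(`mlOscillation_volterra`), so w = u - φ v formally solves the homogeneous problem w = (u⁰ - v) + t
u¹ + I^α Δw. Moreover E_α(i^α t^α) equals e^{it}/α up to a decaying error
(`exists_norm_mittagLeffler_sub_exp_le`), hence |φ| is eventually bounded below. It remains to show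
that w(t, y) → 0.

This is done without a fundamental solution and without a uniqueness theorem. Smooth w(t, ·) by the
heat kernel at complex time ζ, Re ζ > 0, and evaluate at y: the result W(t, ζ) is holomorphic in ζ
and Δ becomes ∂/∂ζ, so W = A + t b + I^α ∂W/∂ζ, where A and b are the heat extensions of u⁰ - v and
u¹ (`heatExt_sub_eq_rlIntegral`). Iterating gives W(t, s) = Σ (t^{αk}/Γ(αk+1) A⁽ᵏ⁾(s) +
t^{αk+1}/Γ(αk+2) b⁽ᵏ⁾(s)). Cauchy estimates cost a factor of order k!, which Γ(αk+1) beats because α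
> 1 (`tendsto_sum_of_volterra`).

For decay in t, the derivatives are written as Cauchy integrals over the two rays bounding a sector
(`iterate_deriv_eq_cauchy`). Summing under the integral produces the kernel Σ j! t^{αj+b-1}/Γ(αj+b)
σ^{-j-1}, a Borel transform of E_{α,b}. It is a Laplace integral of E_{α,b} along a ray outside
|arg| ≤ πα/2, where E_{α,b} decays (`norm_mlPower_le`, `norm_mlKernel_le`). Boundedness and
integrability of the data with n ≥ 3 give |A|, |b| ≤ C min(1, |ζ|^{-3/2}) in the sector
(`sectorDecay_heatExt`), and everything combines to |W(t, s)| ≤ C t^{μ-2} with μ < 2, uniformly in s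
> 0 (`exists_norm_hasSum_le`). Letting s → 0+ recovers w(t, y). -/

theorem rpow_mul_Gamma_le_Gamma_add {x α : ℝ} (hx : 0 < x) (hα : 1 ≤ α) :
    x ^ α * Real.Gamma x ≤ Real.Gamma (x + α) := by
  have hα0 : 0 < α := by linarith
  rcases hα.eq_or_lt with rfl | hα1
  · rw [Real.rpow_one, Real.Gamma_add_one hx.ne']
  have hG : 0 < Real.Gamma x := Real.Gamma_pos_of_pos hx
  have hG' : 0 < Real.Gamma (x + α) := Real.Gamma_pos_of_pos (by linarith)
  have h1 : 0 < 1 - 1 / α := by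
    rw [sub_pos, div_lt_one hα0]; exact hα1
  -- Log-convexity of Γ: x + 1 is the convex combination of x and x + α with weight 1/α on the
  -- second point.
  have key := Real.Gamma_mul_add_mul_le_rpow_Gamma_mul_rpow_Gamma (s := x) (t := x + α)
    (a := 1 - 1 / α) (b := 1 / α) hx (by linarith) h1 (by positivity) (by ring)
  have e : (1 - 1 / α) * x + 1 / α * (x + α) = x + 1 := by field_simp; ring
  rw [e, Real.Gamma_add_one hx.ne'] at key
  have h2 : x * Real.Gamma x ^ (1 / α) ≤ Real.Gamma (x + α) ^ (1 / α) := by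
    have h3 : 0 < Real.Gamma x ^ (1 - 1 / α) := Real.rpow_pos_of_pos hG _
    have h4 : Real.Gamma x = Real.Gamma x ^ (1 - 1 / α) * Real.Gamma x ^ (1 / α) := by
      rw [← Real.rpow_add hG]; simp
    refine le_of_mul_le_mul_left ?_ h3
    calc _ = x * (Real.Gamma x ^ (1 - 1 / α) * Real.Gamma x ^ (1 / α)) := by ring
      _ = x * Real.Gamma x := by rw [← h4]
      _ ≤ _ := key
  have h5 := Real.rpow_le_rpow (by positivity) h2 hα0.le
  rw [Real.mul_rpow hx.le (by positivity), ← Real.rpow_mul hG.le, ← Real.rpow_mul hG'.le,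
    one_div_mul_cancel hα0.ne', Real.rpow_one, Real.rpow_one] at h5
  exact h5

/-- Passing from k to k + 1 multiplies the denominator by at least (αk + b)^α and the numerator only
by (k + 1)x, so α > 1 wins. The factorial is the price of k-th derivatives in Cauchy's estimates;
this series therefore controls both the Borel kernel and the iteration of the Volterra equation. -/
theorem summable_factorial_mul_pow_div_Gamma {α b x : ℝ} (hα : 1 < α) (hb : 1 ≤ b) (hx : 0 ≤ x) :
    Summable fun k : ℕ => (k.factorial : ℝ) * x ^ k / Real.Gamma (α * k + b) := by
  have hlim : Tendsto (fun k : ℕ => x * ((k : ℝ) + 1) ^ (-(α - 1))) atTop (𝓝 (x * 0)) :=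
    ((tendsto_rpow_neg_atTop (by linarith : 0 < α - 1)).comp
      (tendsto_natCast_atTop_atTop.atTop_add tendsto_const_nhds)).const_mul x
  rw [mul_zero] at hlim
  refine summable_of_ratio_norm_eventually_le (r := 1 / 2) (by norm_num) ?_
  filter_upwards [hlim.eventually (gt_mem_nhds (by norm_num : (0 : ℝ) < 1 / 2))] with k hk
  have hk0 : (0 : ℝ) < α * k + b := by positivity
  have hG := Real.Gamma_pos_of_pos hk0
  have h1 := rpow_mul_Gamma_le_Gamma_add hk0 hα.le
  have e : α * ((k + 1 : ℕ) : ℝ) + b = α * k + b + α := by push_cast; ring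
  have hG' : 0 < Real.Gamma (α * k + b + α) := Real.Gamma_pos_of_pos (by linarith)
  rw [e, Real.norm_of_nonneg (by positivity), Real.norm_of_nonneg (by positivity),
    div_le_iff₀ hG']
  have h2 : ((k : ℝ) + 1) ^ α ≤ (α * k + b) ^ α :=
    Real.rpow_le_rpow (by positivity) (by nlinarith [(Nat.cast_nonneg k : (0 : ℝ) ≤ k)])
      (by linarith)
  have h3 : x * ((k : ℝ) + 1) ≤ 1 / 2 * ((k : ℝ) + 1) ^ α := by
    have : ((k : ℝ) + 1) = ((k : ℝ) + 1) ^ (-(α - 1)) * ((k : ℝ) + 1) ^ α := by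
      rw [← Real.rpow_add (by positivity)]; simp
    calc x * ((k : ℝ) + 1) = x * ((k : ℝ) + 1) ^ (-(α - 1)) * ((k : ℝ) + 1) ^ α := by
          rw [mul_assoc, ← this]
      _ ≤ _ := by gcongr
  rw [Nat.factorial_succ, pow_succ]
  push_cast
  calc ((k : ℝ) + 1) * k.factorial * (x ^ k * x)
      = (x * ((k : ℝ) + 1)) * (k.factorial * x ^ k) := by ring
    _ ≤ (1 / 2 * (α * k + b) ^ α) * (k.factorial * x ^ k) := by
        exact mul_le_mul_of_nonneg_right (h3.trans (by gcongr)) (by positivity)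
    _ = 1 / 2 * (k.factorial * x ^ k / Real.Gamma (α * k + b)) *
          ((α * k + b) ^ α * Real.Gamma (α * k + b)) := by field_simp
    _ ≤ _ := by gcongr

theorem summable_pow_div_Gamma {α b x : ℝ} (hα : 1 < α) (hb : 1 ≤ b) (hx : 0 ≤ x) :
    Summable fun k : ℕ => x ^ k / Real.Gamma (α * k + b) := by
  refine (summable_factorial_mul_pow_div_Gamma hα hb hx).of_nonneg_of_le
    (fun k => ?_) (fun k => ?_)
  · have := Real.Gamma_pos_of_pos (by positivity : 0 < α * k + b)
    positivity
  · have := Real.Gamma_pos_of_pos (by positivity : 0 < α * k + b)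
    gcongr
    exact le_mul_of_one_le_left (by positivity) (by exact_mod_cast k.factorial_pos)

/-- The two-parametric Mittag-Leffler function `E_{α,b}`. -/
noncomputable def mittagLeffler₂ (α b : ℝ) (z : ℂ) : ℂ :=
  ∑' k : ℕ, z ^ k / (Real.Gamma (α * k + b) : ℂ)

theorem mittagLeffler₂_one (α : ℝ) (z : ℂ) : mittagLeffler₂ α 1 z = mittagLeffler α z := rfl

theorem norm_pow_div_Gamma {α b : ℝ} (hα : 0 ≤ α) (hb : 0 < b) (z : ℂ) (k : ℕ) :
    ‖z ^ k / (Real.Gamma (α * k + b) : ℂ)‖ = ‖z‖ ^ k / Real.Gamma (α * k + b) := by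
  have := Real.Gamma_pos_of_pos (by positivity : 0 < α * k + b)
  rw [norm_div, norm_pow, Complex.norm_real, Real.norm_of_nonneg this.le]

theorem hasSum_mittagLeffler₂ {α b : ℝ} (hα : 1 < α) (hb : 1 ≤ b) (z : ℂ) :
    HasSum (fun k : ℕ => z ^ k / (Real.Gamma (α * k + b) : ℂ)) (mittagLeffler₂ α b z) := by
  refine Summable.hasSum (Summable.of_norm ?_)
  simp_rw [norm_pow_div_Gamma (by linarith : 0 ≤ α) (by linarith : 0 < b)]
  exact summable_pow_div_Gamma hα hb (norm_nonneg z)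

theorem continuous_mittagLeffler₂ {α b : ℝ} (hα : 1 < α) (hb : 1 ≤ b) :
    Continuous (mittagLeffler₂ α b) := by
  rw [continuous_iff_continuousAt]
  intro z
  have : ContinuousOn (mittagLeffler₂ α b) (Metric.ball 0 (‖z‖ + 1)) := by
    refine continuousOn_tsum (u := fun k : ℕ => (‖z‖ + 1) ^ k / Real.Gamma (α * k + b))
      (fun k => by fun_prop) (summable_pow_div_Gamma hα hb (by positivity)) ?_
    intro k w hw
    rw [norm_pow_div_Gamma (by linarith : 0 ≤ α) (by linarith : 0 < b)]
    have := Real.Gamma_pos_of_pos (by positivity : 0 < α * k + b)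
    rw [mem_ball_zero_iff] at hw
    gcongr
  exact this.continuousAt (Metric.isOpen_ball.mem_nhds (by simp))

/-! ### Decay of a function from its Laplace transform -/

theorem norm_add_mul_I_rpow {c : ℝ} (hc : 0 < c) (μ y : ℝ) :
    ‖(c : ℂ) + y * Complex.I‖ ^ (-μ) = c ^ (-μ) * (1 + ‖y / c‖ ^ 2) ^ (-μ / 2) := by
  have h1 : ‖(c : ℂ) + y * Complex.I‖ = c * (1 + ‖y / c‖ ^ 2) ^ (1 / 2 : ℝ) := by
    rw [Complex.norm_add_mul_I, ← Real.sqrt_eq_rpow, ← Real.sqrt_sq hc.le, ← Real.sqrt_mul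
      (by positivity), Real.sqrt_sq hc.le, Real.norm_eq_abs, sq_abs]
    congr 1
    field_simp
  rw [h1, Real.mul_rpow hc.le (by positivity), ← Real.rpow_mul (by positivity)]
  congr 2
  ring

theorem integrable_norm_add_mul_I_rpow {c μ : ℝ} (hc : 0 < c) (hμ : 1 < μ) :
    Integrable fun y : ℝ => ‖(c : ℂ) + y * Complex.I‖ ^ (-μ) := by
  simp_rw [norm_add_mul_I_rpow hc]
  refine Integrable.const_mul ?_ _
  exact (integrable_rpow_neg_one_add_norm_sq (E := ℝ) (by simpa using hμ)).comp_div hc.ne'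

theorem integral_norm_add_mul_I_rpow {c : ℝ} (hc : 0 < c) (μ : ℝ) :
    ∫ y : ℝ, ‖(c : ℂ) + y * Complex.I‖ ^ (-μ) =
      c ^ (1 - μ) * ∫ y : ℝ, (1 + ‖y‖ ^ 2) ^ (-μ / 2) := by
  simp_rw [norm_add_mul_I_rpow hc]
  rw [integral_const_mul, Measure.integral_comp_div (fun y : ℝ => (1 + ‖y‖ ^ 2) ^ (-μ / 2)) c,
    abs_of_pos hc, smul_eq_mul, ← mul_assoc, ← Real.rpow_add_one hc.ne']
  ring_nf

theorem integrable_vertical {G : ℂ → ℂ} {B μ c : ℝ} (hc : 0 < c) (hμ : 1 < μ)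
    (hG : ContinuousOn G {p | 0 < p.re}) (hB : ∀ p : ℂ, p.re = c → ‖G p‖ ≤ B * ‖p‖ ^ (-μ)) :
    Integrable fun y : ℝ => G ((c : ℂ) + y * Complex.I) := by
  have hcont : Continuous fun y : ℝ => G ((c : ℂ) + y * Complex.I) :=
    hG.comp_continuous (by fun_prop) (by intro y; simpa using hc)
  exact ((integrable_norm_add_mul_I_rpow hc hμ).const_mul B).mono' hcont.aestronglyMeasurable
    (Eventually.of_forall fun y => hB _ (by simp))

/-- Cauchy's theorem on the rectangle between the lines, whose horizontal sides vanish in the limit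
by the decay of ‖p‖^{-μ}. -/
theorem integral_vertical_eq {G : ℂ → ℂ} {B μ c₁ c₂ : ℝ} (hc₁ : 0 < c₁) (hc : c₁ ≤ c₂)
    (hμ : 1 < μ) (hG : DifferentiableOn ℂ G {p | 0 < p.re})
    (hB : ∀ p : ℂ, p.re ∈ Icc c₁ c₂ → ‖G p‖ ≤ B * ‖p‖ ^ (-μ)) :
    ∫ y : ℝ, G ((c₁ : ℂ) + y * Complex.I) = ∫ y : ℝ, G ((c₂ : ℂ) + y * Complex.I) := by
  have hc₂ : 0 < c₂ := hc₁.trans_le hc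
  have hi₁ := integrable_vertical hc₁ hμ hG.continuousOn
    (fun p hp => hB p (by rw [hp]; exact ⟨le_rfl, hc⟩))
  have hi₂ := integrable_vertical hc₂ hμ hG.continuousOn
    (fun p hp => hB p (by rw [hp]; exact ⟨hc, le_rfl⟩))
  have l₁ := intervalIntegral_tendsto_integral hi₁ tendsto_neg_atTop_atBot tendsto_id
  have l₂ := intervalIntegral_tendsto_integral hi₂ tendsto_neg_atTop_atBot tendsto_id
  have hB0 : 0 ≤ B := by
    have := (norm_nonneg _).trans (hB c₁ (by simpa using hc))
    refine nonneg_of_mul_nonneg_left this (Real.rpow_pos_of_pos ?_ _)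
    simpa using hc₁.ne'
  have hor : ∀ σ : ℝ, |σ| = 1 → Tendsto (fun T : ℝ => ∫ x in c₁..c₂,
      G ((x : ℂ) + (σ * T : ℝ) * Complex.I)) atTop (𝓝 0) := by
    intro σ hσ
    have hlim : Tendsto (fun T : ℝ => B * T ^ (-μ) * |c₂ - c₁|) atTop (𝓝 0) := by
      have := ((tendsto_rpow_neg_atTop (by linarith : 0 < μ)).const_mul B).mul_const |c₂ - c₁|
      simpa using this
    refine squeeze_zero_norm' ?_ hlim
    filter_upwards [eventually_gt_atTop 0] with T hT
    refine intervalIntegral.norm_integral_le_of_norm_le_const ?_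
    intro x hx
    rw [uIoc_of_le hc] at hx
    refine (hB _ (by simpa using ⟨hx.1.le, hx.2⟩)).trans ?_
    refine mul_le_mul_of_nonneg_left ?_ hB0
    refine Real.rpow_le_rpow_of_nonpos hT ?_ (by linarith)
    calc T = |((x : ℂ) + (σ * T : ℝ) * Complex.I).im| := by
          simp [abs_mul, hσ, abs_of_pos hT]
      _ ≤ _ := Complex.abs_im_le_norm _
  have rect : ∀ T : ℝ, (∫ x in c₁..c₂, G ((x : ℂ) + ((-1) * T : ℝ) * Complex.I)) -
      (∫ x in c₁..c₂, G ((x : ℂ) + (1 * T : ℝ) * Complex.I)) +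
      Complex.I * (∫ y in (-T)..T, G ((c₂ : ℂ) + y * Complex.I)) -
      Complex.I * (∫ y in (-T)..T, G ((c₁ : ℂ) + y * Complex.I)) = 0 := by
    intro T
    have := Complex.integral_boundary_rect_eq_zero_of_differentiableOn G
      ⟨c₁, -T⟩ ⟨c₂, T⟩ (hG.mono ?_)
    · simpa using this
    · intro p hp
      have := (Complex.mem_reProdIm.1 hp).1
      simp only [uIcc_of_le hc] at this
      exact hc₁.trans_le this.1
  have lim := (((hor (-1) (by simp)).sub (hor 1 (by simp))).add
    (l₂.const_mul Complex.I)).sub (l₁.const_mul Complex.I)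
  have h0 := tendsto_nhds_unique (lim.congr fun T => rect T) tendsto_const_nhds
  have h1 : Complex.I * ((∫ y : ℝ, G ((c₂ : ℂ) + y * Complex.I)) -
      ∫ y : ℝ, G ((c₁ : ℂ) + y * Complex.I)) = 0 := by
    linear_combination h0
  rcases mul_eq_zero.1 h1 with h | h
  · exact absurd h Complex.I_ne_zero
  · exact (sub_eq_zero.1 h).symm

/-- Fourier inversion on Re p = c₁ represents T, and analyticity lets the line be moved to Re p =
1/t. There |e^{pt}| = e, and rescaling p by 1/t turns the bound ‖p‖^{-μ} into t^{μ-1}. Because μ > 1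
all integrals converge absolutely, and Q is needed only on the open half-plane. -/
theorem norm_le_rpow_of_laplace {T : ℝ → ℂ} {Q : ℂ → ℂ} {C μ c₁ : ℝ} (hμ : 1 < μ)
    (hT : Continuous T) (hT0 : ∀ t ≤ 0, T t = 0) (hc₁ : 0 < c₁)
    (hint : IntegrableOn (fun t : ℝ => Complex.exp (-c₁ * t) * T t) (Ioi 0))
    (hL : ∀ p : ℂ, p.re = c₁ → ∫ t in Ioi (0 : ℝ), Complex.exp (-p * t) * T t = Q p)
    (hQ : DifferentiableOn ℂ Q {p | 0 < p.re})
    (hQC : ∀ p : ℂ, 0 < p.re → ‖Q p‖ ≤ C * ‖p‖ ^ (-μ)) :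
    ∃ C' : ℝ, ∀ t > 0, ‖T t‖ ≤ C' * t ^ (μ - 1) := by
  have hC0 : 0 ≤ C := by
    have := (norm_nonneg _).trans (hQC 1 (by simp))
    simpa using this
  set f : ℝ → ℂ := fun t => Complex.exp (-c₁ * t) * T t with hf
  have hfc : Continuous f := by fun_prop
  have hfi : Integrable f := by
    rw [← integrableOn_univ, ← Iic_union_Ioi (a := (0 : ℝ))]
    refine IntegrableOn.union ?_ hint
    refine IntegrableOn.congr_fun (f := fun _ => (0 : ℂ)) integrableOn_zero ?_ measurableSet_Iic
    intro t ht
    simp [hf, hT0 t ht]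
  have hF : ∀ ξ : ℝ, FourierTransform.fourier f ξ =
      Q ((c₁ : ℂ) + (2 * Real.pi * ξ : ℝ) * Complex.I) := by
    intro ξ
    rw [← hL _ (by simp), Real.fourier_eq']
    rw [← integral_indicator measurableSet_Ioi]
    refine integral_congr_ae (Eventually.of_forall fun t => ?_)
    by_cases ht : 0 < t
    · simp only [hf, indicator_of_mem (mem_Ioi.2 ht), smul_eq_mul, ← mul_assoc, ← Complex.exp_add]
      congr 2
      simp
      ring
    · simp only [hf, indicator_of_notMem (notMem_Ioi.2 (not_lt.1 ht)), hT0 t (not_lt.1 ht)]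
      simp
  have hFi : Integrable (FourierTransform.fourier f) := by
    have := (integrable_vertical hc₁ hμ hQ.continuousOn
      (fun p hp => hQC p (by rw [hp]; exact hc₁))).comp_mul_left'
      (R := 2 * Real.pi) (by positivity)
    exact this.congr (Eventually.of_forall fun ξ => by simp [hF ξ])
  have hinv : ∀ t : ℝ, T t = (1 / (2 * Real.pi) : ℂ) *
      ∫ y : ℝ, Complex.exp (((c₁ : ℂ) + y * Complex.I) * t) * Q ((c₁ : ℂ) + y * Complex.I) := by
    intro t
    have h1 : f t = ∫ ξ : ℝ, Complex.exp (((2 * Real.pi * ξ : ℝ) : ℂ) * Complex.I * t) *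
        Q ((c₁ : ℂ) + (2 * Real.pi * ξ : ℝ) * Complex.I) := by
      rw [← congrFun (hfc.fourierInv_fourier_eq hfi hFi) t, Real.fourierInv_eq']
      refine integral_congr_ae (Eventually.of_forall fun ξ => ?_)
      simp only [hF, smul_eq_mul]
      congr 2
      simp
      ring
    have h2 := Measure.integral_comp_mul_left (fun y : ℝ => Complex.exp ((y : ℂ) * Complex.I * t) *
        Q ((c₁ : ℂ) + y * Complex.I)) (2 * Real.pi)
    rw [h2, abs_of_pos (by positivity)] at h1
    have h3 : T t = Complex.exp (c₁ * t) * f t := by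
      rw [hf, ← mul_assoc, ← Complex.exp_add]; simp
    rw [h3, h1, Complex.real_smul, mul_left_comm, ← integral_const_mul]
    push_cast
    rw [inv_eq_one_div]
    congr 1
    refine integral_congr_ae (Eventually.of_forall fun ξ => ?_)
    simp only
    rw [← mul_assoc, ← Complex.exp_add]
    ring_nf
  refine ⟨1 / (2 * Real.pi) * (Real.exp 1 * C * ∫ y : ℝ, (1 + ‖y‖ ^ 2) ^ (-μ / 2)), ?_⟩
  intro t ht
  set G : ℂ → ℂ := fun p => Complex.exp (p * t) * Q p with hG
  have hGd : DifferentiableOn ℂ G {p | 0 < p.re} := by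
    refine DifferentiableOn.mul ?_ hQ
    fun_prop
  have hGn : ∀ c : ℝ, ∀ p : ℂ, 0 < p.re → p.re ≤ c →
      ‖G p‖ ≤ (Real.exp (c * t) * C) * ‖p‖ ^ (-μ) := by
    intro c p hp hpc
    rw [hG, norm_mul, Complex.norm_exp, mul_assoc]
    have : (p * t).re = p.re * t := by simp
    rw [this]
    gcongr
    exact hQC p hp
  have ht' : 0 < t⁻¹ := inv_pos.2 ht
  -- The new line may lie on either side of c₁, depending on t.
  have shift : ∫ y : ℝ, G ((c₁ : ℂ) + y * Complex.I) =
      ∫ y : ℝ, G (((t⁻¹ : ℝ) : ℂ) + y * Complex.I) := by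
    rcases le_total c₁ t⁻¹ with h | h
    · exact integral_vertical_eq hc₁ h hμ hGd fun p hp => hGn t⁻¹ p (hc₁.trans_le hp.1) hp.2
    · exact (integral_vertical_eq ht' h hμ hGd fun p hp => hGn c₁ p (ht'.trans_le hp.1) hp.2).symm
  have hbd : ‖∫ y : ℝ, G (((t⁻¹ : ℝ) : ℂ) + y * Complex.I)‖ ≤
      Real.exp 1 * C * (t ^ (μ - 1) * ∫ y : ℝ, (1 + ‖y‖ ^ 2) ^ (-μ / 2)) := by
    have e : t ^ (μ - 1) = (t⁻¹) ^ (1 - μ) := by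
      rw [Real.inv_rpow ht.le, ← Real.rpow_neg ht.le]; ring_nf
    rw [e, ← integral_norm_add_mul_I_rpow ht', ← integral_const_mul]
    refine norm_integral_le_of_norm_le ((integrable_norm_add_mul_I_rpow ht' hμ).const_mul _)
      (Eventually.of_forall fun y => ?_)
    have := hGn t⁻¹ (((t⁻¹ : ℝ) : ℂ) + y * Complex.I) (by simpa using ht) (by simp)
    rwa [inv_mul_cancel₀ ht.ne'] at this
  rw [hinv t, norm_mul, shift]
  have hn : ‖(1 / (2 * Real.pi) : ℂ)‖ = 1 / (2 * Real.pi) := by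
    simp [abs_of_pos Real.pi_pos]
  rw [hn, mul_assoc]
  refine mul_le_mul_of_nonneg_left (hbd.trans (le_of_eq ?_)) (by positivity)
  ring

/-! ### Laplace transforms of powers and of Mittag-Leffler functions -/

theorem isOpen_re_pos : IsOpen {p : ℂ | 0 < p.re} := isOpen_lt continuous_const Complex.continuous_re

theorem eq_of_eq_on_pos_reals {f g : ℂ → ℂ} (hf : DifferentiableOn ℂ f {p | 0 < p.re})
    (hg : DifferentiableOn ℂ g {p | 0 < p.re}) (h : ∀ x : ℝ, 0 < x → f x = g x) {p : ℂ}
    (hp : 0 < p.re) : f p = g p := by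
  have hconv : IsPreconnected {p : ℂ | 0 < p.re} :=
    (convex_halfSpace_re_gt 0).isPreconnected
  refine (hf.analyticOnNhd isOpen_re_pos).eqOn_of_preconnected_of_frequently_eq
    (hg.analyticOnNhd isOpen_re_pos) hconv (z₀ := ((1 : ℝ) : ℂ)) (by simp) ?_ hp
  have ht : Tendsto (fun x : ℝ => (x : ℂ)) (𝓝[≠] 1) (𝓝[≠] ((1 : ℝ) : ℂ)) := by
    refine tendsto_nhdsWithin_of_tendsto_nhds_of_eventually_within _
      (Complex.continuous_ofReal.continuousAt.tendsto.mono_left nhdsWithin_le_nhds) ?_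
    filter_upwards [self_mem_nhdsWithin] with x hx
    simpa using hx
  refine ht.frequently (Eventually.frequently ?_)
  filter_upwards [nhdsWithin_le_nhds (lt_mem_nhds (zero_lt_one' ℝ))] with x hx
  exact h x hx

theorem integrableOn_rpow_mul_exp_neg_mul {s c : ℝ} (hs : -1 < s) (hc : 0 < c) :
    IntegrableOn (fun t : ℝ => t ^ s * Real.exp (-(c * t))) (Ioi 0) := by
  have := integrableOn_rpow_mul_exp_neg_mul_rpow hs one_pos hc
  simpa using this

theorem norm_exp_neg_mul_rpow {p : ℂ} {s t : ℝ} (ht : 0 < t) :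
    ‖Complex.exp (-p * t) * ((t ^ s : ℝ) : ℂ)‖ = t ^ s * Real.exp (-(p.re * t)) := by
  have h1 : 0 ≤ t ^ s := Real.rpow_nonneg ht.le _
  rw [norm_mul, Complex.norm_exp, Complex.norm_real, Real.norm_of_nonneg h1, mul_comm]
  congr 2
  simp

theorem continuousOn_exp_neg_mul_rpow (p : ℂ) (s : ℝ) :
    ContinuousOn (fun t : ℝ => Complex.exp (-p * t) * ((t ^ s : ℝ) : ℂ)) (Ioi 0) := by
  refine ContinuousOn.mul (by fun_prop) ?_
  exact Complex.continuous_ofReal.comp_continuousOn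
    (continuousOn_id.rpow_const fun t ht => Or.inl (ne_of_gt ht))

theorem integrableOn_exp_neg_mul_rpow {p : ℂ} {s : ℝ} (hs : -1 < s) (hp : 0 < p.re) :
    IntegrableOn (fun t : ℝ => Complex.exp (-p * t) * ((t ^ s : ℝ) : ℂ)) (Ioi 0) := by
  refine Integrable.mono' (integrableOn_rpow_mul_exp_neg_mul hs hp)
    ((continuousOn_exp_neg_mul_rpow p s).aestronglyMeasurable measurableSet_Ioi) ?_
  filter_upwards [ae_restrict_mem measurableSet_Ioi] with t ht
  exact (norm_exp_neg_mul_rpow ht).le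

theorem integral_norm_exp_neg_mul_rpow {p : ℂ} {a : ℝ} (ha : 0 < a) (hp : 0 < p.re) :
    ∫ t in Ioi (0 : ℝ), ‖Complex.exp (-p * t) * ((t ^ (a - 1) : ℝ) : ℂ)‖ =
      (1 / p.re) ^ a * Real.Gamma a := by
  rw [← Real.integral_rpow_mul_exp_neg_mul_Ioi ha hp]
  exact setIntegral_congr_fun measurableSet_Ioi fun t ht => norm_exp_neg_mul_rpow ht

/-- Both sides are holomorphic in the right half-plane, so the identity theorem reduces the claim to
the Gamma integral for real p. -/
theorem laplace_rpow {p : ℂ} {a : ℝ} (ha : 0 < a) (hp : 0 < p.re) :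
    ∫ t in Ioi (0 : ℝ), Complex.exp (-p * t) * ((t ^ (a - 1) : ℝ) : ℂ) =
      p ^ (-a : ℂ) * Real.Gamma a := by
  refine eq_of_eq_on_pos_reals (f := fun p => ∫ t in Ioi (0 : ℝ),
    Complex.exp (-p * t) * ((t ^ (a - 1) : ℝ) : ℂ)) (g := fun p => p ^ (-a : ℂ) * Real.Gamma a)
    ?_ ?_ ?_ hp
  · intro q hq
    have hq : 0 < q.re := hq
    refine DifferentiableAt.differentiableWithinAt (HasDerivAt.differentiableAt
      (hasDerivAt_integral_of_dominated_loc_of_deriv_le (s := {p : ℂ | q.re / 2 < p.re})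
      (F' := fun p (t : ℝ) => -t * Complex.exp (-p * t) * ((t ^ (a - 1) : ℝ) : ℂ))
      (bound := fun t : ℝ => t ^ a * Real.exp (-(q.re / 2 * t)))
      ?_ ?_ ?_ ?_ ?_ ?_ ?_).2)
    · exact (isOpen_lt continuous_const Complex.continuous_re).mem_nhds (half_lt_self hq)
    · exact Eventually.of_forall fun p =>
        (continuousOn_exp_neg_mul_rpow p _).aestronglyMeasurable measurableSet_Ioi
    · exact integrableOn_exp_neg_mul_rpow (by linarith) hq
    · refine ContinuousOn.aestronglyMeasurable ?_ measurableSet_Ioi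
      simp_rw [mul_assoc]
      exact ContinuousOn.mul (by fun_prop) (continuousOn_exp_neg_mul_rpow q _)
    · filter_upwards [ae_restrict_mem measurableSet_Ioi] with t ht p hp
      have ht : 0 < t := ht
      rw [mul_assoc, norm_mul, norm_exp_neg_mul_rpow ht, norm_neg, Complex.norm_real,
        Real.norm_of_nonneg ht.le, ← mul_assoc, mul_comm t, ← Real.rpow_add_one ht.ne']
      have : q.re / 2 ≤ p.re := le_of_lt hp
      simp only [sub_add_cancel]
      gcongr
    · exact integrableOn_rpow_mul_exp_neg_mul (by linarith) (half_pos hq)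
    · refine Eventually.of_forall fun t p _ => ?_
      have : HasDerivAt (fun p : ℂ => Complex.exp (-p * t)) (Complex.exp (-p * t) * (-1 * t)) p :=
        (((hasDerivAt_id p).neg).mul_const (t : ℂ)).cexp
      convert! this.mul_const _ using 1
      ring
  · intro q hq
    have : q ∈ Complex.slitPlane := Or.inl hq
    exact (((differentiableAt_id).cpow_const this).mul_const _).differentiableWithinAt
  · intro x hx
    have h1 := Complex.integral_cpow_mul_exp_neg_mul_Ioi (a := a) (by simpa using ha) hx
    rw [Complex.Gamma_ofReal] at h1
    rw [Complex.cpow_neg, ← Complex.inv_cpow _ _ (by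
      rw [Complex.arg_ofReal_of_nonneg hx.le]; exact Real.pi_pos.ne), ← one_div, ← h1]
    refine setIntegral_congr_fun measurableSet_Ioi fun t ht => ?_
    have ht : 0 < t := ht
    rw [Complex.ofReal_cpow ht.le]
    push_cast
    ring_nf

theorem integrable_of_hasSum_of_summable_integral_norm {X ι : Type*} [MeasurableSpace X]
    [Countable ι] {μ : Measure X} {F : ι → X → ℂ} {f : X → ℂ} (hF : ∀ i, Integrable (F i) μ)
    (hs : Summable fun i => ∫ x, ‖F i x‖ ∂μ) (hf : AEStronglyMeasurable f μ)
    (hsum : ∀ᵐ x ∂μ, HasSum (fun i => F i x) (f x)) : Integrable f μ := by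
  refine ⟨hf, ?_⟩
  calc ∫⁻ x, ‖f x‖ₑ ∂μ ≤ ∫⁻ x, ∑' i, ‖F i x‖ₑ ∂μ := by
        refine lintegral_mono_ae ?_
        filter_upwards [hsum] with x hx
        rw [← hx.tsum_eq]
        exact enorm_tsum_le_tsum_enorm
    _ = ∑' i, ENNReal.ofReal (∫ x, ‖F i x‖ ∂μ) := by
        rw [lintegral_tsum fun i => (hF i).1.enorm]
        exact tsum_congr fun i => (ofReal_integral_norm_eq_lintegral_enorm (hF i)).symm
    _ < ∞ := hs.tsum_ofReal_lt_top

/-- The function `t ^ b E_{α,b}(z t ^ α)`, extended by `0` to the negative half-line. -/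
noncomputable def mlPower (α b : ℝ) (z : ℂ) (t : ℝ) : ℂ :=
  ((max t 0 ^ b : ℝ) : ℂ) * mittagLeffler₂ α b (z * ((max t 0 ^ α : ℝ) : ℂ))

theorem mlPower_of_nonpos {α b : ℝ} (hb : 0 < b) (z : ℂ) {t : ℝ} (ht : t ≤ 0) :
    mlPower α b z t = 0 := by
  simp [mlPower, max_eq_right ht, Real.zero_rpow hb.ne']

theorem mlPower_of_pos {α b : ℝ} (z : ℂ) {t : ℝ} (ht : 0 < t) :
    mlPower α b z t = ((t ^ b : ℝ) : ℂ) * mittagLeffler₂ α b (z * ((t ^ α : ℝ) : ℂ)) := by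
  rw [mlPower, max_eq_left ht.le]

theorem continuous_mlPower {α b : ℝ} (hα : 1 < α) (hb : 1 ≤ b) (z : ℂ) :
    Continuous (mlPower α b z) := by
  have h : ∀ s : ℝ, 0 ≤ s → Continuous fun t : ℝ => ((max t 0 ^ s : ℝ) : ℂ) := fun s hs =>
    Complex.continuous_ofReal.comp
      ((continuous_id.max continuous_const).rpow_const fun t => Or.inr hs)
  exact (h b (by linarith)).mul
    ((continuous_mittagLeffler₂ hα hb).comp (continuous_const.mul (h α (by linarith))))

/-- The Laplace transform of `t ^ b E_{α,b}(z t ^ α)`. -/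
noncomputable def mlLaplace (α b : ℝ) (z p : ℂ) : ℂ :=
  p ^ ((α - b - 1 : ℝ) : ℂ) * (b * p ^ (α : ℂ) + (α - b) * z) / (p ^ (α : ℂ) - z) ^ 2

/-- The series is transformed term by term, and ‖z‖ < c^α makes the result converge like a geometric
series. The function t^{b-1}E_{α,b}(z t^α) has transform p^{α-b}/(p^α - z); the extra factor t
replaces it by minus its derivative, whence the square in the denominator and the weights αk + b.
The extra power makes the function vanish continuously at 0 and its transform O(|p|^{-b-1}),
absolutely integrable on vertical lines already for b = 1. -/
theorem laplace_mlPower {α b c : ℝ} (hα : 1 < α) (hb : 1 ≤ b) {z : ℂ} (hc : 0 < c)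
    (hzc : ‖z‖ < c ^ α) :
    IntegrableOn (fun t : ℝ => Complex.exp (-c * t) * mlPower α b z t) (Ioi 0) ∧
    ∀ p : ℂ, p.re = c →
      ∫ t in Ioi (0 : ℝ), Complex.exp (-p * t) * mlPower α b z t = mlLaplace α b z p := by
  set F : ℂ → ℕ → ℝ → ℂ := fun p k t => (z ^ k / (Real.Gamma (α * k + b) : ℂ)) *
    (Complex.exp (-p * t) * ((t ^ (α * k + b + 1 - 1) : ℝ) : ℂ)) with hF
  have hpos : ∀ k : ℕ, 0 < α * k + b := fun k => by positivity
  have hsum : ∀ p : ℂ, ∀ t ∈ Ioi (0 : ℝ),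
      HasSum (fun k => F p k t) (Complex.exp (-p * t) * mlPower α b z t) := by
    intro p t ht
    rw [mlPower_of_pos z ht, ← mul_assoc]
    convert! (hasSum_mittagLeffler₂ hα hb (z * ((t ^ α : ℝ) : ℂ))).mul_left
      (Complex.exp (-p * t) * ((t ^ b : ℝ) : ℂ)) using 2 with k
    have : t ^ (α * k + b + 1 - 1) = t ^ b * (t ^ α) ^ k := by
      rw [← Real.rpow_natCast, ← Real.rpow_mul (le_of_lt ht), ← Real.rpow_add ht]
      ring_nf
    simp only [hF, this, mul_pow]
    push_cast
    ring
  have hFi : ∀ p : ℂ, p.re = c → ∀ k, IntegrableOn (F p k) (Ioi 0) := by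
    intro p hp k
    exact (integrableOn_exp_neg_mul_rpow (by linarith [hpos k]) (by rw [hp]; exact hc)).const_mul _
  have hGam : ∀ k : ℕ, Real.Gamma (α * k + b + 1) = (α * k + b) * Real.Gamma (α * k + b) :=
    fun k => Real.Gamma_add_one (hpos k).ne'
  have hx : ‖z‖ * c ^ (-α) < 1 := by
    rw [Real.rpow_neg hc.le, mul_inv_lt_iff₀ (Real.rpow_pos_of_pos hc _), one_mul]; exact hzc
  have hsm : ∀ p : ℂ, p.re = c → Summable fun k => ∫ t in Ioi (0 : ℝ), ‖F p k t‖ := by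
    intro p hp
    have hx' : ‖(‖z‖ * c ^ (-α) : ℝ)‖ < 1 := by rwa [Real.norm_of_nonneg (by positivity)]
    have h1 := (((hasSum_coe_mul_geometric_of_norm_lt_one hx').summable.mul_left α).add
      ((hasSum_geometric_of_norm_lt_one hx').summable.mul_left b)).mul_left (c ^ (-(b + 1)))
    refine h1.congr fun k => ?_
    simp only [hF, norm_mul _ (_ * _)]
    rw [integral_const_mul, integral_norm_exp_neg_mul_rpow (by linarith [hpos k])
      (by rw [hp]; exact hc), norm_pow_div_Gamma (by linarith) (by linarith), hGam, hp, one_div,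
      Real.inv_rpow hc.le, ← Real.rpow_neg hc.le]
    have hG := Real.Gamma_pos_of_pos (hpos k)
    have e : c ^ (-(α * k + b + 1)) = c ^ (-(b + 1)) * (c ^ (-α)) ^ k := by
      rw [← Real.rpow_natCast, ← Real.rpow_mul hc.le, ← Real.rpow_add hc]
      ring_nf
    rw [e, mul_pow]
    field_simp
  refine ⟨?_, ?_⟩
  · refine integrable_of_hasSum_of_summable_integral_norm (hFi c (by simp)) (hsm c (by simp)) ?_ ?_
    · have := continuous_mlPower hα hb z
      exact (by fun_prop : Continuous fun t : ℝ =>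
        Complex.exp (-c * t) * mlPower α b z t).aestronglyMeasurable
    · filter_upwards [ae_restrict_mem measurableSet_Ioi] with t ht
      exact hsum c t ht
  · intro p hp
    have hp0 : 0 < p.re := by rw [hp]; exact hc
    have hpn : p ≠ 0 := fun h => by simp [h] at hp0
    have h1 := hasSum_integral_of_summable_integral_norm (hFi p hp) (hsm p hp)
    have h2 : ∫ t in Ioi (0 : ℝ), ∑' k, F p k t =
        ∫ t in Ioi (0 : ℝ), Complex.exp (-p * t) * mlPower α b z t :=
      setIntegral_congr_fun measurableSet_Ioi fun t ht => (hsum p t ht).tsum_eq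
    rw [h2] at h1
    set P : ℂ := p ^ (α : ℂ) with hP
    have hPn : P ≠ 0 := by simp [hP, Complex.cpow_eq_zero_iff, hpn]
    have hPc : c ^ α ≤ ‖P‖ := by
      rw [hP, Complex.norm_cpow_of_ne_zero hpn]
      simp only [Complex.ofReal_re, Complex.ofReal_im, mul_zero, Real.exp_zero, div_one]
      refine Real.rpow_le_rpow hc.le ?_ (by linarith)
      rw [← hp]
      exact (le_abs_self _).trans (Complex.abs_re_le_norm p)
    have hxz : ‖z * P⁻¹‖ < 1 := by
      rw [norm_mul, norm_inv, mul_inv_lt_iff₀ (norm_pos_iff.2 hPn), one_mul]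
      exact hzc.trans_le hPc
    have hPz : P - z ≠ 0 := by
      intro h
      rw [sub_eq_zero.1 h, mul_inv_cancel₀ (sub_eq_zero.1 h ▸ hPn)] at hxz
      simp at hxz
    have h3 := (((hasSum_coe_mul_geometric_of_norm_lt_one hxz).mul_left (α : ℂ)).add
      ((hasSum_geometric_of_norm_lt_one hxz).mul_left (b : ℂ))).mul_left
      (p ^ (-(b + 1 : ℝ) : ℂ))
    have h4 : (fun k => ∫ t in Ioi (0 : ℝ), F p k t) = fun k : ℕ => p ^ (-(b + 1 : ℝ) : ℂ) *
        ((α : ℂ) * (k * (z * P⁻¹) ^ k) + b * (z * P⁻¹) ^ k) := by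
      funext k
      simp only [hF]
      rw [integral_const_mul, laplace_rpow (by linarith [hpos k]) hp0, hGam]
      have hG : (Real.Gamma (α * k + b) : ℂ) ≠ 0 := by
        exact_mod_cast (Real.Gamma_pos_of_pos (hpos k)).ne'
      have e : p ^ (-(α * k + b + 1 : ℝ) : ℂ) = p ^ (-(b + 1 : ℝ) : ℂ) * (P⁻¹) ^ k := by
        rw [hP, ← Complex.cpow_neg, ← Complex.cpow_nat_mul, ← Complex.cpow_add _ _ hpn]
        congr 1
        push_cast
        ring
      rw [e, mul_pow]
      push_cast
      field_simp
    rw [h4] at h1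
    rw [h1.unique h3, mlLaplace]
    have e2 : p ^ ((α - b - 1 : ℝ) : ℂ) = P * p ^ (-(b + 1 : ℝ) : ℂ) := by
      rw [hP, ← Complex.cpow_add _ _ hpn]
      congr 1
      push_cast
      ring
    have e3 : 1 - z * P⁻¹ = (P - z) / P := by field_simp
    rw [e2, e3, ← hP]
    field_simp
    ring

/-! ### Decay of Mittag-Leffler functions -/

theorem norm_cpow_real {p : ℂ} (hp : p ≠ 0) (s : ℝ) : ‖p ^ (s : ℂ)‖ = ‖p‖ ^ s := by
  rw [Complex.norm_cpow_of_ne_zero hp]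
  simp

/-- The numerator factor is O(1 + |p|^α) and the denominator at least κ(1 + |p|^{2α}). What remains
behaves like |p|^{α-b-1} near 0 and |p|^{-b-1} at infinity, so every intermediate power |p|^{-μ}
dominates it. -/
theorem norm_mlLaplace_le {α b μ κ : ℝ} (hb : 0 ≤ b) (hμ₁ : b + 1 - α ≤ μ)
    (hμ₂ : μ ≤ b + 1) (hκ : 0 < κ) {z p : ℂ} (hz : ‖z‖ ≤ 1) (hp : p ≠ 0)
    (h : κ * (1 + ‖p‖ ^ (2 * α)) ≤ ‖p ^ (α : ℂ) - z‖ ^ 2) :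
    ‖mlLaplace α b z p‖ ≤ 2 * (b + |α - b|) / κ * ‖p‖ ^ (-μ) := by
  have hρ : 0 < ‖p‖ := norm_pos_iff.2 hp
  set x : ℝ := ‖p‖ ^ α with hx
  have hx0 : 0 < x := Real.rpow_pos_of_pos hρ _
  have hx2 : ‖p‖ ^ (2 * α) = x ^ 2 := by
    rw [hx, ← Real.rpow_natCast, ← Real.rpow_mul hρ.le]; ring_nf
  rw [hx2] at h
  have hD : 0 < ‖p ^ (α : ℂ) - z‖ ^ 2 := lt_of_lt_of_le (by positivity) h
  have h1 : ‖(b * p ^ (α : ℂ) + (α - b) * z : ℂ)‖ ≤ (b + |α - b|) * (1 + x) := by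
    calc _ ≤ ‖(b * p ^ (α : ℂ) : ℂ)‖ + ‖((α - b) * z : ℂ)‖ := norm_add_le _ _
      _ = b * x + |α - b| * ‖z‖ := by
          rw [norm_mul, norm_mul, norm_cpow_real hp, Complex.norm_real, Real.norm_of_nonneg hb]
          rw [← Complex.ofReal_sub, Complex.norm_real, Real.norm_eq_abs]
      _ ≤ b * x + |α - b| * 1 := by gcongr
      _ ≤ _ := by nlinarith [abs_nonneg (α - b), mul_nonneg (abs_nonneg (α - b)) hx0.le]
  have h2 : ‖p‖ ^ (α - b - 1 + μ) ≤ 1 + x := by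
    rcases le_total ‖p‖ 1 with h' | h'
    · have := Real.rpow_le_one hρ.le h' (by linarith : 0 ≤ α - b - 1 + μ)
      linarith
    · have := Real.rpow_le_rpow_of_exponent_le h' (by linarith : α - b - 1 + μ ≤ α)
      linarith
  have h3 : ‖p‖ ^ (α - b - 1) ≤ (1 + x) * ‖p‖ ^ (-μ) := by
    calc ‖p‖ ^ (α - b - 1) = ‖p‖ ^ (α - b - 1 + μ) * ‖p‖ ^ (-μ) := by
          rw [← Real.rpow_add hρ]; ring_nf
      _ ≤ _ := by gcongr
  have hb' : 0 ≤ b + |α - b| := by positivity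
  rw [mlLaplace, norm_div, norm_mul, norm_cpow_real hp, norm_pow, div_le_iff₀ hD]
  calc _ ≤ ((1 + x) * ‖p‖ ^ (-μ)) * ((b + |α - b|) * (1 + x)) := by gcongr
    _ = (b + |α - b|) * ‖p‖ ^ (-μ) * (1 + x) ^ 2 := by ring
    _ ≤ (b + |α - b|) * ‖p‖ ^ (-μ) * (2 * (1 + x ^ 2)) := by
        gcongr
        nlinarith [sq_nonneg (1 - x)]
    _ = 2 * (b + |α - b|) / κ * ‖p‖ ^ (-μ) * (κ * (1 + x ^ 2)) := by
        field_simp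
    _ ≤ _ := by gcongr

theorem differentiableOn_mlLaplace {α b : ℝ} {z : ℂ}
    (hz : ∀ p : ℂ, 0 < p.re → p ^ (α : ℂ) ≠ z) :
    DifferentiableOn ℂ (mlLaplace α b z) {p | 0 < p.re} := by
  have hpow : ∀ s : ℂ, DifferentiableOn ℂ (fun p : ℂ => p ^ s) {p : ℂ | 0 < p.re} :=
    fun s p hp => ((differentiableAt_id).cpow_const (Or.inl hp)).differentiableWithinAt
  refine DifferentiableOn.div ?_ ?_ ?_
  · exact (hpow _).mul (((hpow _).const_mul _).add (differentiableOn_const _))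
  · exact ((hpow _).sub (differentiableOn_const _)).pow 2
  · intro p hp
    exact pow_ne_zero 2 (sub_ne_zero.2 (hz p hp))

/-- For Re p > 0 the argument of p^α is below πα/2 in modulus, so it keeps an angle of at least ψ -
πα/2 from e^{iχ}; the law of cosines does the rest. -/
theorem sq_norm_cpow_sub_ge {α ψ χ : ℝ} (hα : 0 < α) (hψ : Real.pi * α / 2 < ψ) (hψπ : ψ ≤ Real.pi)
    (hχ : |χ| = ψ) {p : ℂ} (hp : 0 < p.re) :
    (1 - Real.cos (ψ - Real.pi * α / 2)) / 2 * (1 + ‖p‖ ^ (2 * α)) ≤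
      ‖p ^ (α : ℂ) - Complex.exp (χ * Complex.I)‖ ^ 2 := by
  have hpi := Real.pi_pos
  have hpn : p ≠ 0 := fun h => by simp [h] at hp
  have hρ : 0 < ‖p‖ := norm_pos_iff.2 hpn
  set x : ℝ := ‖p‖ ^ α with hx
  have hx0 : 0 < x := Real.rpow_pos_of_pos hρ _
  have hx2 : ‖p‖ ^ (2 * α) = x ^ 2 := by
    rw [hx, ← Real.rpow_natCast, ← Real.rpow_mul hρ.le]; ring_nf
  set β : ℝ := p.arg * α with hβ
  have hβ' : |β| < Real.pi * α / 2 := by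
    have := Complex.abs_arg_lt_pi_div_two_iff.2 (Or.inl hp)
    rw [hβ, abs_mul, abs_of_pos hα]
    nlinarith
  have hcos : Real.cos (β - χ) ≤ Real.cos (ψ - Real.pi * α / 2) := by
    have hl : ψ - Real.pi * α / 2 ≤ |β - χ| := by
      have := abs_sub_abs_le_abs_sub χ β
      rw [abs_sub_comm χ β, hχ] at this
      linarith
    -- Angles count modulo 2π: this bound, which uses ψ ≤ π, keeps β - χ away from ±2π as well as
    -- from 0.
    have hu : |β - χ| ≤ 2 * Real.pi - (ψ - Real.pi * α / 2) := by
      have := abs_sub β χ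
      rw [hχ] at this
      linarith
    rw [← Real.cos_abs (β - χ)]
    rcases le_total |β - χ| Real.pi with h | h
    · exact Real.cos_le_cos_of_nonneg_of_le_pi (by linarith) h hl
    · rw [← Real.cos_two_pi_sub]
      exact Real.cos_le_cos_of_nonneg_of_le_pi (by linarith) (by linarith) (by linarith)
  have hn : ‖p ^ (α : ℂ) - Complex.exp (χ * Complex.I)‖ ^ 2 =
      x ^ 2 + 1 - 2 * x * Real.cos (β - χ) := by
    rw [Complex.cpow_ofReal, ← hx, ← hβ, Complex.exp_mul_I, ← Complex.ofReal_cos,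
      ← Complex.ofReal_sin, ← Complex.normSq_eq_norm_sq, Complex.normSq_apply, Real.cos_sub]
    simp only [Complex.sub_re, Complex.sub_im, Complex.mul_re, Complex.mul_im, Complex.add_re,
      Complex.add_im, Complex.ofReal_re, Complex.ofReal_im, Complex.I_re, Complex.I_im]
    have h1 := Real.sin_sq_add_cos_sq β
    have h2 := Real.sin_sq_add_cos_sq χ
    linear_combination x ^ 2 * h1 + h2
  rw [hn, hx2]
  nlinarith [mul_le_mul_of_nonneg_left hcos hx0.le,
    mul_nonneg (sub_nonneg.2 (Real.cos_le_one (ψ - Real.pi * α / 2))) hx0.le,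
    mul_nonneg (sub_nonneg.2 (Real.neg_one_le_cos (ψ - Real.pi * α / 2))) (sq_nonneg (x - 1))]

/-- With arg z = χ beyond πα/2 in modulus, the denominator p^α - z of the transform stays away from
zero on the right half-plane, so the Laplace bound applies. The exponent μ is left free: μ < b + 1
expresses decay of E_{α,b} along the ray of direction e^{iχ}. -/
theorem norm_mlPower_le {α b ψ χ μ : ℝ} (hα₁ : 1 < α) (hb : 1 ≤ b)
    (hψ : Real.pi * α / 2 < ψ) (hψπ : ψ ≤ Real.pi) (hχ : |χ| = ψ) (hμ : 1 < μ)
    (hμ₁ : b + 1 - α ≤ μ) (hμ₂ : μ ≤ b + 1) :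
    ∃ C : ℝ, ∀ t > 0, ‖mlPower α b (Complex.exp (χ * Complex.I)) t‖ ≤ C * t ^ (μ - 1) := by
  have hpi := Real.pi_pos
  have hz : ‖Complex.exp (χ * Complex.I)‖ = 1 := Complex.norm_exp_ofReal_mul_I χ
  have hκ : 0 < (1 - Real.cos (ψ - Real.pi * α / 2)) / 2 := by
    have hαpos : 0 < Real.pi * α := by positivity
    have := Real.cos_lt_cos_of_nonneg_of_le_pi (x := 0) (y := ψ - Real.pi * α / 2) le_rfl
      (by linarith) (by linarith)
    rw [Real.cos_zero] at this
    linarith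
  have hge := fun {p : ℂ} (hp : 0 < p.re) =>
    sq_norm_cpow_sub_ge (by linarith : 0 < α) hψ hψπ hχ hp
  have hL := laplace_mlPower hα₁ hb (c := 2) (z := Complex.exp (χ * Complex.I)) two_pos
    (by rw [hz]; exact Real.one_lt_rpow one_lt_two (by linarith))
  refine norm_le_rpow_of_laplace (Q := mlLaplace α b (Complex.exp (χ * Complex.I)))
    (C := 2 * (b + |α - b|) / ((1 - Real.cos (ψ - Real.pi * α / 2)) / 2)) hμ
    (continuous_mlPower hα₁ hb _)
    (fun t ht => mlPower_of_nonpos (by linarith) _ ht) two_pos hL.1 hL.2 ?_ ?_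
  · refine differentiableOn_mlLaplace fun p hp h => ?_
    have := hge hp
    rw [h] at this
    simp only [sub_self, norm_zero] at this
    have h2 : 0 < (1 - Real.cos (ψ - Real.pi * α / 2)) / 2 * (1 + ‖p‖ ^ (2 * α)) := by positivity
    linarith [this, h2, zero_pow (M₀ := ℝ) (n := 2) (by norm_num)]
  · intro p hp
    exact norm_mlLaplace_le (by linarith) hμ₁ hμ₂ hκ hz.le
      (fun h => by simp [h] at hp) (hge hp)

/-! ### Asymptotics of the oscillation -/

/-- In the closed right half-plane arguments differ from π/2 by at most π, and α < 2 keeps the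
difference of the exponents below 2π, so the logarithms must coincide. Hence i is the only zero of
p^α - i^α there. -/
theorem cpow_eq_I_cpow {α : ℝ} (hα₁ : 0 < α) (hα₂ : α < 2) {p : ℂ} (hp : p ≠ 0) (hre : 0 ≤ p.re)
    (h : p ^ (α : ℂ) = Complex.I ^ (α : ℂ)) : p = Complex.I := by
  have hpi := Real.pi_pos
  rw [Complex.cpow_def_of_ne_zero hp, Complex.cpow_def_of_ne_zero Complex.I_ne_zero,
    Complex.exp_eq_exp_iff_exists_int] at h
  obtain ⟨m, hm⟩ := h
  have him := congrArg Complex.im hm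
  simp only [Complex.mul_im, Complex.log_im, Complex.ofReal_re, Complex.ofReal_im, mul_zero,
    add_zero, zero_add, Complex.arg_I, Complex.add_im, Complex.intCast_re, Complex.intCast_im,
    zero_mul, Complex.mul_re, Complex.I_im, Complex.I_re, mul_one, sub_zero,
    Complex.re_ofNat, Complex.im_ofNat, Complex.log_re] at him
  have harg := abs_le.1 (Complex.abs_arg_le_pi_div_two_iff.2 hre)
  have hm0 : m = 0 := by
    have h1 : (m : ℝ) * (2 * Real.pi) = (p.arg - Real.pi / 2) * α := by linarith
    have h2 : (m : ℝ) < 1 := by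
      by_contra hc
      push Not at hc
      nlinarith [mul_nonneg (sub_nonneg.2 hc) hpi.le, mul_nonneg (sub_nonneg.2 harg.2) hα₁.le]
    have h3 : (-1 : ℝ) < m := by
      by_contra hc
      push Not at hc
      nlinarith [mul_nonneg (sub_nonneg.2 hc) hpi.le, mul_nonneg (sub_nonneg.2 harg.1) hα₁.le,
        mul_pos hpi (sub_pos.2 hα₂)]
    have h2' : m < 1 := by exact_mod_cast h2
    have h3' : -1 < m := by exact_mod_cast h3
    omega
  rw [hm0] at hm
  have hαc : (α : ℂ) ≠ 0 := by exact_mod_cast hα₁.ne'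
  have hlog : Complex.log p = Complex.log Complex.I := by
    refine mul_right_cancel₀ hαc ?_
    simpa using hm
  rw [← Complex.exp_log hp, hlog, Complex.exp_log Complex.I_ne_zero]

/-- The transform is minus the derivative of p^{α-1}/(p^α - i^α), which has a simple pole with
residue 1/α at i and no other pole on the closed half-annulus. Subtracting (1/α)/(p - i) leaves a
function holomorphic near this compact set, and its derivative is bounded there. -/
theorem exists_mlLaplace_sub_pole_le_on_annulus {α : ℝ} (hα₁ : 1 < α) (hα₂ : α < 2) :
    ∃ M : ℝ, ∀ p : ℂ, 0 < p.re → 1 / 2 ≤ ‖p‖ → ‖p‖ ≤ 2 →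
      ‖mlLaplace α 1 (Complex.I ^ (α : ℂ)) p - (1 / α : ℂ) / (p - Complex.I) ^ 2‖ ≤ M := by
  have hI : Complex.I ∈ Complex.slitPlane := by simp [Complex.mem_slitPlane_iff]
  have hα0 : (α : ℂ) ≠ 0 := by
    have : α ≠ 0 := by linarith
    exact_mod_cast this
  set z := Complex.I ^ (α : ℂ) with hz
  have hpow : ∀ s : ℂ, DifferentiableOn ℂ (fun p : ℂ => p ^ s) Complex.slitPlane :=
    fun s p hp => ((differentiableAt_id).cpow_const hp).differentiableWithinAt
  set N : ℂ → ℂ := dslope (fun p : ℂ => p ^ (α : ℂ)) Complex.I with hN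
  have hNd : DifferentiableOn ℂ N Complex.slitPlane :=
    (Complex.differentiableOn_dslope (Complex.isOpen_slitPlane.mem_nhds hI)).2 (hpow _)
  have hNI : N Complex.I = α * Complex.I ^ ((α : ℂ) - 1) := by
    rw [hN, dslope_same]
    exact ((hasDerivAt_id Complex.I).cpow_const hI).deriv.trans (by simp)
  have hNne : ∀ p : ℂ, p ≠ Complex.I → N p = (p ^ (α : ℂ) - z) / (p - Complex.I) := by
    intro p hp
    rw [hN, dslope_of_ne _ hp, slope_def_field]
  set U : Set ℂ := {p ∈ Complex.slitPlane | N p ≠ 0} with hU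
  have hUo : IsOpen U := hNd.continuousOn.isOpen_inter_preimage Complex.isOpen_slitPlane
    isOpen_compl_singleton
  have hIpow : Complex.I ^ ((α : ℂ) - 1) ≠ 0 := by
    simp [Complex.cpow_eq_zero_iff]
  have hNI0 : N Complex.I ≠ 0 := by rw [hNI]; exact mul_ne_zero hα0 hIpow
  have hIU : Complex.I ∈ U := ⟨hI, hNI0⟩
  -- M is (p - i) times the difference of p^{α-1}/(p^α - z) and its polar part (1/α)/(p - i),
  -- extended by 0 to i. Its divided difference H at i is therefore that difference with the
  -- singularity removed.
  set M : ℂ → ℂ := fun p => p ^ ((α : ℂ) - 1) / N p - 1 / α with hM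
  have hMd : DifferentiableOn ℂ M U :=
    (((hpow _).mono fun p hp => hp.1).div (hNd.mono fun p hp => hp.1) fun p hp => hp.2).sub
      (differentiableOn_const _)
  have hMI : M Complex.I = 0 := by
    simp only [hM, hNI]
    field_simp
    simp
  set H : ℂ → ℂ := dslope M Complex.I with hH
  have hHd : DifferentiableOn ℂ H U :=
    (Complex.differentiableOn_dslope (hUo.mem_nhds hIU)).2 hMd
  set K : Set ℂ := {p | 0 ≤ p.re ∧ 1 / 2 ≤ ‖p‖} ∩ Metric.closedBall 0 2 with hK
  have hKc : IsCompact K := by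
    refine (isCompact_closedBall (0 : ℂ) 2).inter_left ?_
    exact (isClosed_le continuous_const Complex.continuous_re).inter
      (isClosed_le continuous_const continuous_norm)
  have hKU : K ⊆ U := by
    rintro p ⟨⟨h1, h2⟩, -⟩
    have hp0 : p ≠ 0 := fun h => by simp [h] at h2; norm_num at h2
    have hps : p ∈ Complex.slitPlane := by
      rw [Complex.mem_slitPlane_iff]
      by_contra hc
      push Not at hc
      exact hp0 (Complex.ext (le_antisymm hc.1 h1) hc.2)
    refine ⟨hps, ?_⟩
    by_cases hpI : p = Complex.I
    · rw [hpI]; exact hNI0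
    · rw [hNne p hpI]
      refine div_ne_zero (sub_ne_zero.2 fun h => hpI ?_) (sub_ne_zero.2 hpI)
      exact cpow_eq_I_cpow (by linarith) hα₂ hp0 h1 h
  obtain ⟨B, hB⟩ := hKc.exists_bound_of_continuousOn
    ((hHd.deriv hUo).continuousOn.mono hKU)
  refine ⟨B, fun p hp h1 h2 => ?_⟩
  have hpK : p ∈ K := ⟨⟨hp.le, h1⟩, by simpa using h2⟩
  have hps : p ∈ Complex.slitPlane := (hKU hpK).1
  have hp0 : p ≠ 0 := Complex.slitPlane_ne_zero hps
  have hpI : p ≠ Complex.I := fun h => by simp [h] at hp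
  have hD : p ^ (α : ℂ) - z ≠ 0 :=
    sub_ne_zero.2 fun h => hpI (cpow_eq_I_cpow (by linarith) hα₂ hp0 hp.le h)
  have heq : H =ᶠ[𝓝 p] fun q => q ^ ((α : ℂ) - 1) / (q ^ (α : ℂ) - z) -
      (1 / α) / (q - Complex.I) := by
    filter_upwards [isOpen_ne.mem_nhds hpI, hUo.mem_nhds (hKU hpK)] with q hq hqU
    have hqI : q - Complex.I ≠ 0 := sub_ne_zero.2 hq
    have hqN := hqU.2
    rw [hNne q hq] at hqN
    have hqD : q ^ (α : ℂ) - z ≠ 0 := fun h => hqN (by rw [h, zero_div])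
    rw [hH, dslope_of_ne _ hq, slope_def_field, hMI]
    simp only [hM, hNne q hq]
    field_simp
    ring
  have hder : HasDerivAt (fun q : ℂ => q ^ ((α : ℂ) - 1) / (q ^ (α : ℂ) - z) -
      (1 / α) / (q - Complex.I))
      (-(mlLaplace α 1 z p - (1 / α : ℂ) / (p - Complex.I) ^ 2)) p := by
    have d1 : HasDerivAt (fun q : ℂ => q ^ ((α : ℂ) - 1))
        (((α : ℂ) - 1) * p ^ ((α : ℂ) - 1 - 1) * 1) p := (hasDerivAt_id p).cpow_const hps
    have d2 : HasDerivAt (fun q : ℂ => q ^ (α : ℂ) - z)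
        ((α : ℂ) * p ^ ((α : ℂ) - 1) * 1) p :=
      ((hasDerivAt_id p).cpow_const hps).sub_const z
    have d3 : HasDerivAt (fun q : ℂ => (1 / α : ℂ) / (q - Complex.I))
        ((0 * (p - Complex.I) - (1 / α) * 1) / (p - Complex.I) ^ 2) p :=
      (hasDerivAt_const p (1 / α : ℂ)).div ((hasDerivAt_id p).sub_const _) (sub_ne_zero.2 hpI)
    convert! (d1.div d2 hD).sub d3 using 1
    have e1 : p ^ ((α : ℂ) - 1) = p * p ^ ((α : ℂ) - 1 - 1) := by
      rw [Complex.cpow_sub ((α : ℂ) - 1) 1 hp0, Complex.cpow_one]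
      field_simp
    have e2 : p ^ (α : ℂ) = p ^ 2 * p ^ ((α : ℂ) - 1 - 1) := by
      rw [pow_two, mul_assoc, ← e1, Complex.cpow_sub _ _ hp0, Complex.cpow_one]
      field_simp
    have e3 : ((α - 1 - 1 : ℝ) : ℂ) = (α : ℂ) - 1 - 1 := by push_cast; ring
    have hpI' := sub_ne_zero.2 hpI
    rw [mlLaplace, e3, e1]
    rw [e2] at hD ⊢
    generalize p ^ ((α : ℂ) - 1 - 1) = w at *
    push_cast
    field_simp
    ring
  have := hB p hpK
  rw [heq.deriv_eq, hder.deriv, norm_neg] at this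
  exact this

/-- The function t e^{it}/α has transform (1/α)/(p - i)², exactly the singular part at i. After its
subtraction the transform obeys a bound C‖p‖^{-μ} on the whole half-plane: for ‖p‖ ≤ 1/2 and ‖p‖ ≥ 2
both terms are small enough separately, and in between the pole cancels. Dividing the resulting
estimate by t gives the claim. -/
theorem exists_norm_mittagLeffler_sub_exp_le {α : ℝ} (hα₁ : 1 < α) (hα₂ : α < 2) :
    ∃ C μ : ℝ, μ < 2 ∧ ∀ t > 0, ‖mittagLeffler α (Complex.I ^ (α : ℂ) * ((t ^ α : ℝ) : ℂ)) -
      (1 / α : ℂ) * Complex.exp (t * Complex.I)‖ ≤ C * t ^ (μ - 2) := by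
  set z := Complex.I ^ (α : ℂ) with hz
  have hα0 : 0 < α := by linarith
  have hz1 : ‖z‖ = 1 := by
    rw [hz, norm_cpow_real Complex.I_ne_zero, Complex.norm_I, Real.one_rpow]
  obtain ⟨M, hM⟩ := exists_mlLaplace_sub_pole_le_on_annulus hα₁ hα₂
  -- The midpoint of 3 - α and 2; here any value in (1, 2) would serve.
  set μ : ℝ := (5 - α) / 2 with hμ
  have hμ1 : 1 < μ := by rw [hμ]; linarith
  have hμ2 : μ < 2 := by rw [hμ]; linarith
  set T : ℝ → ℂ := fun t => mlPower α 1 z t -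
    (1 / α : ℂ) * (((max t 0 : ℝ) : ℂ) * Complex.exp (t * Complex.I)) with hT
  set Q : ℂ → ℂ := fun p => mlLaplace α 1 z p - (1 / α : ℂ) / (p - Complex.I) ^ 2 with hQ
  have hL := laplace_mlPower hα₁ le_rfl (c := 2) (z := z) two_pos
    (by rw [hz1]; exact Real.one_lt_rpow one_lt_two (by linarith))
  have hE : ∀ p : ℂ, ∀ t ∈ Ioi (0 : ℝ), Complex.exp (-p * t) *
      ((1 / α : ℂ) * (((max t 0 : ℝ) : ℂ) * Complex.exp (t * Complex.I))) =
      (1 / α : ℂ) * (Complex.exp (-(p - Complex.I) * t) * ((t ^ ((2 : ℝ) - 1) : ℝ) : ℂ)) := by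
    intro p t ht
    have e : (2 : ℝ) - 1 = 1 := by norm_num
    rw [max_eq_left (le_of_lt ht), e, Real.rpow_one]
    have : Complex.exp (-(p - Complex.I) * t) =
        Complex.exp (-p * t) * Complex.exp (t * Complex.I) := by
      rw [← Complex.exp_add]; ring_nf
    rw [this]
    ring
  have hEi : ∀ p : ℂ, 0 < p.re → IntegrableOn (fun t : ℝ => Complex.exp (-p * t) *
      ((1 / α : ℂ) * (((max t 0 : ℝ) : ℂ) * Complex.exp (t * Complex.I)))) (Ioi 0) := by
    intro p hp
    have := (integrableOn_exp_neg_mul_rpow (p := p - Complex.I) (s := (2 : ℝ) - 1) (by norm_num)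
      (by simpa using hp)).const_mul (1 / α : ℂ)
    exact IntegrableOn.congr_fun this (fun t ht => (hE p t ht).symm) measurableSet_Ioi
  have hTi : ∀ p : ℂ, p.re = 2 →
      IntegrableOn (fun t : ℝ => Complex.exp (-p * t) * mlPower α 1 z t) (Ioi 0) := by
    intro p hp
    refine Integrable.mono hL.1 ?_ ?_
    · have := continuous_mlPower hα₁ le_rfl z
      exact (by fun_prop : Continuous fun t : ℝ =>
        Complex.exp (-p * t) * mlPower α 1 z t).aestronglyMeasurable
    · refine Eventually.of_forall fun t => ?_
      rw [norm_mul, norm_mul, Complex.norm_exp, Complex.norm_exp]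
      simp [hp]
  obtain ⟨C, hC⟩ : ∃ C : ℝ, ∀ t > 0, ‖T t‖ ≤ C * t ^ (μ - 1) := by
    refine norm_le_rpow_of_laplace (Q := Q) (c₁ := 2)
      (C := max (2 * (1 + |α - 1|) / (1 / 8) + 4 / α) (M * 2 ^ μ)) hμ1 ?_ ?_ two_pos ?_ ?_ ?_ ?_
    · have := continuous_mlPower hα₁ le_rfl z
      fun_prop
    · intro t ht
      simp [hT, mlPower_of_nonpos one_pos z ht, max_eq_right ht]
    · have := (hTi 2 (by simp)).sub (hEi 2 (by simp))
      refine this.congr (Eventually.of_forall fun t => ?_)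
      simp [hT, mul_sub]
    · intro p hp
      have hp0 : 0 < p.re := by rw [hp]; exact two_pos
      simp only [hT, mul_sub]
      rw [integral_sub (hTi p hp) (hEi p hp0), hL.2 p hp,
        setIntegral_congr_fun measurableSet_Ioi (hE p), integral_const_mul,
        laplace_rpow two_pos (by simpa using hp0)]
      simp only [hQ, Real.Gamma_two, Complex.ofReal_one, mul_one]
      rw [Complex.cpow_neg, Complex.ofReal_ofNat, Complex.cpow_ofNat]
      simp only [div_eq_mul_inv]
    · refine (differentiableOn_mlLaplace fun p hp h => ?_).sub ?_
      · have := cpow_eq_I_cpow hα0 hα₂ (fun h => by simp [h] at hp) hp.le h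
        simp [this] at hp
      · refine DifferentiableOn.div (differentiableOn_const _) (by fun_prop) fun p hp => ?_
        refine pow_ne_zero 2 (sub_ne_zero.2 fun h => ?_)
        have hp : 0 < p.re := hp
        simp [h] at hp
    · intro p hp
      have hpn : p ≠ 0 := fun h => by simp [h] at hp
      have hρ : 0 < ‖p‖ := norm_pos_iff.2 hpn
      have hPn := norm_cpow_real hpn α
      have h2α : ‖p‖ ^ (2 * α) = ‖p ^ (α : ℂ)‖ ^ 2 := by
        rw [hPn, ← Real.rpow_natCast, ← Real.rpow_mul hρ.le]; ring_nf
      have far : (1 / 8 : ℝ) * (1 + ‖p‖ ^ (2 * α)) ≤ ‖p ^ (α : ℂ) - z‖ ^ 2 →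
          ‖(1 / α : ℂ) / (p - Complex.I) ^ 2‖ ≤ 4 / α * ‖p‖ ^ (-μ) →
          ‖Q p‖ ≤ max (2 * (1 + |α - 1|) / (1 / 8) + 4 / α) (M * 2 ^ μ) * ‖p‖ ^ (-μ) := by
        intro h1 h2
        have h3 := norm_mlLaplace_le zero_le_one (by rw [hμ]; linarith : 1 + 1 - α ≤ μ)
          (by linarith) (by norm_num) hz1.le hpn h1
        calc ‖Q p‖ ≤ _ := norm_sub_le _ _
          _ ≤ _ := add_le_add h3 h2
          _ = (2 * (1 + |α - 1|) / (1 / 8) + 4 / α) * ‖p‖ ^ (-μ) := by ring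
          _ ≤ _ := by gcongr; exact le_max_left _ _
      have hnorm : ‖(1 / α : ℂ) / (p - Complex.I) ^ 2‖ = 1 / α * (‖p - Complex.I‖ ^ 2)⁻¹ := by
        rw [norm_div, norm_div, norm_one, Complex.norm_real, Real.norm_of_nonneg hα0.le, norm_pow,
          div_eq_mul_inv]
      rcases le_total ‖p‖ (1 / 2) with h | h
      · have hP : ‖p ^ (α : ℂ)‖ ≤ 1 / 2 := by
          rw [hPn]
          calc ‖p‖ ^ α ≤ ‖p‖ ^ (1 : ℝ) :=
                Real.rpow_le_rpow_of_exponent_ge hρ (by linarith) hα₁.le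
            _ ≤ 1 / 2 := by rwa [Real.rpow_one]
        refine far ?_ ?_
        · have : 1 / 2 ≤ ‖p ^ (α : ℂ) - z‖ := by
            have := norm_sub_norm_le z (p ^ (α : ℂ))
            rw [norm_sub_rev, hz1] at this
            linarith
          rw [h2α]
          nlinarith [norm_nonneg (p ^ (α : ℂ))]
        · have h1 : 1 / 2 ≤ ‖p - Complex.I‖ := by
            have := norm_sub_norm_le Complex.I p
            rw [norm_sub_rev, Complex.norm_I] at this
            linarith
          have h2 : (‖p - Complex.I‖ ^ 2)⁻¹ ≤ 4 := by
            rw [inv_le_comm₀ (by positivity) (by norm_num)]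
            nlinarith
          have h3 : 1 ≤ ‖p‖ ^ (-μ) :=
            Real.one_le_rpow_of_pos_of_le_one_of_nonpos hρ (by linarith) (by linarith)
          rw [hnorm]
          calc 1 / α * (‖p - Complex.I‖ ^ 2)⁻¹ ≤ 1 / α * 4 := by gcongr
            _ = 4 / α * 1 := by ring
            _ ≤ _ := by gcongr
      rcases le_total ‖p‖ 2 with h' | h'
      · calc ‖Q p‖ ≤ M := hM p hp h h'
          _ = M * 2 ^ μ * 2 ^ (-μ) := by
              rw [mul_assoc, ← Real.rpow_add two_pos]; simp
          _ ≤ M * 2 ^ μ * ‖p‖ ^ (-μ) := by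
              have hM0 : 0 ≤ M := (norm_nonneg _).trans (hM p hp h h')
              have := Real.rpow_le_rpow_of_nonpos hρ h' (by linarith : -μ ≤ 0)
              gcongr
          _ ≤ _ := by gcongr; exact le_max_right _ _
      · have hP : 2 ≤ ‖p ^ (α : ℂ)‖ := by
          rw [hPn]
          calc (2 : ℝ) ≤ ‖p‖ ^ (1 : ℝ) := by rwa [Real.rpow_one]
            _ ≤ ‖p‖ ^ α := Real.rpow_le_rpow_of_exponent_le (by linarith) hα₁.le
        refine far ?_ ?_
        · have : ‖p ^ (α : ℂ)‖ / 2 ≤ ‖p ^ (α : ℂ) - z‖ := by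
            have := norm_sub_norm_le (p ^ (α : ℂ)) z
            rw [hz1] at this
            linarith
          rw [h2α]
          nlinarith [norm_nonneg (p ^ (α : ℂ))]
        · have h1 : ‖p‖ / 2 ≤ ‖p - Complex.I‖ := by
            have := norm_sub_norm_le p Complex.I
            rw [Complex.norm_I] at this
            linarith
          have h2 : (‖p - Complex.I‖ ^ 2)⁻¹ ≤ 4 * ‖p‖ ^ (-2 : ℝ) := by
            have e : ‖p‖ ^ (-2 : ℝ) = (‖p‖ ^ 2)⁻¹ := by
              rw [Real.rpow_neg hρ.le]; norm_num
            have e' : 4 * (‖p‖ ^ 2)⁻¹ = ((‖p‖ / 2) ^ 2)⁻¹ := by field_simp; norm_num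
            rw [e, e']
            gcongr
          have h3 : ‖p‖ ^ (-2 : ℝ) ≤ ‖p‖ ^ (-μ) :=
            Real.rpow_le_rpow_of_exponent_le (by linarith) (by linarith)
          rw [hnorm]
          calc 1 / α * (‖p - Complex.I‖ ^ 2)⁻¹ ≤ 1 / α * (4 * ‖p‖ ^ (-μ)) := by
                gcongr; linarith
            _ = _ := by ring
  refine ⟨C, μ, hμ2, fun t ht => ?_⟩
  have h1 := hC t ht
  have e : T t = (t : ℂ) * (mittagLeffler α (z * ((t ^ α : ℝ) : ℂ)) -
      (1 / α : ℂ) * Complex.exp (t * Complex.I)) := by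
    simp only [hT, mlPower_of_pos z ht, mittagLeffler₂_one, Real.rpow_one, max_eq_left ht.le]
    ring
  rw [e, norm_mul, Complex.norm_real, Real.norm_of_nonneg ht.le] at h1
  have e2 : t ^ (μ - 1) = t * t ^ (μ - 2) := by
    rw [mul_comm, ← Real.rpow_add_one ht.ne']; ring_nf
  rw [e2] at h1
  refine le_of_mul_le_mul_left ?_ ht
  linarith

theorem mlOscillation_eq {α ω t : ℝ} (hω : 0 ≤ ω) (ht : 0 ≤ t) :
    mlOscillation α ω t =
      mittagLeffler α (Complex.I ^ (α : ℂ) * (((ω * t) ^ α : ℝ) : ℂ)) := by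
  rw [mlOscillation, iomegaPow, Real.mul_rpow hω ht]
  push_cast
  ring_nf

theorem eventually_le_norm_mlOscillation {α ω : ℝ} (hα₁ : 1 < α) (hα₂ : α < 2) (hω : 0 < ω) :
    ∃ c > 0, ∀ᶠ t in atTop, c ≤ ‖mlOscillation α ω t‖ := by
  obtain ⟨C, μ, hμ, hC⟩ := exists_norm_mittagLeffler_sub_exp_le hα₁ hα₂
  have hα0 : 0 < α := by linarith
  -- Half of the limiting modulus 1/α.
  refine ⟨1 / (2 * α), by positivity, ?_⟩
  have hlim : Tendsto (fun t : ℝ => C * (ω * t) ^ (-(2 - μ))) atTop (𝓝 (C * 0)) :=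
    ((tendsto_rpow_neg_atTop (by linarith : 0 < 2 - μ)).comp
      (tendsto_id.const_mul_atTop hω)).const_mul C
  rw [mul_zero] at hlim
  filter_upwards [hlim.eventually (gt_mem_nhds (by positivity : (0 : ℝ) < 1 / (2 * α))),
    eventually_gt_atTop 0] with t h1 ht
  have h2 := hC (ω * t) (mul_pos hω ht)
  rw [mlOscillation_eq hω.le ht.le]
  have h3 : ‖(1 / α : ℂ) * Complex.exp ((ω * t : ℝ) * Complex.I)‖ = 1 / α := by
    rw [norm_mul, Complex.norm_exp_ofReal_mul_I, norm_div, norm_one, Complex.norm_real,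
      Real.norm_of_nonneg hα0.le, mul_one]
  have h4 := norm_sub_norm_le ((1 / α : ℂ) * Complex.exp ((ω * t : ℝ) * Complex.I))
    (mittagLeffler α (Complex.I ^ (α : ℂ) * (((ω * t) ^ α : ℝ) : ℂ)))
  rw [norm_sub_rev, h3] at h4
  have e : -(2 - μ) = μ - 2 := by ring
  rw [e] at h1
  have e2 : 1 / α = 1 / (2 * α) + 1 / (2 * α) := by field_simp; norm_num
  linarith

/-! ### The Borel transform of the Mittag-Leffler function -/

/-- The coefficient `j! t ^ (α j + b - 1) / Γ(α j + b)`. -/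
noncomputable def mlCoeff (α b t : ℝ) (j : ℕ) : ℝ :=
  j.factorial * t ^ (α * j + b - 1) / Real.Gamma (α * j + b)

theorem mlCoeff_nonneg {α b t : ℝ} (hα : 1 < α) (hb : 1 ≤ b) (ht : 0 < t) (j : ℕ) :
    0 ≤ mlCoeff α b t j := by
  have := Real.Gamma_pos_of_pos (by positivity : 0 < α * j + b)
  rw [mlCoeff]
  positivity

theorem mlCoeff_eq {α b t : ℝ} (ht : 0 < t) (j : ℕ) :
    mlCoeff α b t j = t ^ (b - 1) * (j.factorial * (t ^ α) ^ j / Real.Gamma (α * j + b)) := by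
  rw [mlCoeff, add_sub_assoc, Real.rpow_add ht, Real.rpow_mul ht.le, Real.rpow_natCast]
  ring

theorem summable_mlCoeff_mul {α b t : ℝ} (hα : 1 < α) (hb : 1 ≤ b) (ht : 0 < t) {d : ℝ}
    (hd : 0 < d) : Summable fun j : ℕ => mlCoeff α b t j * (d ^ (j + 1))⁻¹ := by
  refine ((summable_factorial_mul_pow_div_Gamma hα hb (x := t ^ α / d) (by positivity)).mul_left
    (t ^ (b - 1) * d⁻¹)).congr fun j => ?_
  rw [mlCoeff_eq ht, div_pow, pow_succ]
  field_simp

/-- The kernel `∑ j! t ^ (α j + b - 1) / Γ(α j + b) σ ^ (-j - 1)`. -/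
noncomputable def mlKernel (α b t : ℝ) (σ : ℂ) : ℂ :=
  ∑' j : ℕ, (mlCoeff α b t j : ℂ) * (σ ^ (j + 1))⁻¹

theorem hasSum_mlKernel {α b t : ℝ} (hα : 1 < α) (hb : 1 ≤ b) (ht : 0 < t) {σ : ℂ} (hσ : σ ≠ 0) :
    HasSum (fun j : ℕ => (mlCoeff α b t j : ℂ) * (σ ^ (j + 1))⁻¹) (mlKernel α b t σ) := by
  refine Summable.hasSum (Summable.of_norm ?_)
  refine (summable_mlCoeff_mul hα hb ht (norm_pos_iff.2 hσ)).congr fun j => ?_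
  rw [norm_mul, norm_inv, norm_pow, Complex.norm_real,
    Real.norm_of_nonneg (mlCoeff_nonneg hα hb ht j)]

/-- Borel summation: j! σ^{-j-1} is z^{j+1} times the Laplace integral of r^j at σz, so the kernel
is the integral of z e^{-σzr} t^{b-1} E_{α,b}(z r t^α) over r > 0. By hypothesis E_{α,b} decays
along this ray, which bounds the integrand by a multiple of t^{μ-2} r^{-θ} e^{-Re(σz) r} with θ =
(b+1-μ)/α < 1; what remains is a Gamma integral. -/
theorem norm_mlKernel_le {α b μ C : ℝ} (hα : 1 < α) (hb : 1 ≤ b) {z : ℂ} (hz : ‖z‖ = 1)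
    (hC : ∀ τ > 0, ‖mlPower α b z τ‖ ≤ C * τ ^ (μ - 1)) (hθ : (b + 1 - μ) / α < 1)
    {t : ℝ} (ht : 0 < t) {σ : ℂ} (hσ : 0 < (σ * z).re) :
    ‖mlKernel α b t σ‖ ≤ C * t ^ (μ - 2) * ((σ * z).re ^ ((b + 1 - μ) / α - 1) *
      Real.Gamma (1 - (b + 1 - μ) / α)) := by
  have hα0 : 0 < α := by linarith
  have hz0 : z ≠ 0 := fun h => by simp [h] at hz
  have hσz : σ * z ≠ 0 := fun h => by simp [h] at hσ
  have hσn : σ ≠ 0 := left_ne_zero_of_mul hσz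
  set θ : ℝ := (b + 1 - μ) / α with hθd
  set F : ℕ → ℝ → ℂ := fun j r => ((mlCoeff α b t j / j.factorial : ℝ) : ℂ) * z ^ (j + 1) *
    (Complex.exp (-(σ * z) * r) * ((r ^ ((j + 1 : ℝ) - 1) : ℝ) : ℂ)) with hF
  have hFi : ∀ j, IntegrableOn (F j) (Ioi 0) := fun j =>
    (integrableOn_exp_neg_mul_rpow (by simpa using by linarith [(Nat.cast_nonneg j : (0:ℝ) ≤ j)])
      hσ).const_mul _
  have hjf : ∀ j : ℕ, (0 : ℝ) < j.factorial := fun j => by exact_mod_cast j.factorial_pos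
  have hint : ∀ j, ∫ r in Ioi (0 : ℝ), F j r = (mlCoeff α b t j : ℂ) * (σ ^ (j + 1))⁻¹ := by
    intro j
    simp only [hF]
    rw [integral_const_mul, laplace_rpow (by positivity) hσ, Real.Gamma_nat_eq_factorial]
    have e : (σ * z) ^ (-((j + 1 : ℝ) : ℂ)) = ((σ * z) ^ (j + 1))⁻¹ := by
      rw [Complex.cpow_neg]
      congr 1
      rw [← Complex.cpow_natCast]
      push_cast
      rfl
    have hjf' : (j.factorial : ℂ) ≠ 0 := by exact_mod_cast (hjf j).ne'
    rw [e, mul_pow]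
    push_cast
    field_simp
  have hsm : Summable fun j => ∫ r in Ioi (0 : ℝ), ‖F j r‖ := by
    refine (summable_mlCoeff_mul hα hb ht hσ).congr fun j => ?_
    simp only [hF, norm_mul _ (_ * _)]
    rw [integral_const_mul, integral_norm_exp_neg_mul_rpow (by positivity) hσ,
      Real.Gamma_nat_eq_factorial, norm_mul, norm_pow, hz, Complex.norm_real,
      Real.norm_of_nonneg (div_nonneg (mlCoeff_nonneg hα hb ht j) (hjf j).le)]
    have e : (1 / (σ * z).re) ^ ((j : ℝ) + 1) = ((σ * z).re ^ (j + 1))⁻¹ := by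
      rw [one_div, Real.inv_rpow hσ.le]
      congr 1
      exact_mod_cast Real.rpow_natCast _ (j + 1)
    rw [e, one_pow]
    have := hjf j
    field_simp
  have hsum : ∀ r ∈ Ioi (0 : ℝ), HasSum (fun j => F j r) (z * Complex.exp (-(σ * z) * r) *
      ((t ^ (b - 1) : ℝ) : ℂ) * mittagLeffler₂ α b (z * (((r ^ (1 / α) * t) ^ α : ℝ) : ℂ))) := by
    intro r hr
    have hr : 0 < r := hr
    have e1 : (r ^ (1 / α) * t) ^ α = r * t ^ α := by
      rw [Real.mul_rpow (by positivity) ht.le, ← Real.rpow_mul hr.le, one_div_mul_cancel hα0.ne',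
        Real.rpow_one]
    convert! (hasSum_mittagLeffler₂ hα hb (z * (((r ^ (1 / α) * t) ^ α : ℝ) : ℂ))).mul_left
      (z * Complex.exp (-(σ * z) * r) * ((t ^ (b - 1) : ℝ) : ℂ)) using 2 with j
    have e2 : r ^ ((j + 1 : ℝ) - 1) = r ^ j := by
      rw [add_sub_cancel_right, Real.rpow_natCast]
    have hG : (Real.Gamma (α * j + b) : ℂ) ≠ 0 := by
      exact_mod_cast (Real.Gamma_pos_of_pos (by positivity : 0 < α * j + b)).ne'
    have hjf' : (j.factorial : ℂ) ≠ 0 := by exact_mod_cast (hjf j).ne'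
    simp only [hF]
    rw [mlCoeff_eq ht, e1, e2]
    push_cast
    field_simp
    ring
  have h1 := hasSum_integral_of_summable_integral_norm hFi hsm
  simp_rw [hint] at h1
  rw [(hasSum_mlKernel hα hb ht hσn).unique h1]
  have hC0 : 0 ≤ C := by
    have := (norm_nonneg _).trans (hC 1 one_pos)
    simpa using this
  have hG : (σ * z).re ^ (θ - 1) * Real.Gamma (1 - θ) =
      ∫ r in Ioi (0 : ℝ), r ^ ((1 - θ) - 1) * Real.exp (-((σ * z).re * r)) := by
    rw [Real.integral_rpow_mul_exp_neg_mul_Ioi (by linarith) hσ, one_div, Real.inv_rpow hσ.le,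
      ← Real.rpow_neg hσ.le]
    ring_nf
  rw [hG, ← integral_const_mul]
  refine norm_integral_le_of_norm_le
    ((integrableOn_rpow_mul_exp_neg_mul (by linarith) hσ).const_mul _) ?_
  filter_upwards [ae_restrict_mem measurableSet_Ioi] with r hr
  have hr0 : 0 < r := hr
  have hτ : 0 < r ^ (1 / α) * t := by positivity
  have h2 := hC _ hτ
  rw [mlPower_of_pos z hτ, norm_mul, Complex.norm_real, Real.norm_of_nonneg (by positivity)] at h2
  set E := mittagLeffler₂ α b (z * (((r ^ (1 / α) * t) ^ α : ℝ) : ℂ))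
  have h3 : ‖E‖ ≤ C * (r ^ (1 / α) * t) ^ (μ - 1 - b) := by
    rw [Real.rpow_sub hτ, mul_div_assoc', le_div_iff₀ (by positivity)]
    linarith
  have h4 : (r ^ (1 / α) * t) ^ (μ - 1 - b) = r ^ ((1 - θ) - 1) * t ^ (μ - 1 - b) := by
    rw [Real.mul_rpow (by positivity) ht.le, ← Real.rpow_mul hr0.le]
    congr 2
    rw [hθd]
    ring
  have h5 : t ^ (μ - 2) = t ^ (b - 1) * t ^ (μ - 1 - b) := by
    rw [← Real.rpow_add ht]; ring_nf
  rw [(hsum r hr).tsum_eq, norm_mul, norm_mul, norm_mul, hz, Complex.norm_exp, Complex.norm_real,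
    Real.norm_of_nonneg (by positivity : 0 ≤ t ^ (b - 1)), one_mul]
  have e : (-(σ * z) * (r : ℂ)).re = -((σ * z).re * r) := by simp
  rw [e]
  calc Real.exp (-((σ * z).re * r)) * t ^ (b - 1) * ‖E‖
      ≤ Real.exp (-((σ * z).re * r)) * t ^ (b - 1) * (C * (r ^ (1 / α) * t) ^ (μ - 1 - b)) := by
        gcongr
    _ = _ := by rw [h4, h5]; ring

/-! ### Cauchy's formula on a sector -/

/-- The difference is 2iη/((x - ℓ)² + η²), a Poisson kernel. This is the contribution of the pole
when Cauchy's formula is read on a horizontal strip. -/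
theorem integral_two_mul_I_div {η ℓ : ℝ} (hη : 0 < η) :
    Integrable (fun x : ℝ => (((x : ℂ) - η * Complex.I - ℓ)⁻¹ - ((x : ℂ) + η * Complex.I - ℓ)⁻¹)) ∧
    ∫ x : ℝ, (((x : ℂ) - η * Complex.I - ℓ)⁻¹ - ((x : ℂ) + η * Complex.I - ℓ)⁻¹) =
      2 * Real.pi * Complex.I := by
  have e : ∀ x : ℝ, (((x : ℂ) - η * Complex.I - ℓ)⁻¹ - ((x : ℂ) + η * Complex.I - ℓ)⁻¹) =
      (2 * Complex.I / η) * (((1 + (η⁻¹ * (x - ℓ)) ^ 2)⁻¹ : ℝ) : ℂ) := by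
    intro x
    have h1 : ((x : ℂ) - η * Complex.I - ℓ) ≠ 0 := fun h => by
      have := congrArg Complex.im h
      simp at this
      exact hη.ne' this
    have h2 : ((x : ℂ) + η * Complex.I - ℓ) ≠ 0 := fun h => by
      have := congrArg Complex.im h
      simp at this
      exact hη.ne' this
    have hη' : (η : ℂ) ≠ 0 := by exact_mod_cast hη.ne'
    have h3 : (η : ℂ) ^ 2 + (x - ℓ) ^ 2 = (x - η * Complex.I - ℓ) * (x + η * Complex.I - ℓ) := by
      linear_combination ((η : ℂ) ^ 2) * Complex.I_sq
    have h4 : (((1 + (η⁻¹ * (x - ℓ)) ^ 2)⁻¹ : ℝ) : ℂ) =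
        (η : ℂ) ^ 2 / ((x - η * Complex.I - ℓ) * (x + η * Complex.I - ℓ)) := by
      rw [← h3]
      have h5 : (η : ℂ) ^ 2 + (x - ℓ) ^ 2 ≠ 0 := by rw [h3]; exact mul_ne_zero h1 h2
      have h6 : (1 : ℂ) + ((η : ℂ)⁻¹ * (x - ℓ)) ^ 2 = (η ^ 2 + (x - ℓ) ^ 2) / η ^ 2 := by
        field_simp
      push_cast
      rw [h6, inv_div]
    rw [h4]
    field_simp
    ring
  simp_rw [e]
  have hi : Integrable fun x : ℝ => (1 + (η⁻¹ * (x - ℓ)) ^ 2)⁻¹ :=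
    (integrable_inv_one_add_sq.comp_mul_left' (R := η⁻¹) (inv_ne_zero hη.ne')).comp_sub_right ℓ
  refine ⟨hi.ofReal.const_mul _, ?_⟩
  rw [integral_const_mul, integral_complex_ofReal,
    integral_sub_right_eq_self (fun x : ℝ => (1 + (η⁻¹ * x) ^ 2)⁻¹) ℓ,
    Measure.integral_comp_mul_left (fun x : ℝ => (1 + x ^ 2)⁻¹) η⁻¹,
    integral_univ_inv_one_add_sq, inv_inv, abs_of_pos hη]
  have hη' : (η : ℂ) ≠ 0 := by exact_mod_cast hη.ne'
  rw [smul_eq_mul]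
  push_cast
  field_simp

/-- The weight `min 1 (exp (- 3 x / 2))`. -/
noncomputable def sectorWeight (x : ℝ) : ℝ := min 1 (Real.exp (-(3 / 2 * x)))

theorem sectorWeight_nonneg (x : ℝ) : 0 ≤ sectorWeight x :=
  le_min zero_le_one (Real.exp_pos _).le

theorem integrable_exp_neg_mul_abs {m : ℝ} (hm : 0 < m) :
    Integrable fun x : ℝ => Real.exp (-(m * |x|)) := by
  rw [← integrableOn_univ, ← Iic_union_Ioi (a := (0 : ℝ))]
  refine IntegrableOn.union ?_ ?_
  · refine (integrableOn_exp_mul_Iic hm 0).congr_fun (fun x hx => ?_) measurableSet_Iic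
    simp [abs_of_nonpos (mem_Iic.1 hx)]
  · refine (integrableOn_exp_mul_Ioi (neg_lt_zero.2 hm) 0).congr_fun (fun x hx => ?_)
      measurableSet_Ioi
    simp [abs_of_pos (mem_Ioi.1 hx)]

/-- With |ζ| = e^x, the factor |ζ|^θ decays as x → -∞, and |ζ|^{θ-3/2} is at most e^{-x/2} for x ≥ 0
because θ ≤ 1. -/
theorem sectorWeight_mul_exp_le {θ : ℝ} (hθ₁ : θ ≤ 1) (x : ℝ) :
    sectorWeight x * Real.exp (θ * x) ≤ Real.exp (-(min θ (1 / 2) * |x|)) := by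
  rcases le_total 0 x with hx | hx
  · calc _ ≤ Real.exp (-(3 / 2 * x)) * Real.exp (θ * x) := by
          gcongr; exact min_le_right _ _
      _ = Real.exp (-(3 / 2 * x) + θ * x) := (Real.exp_add _ _).symm
      _ ≤ _ := by
        rw [Real.exp_le_exp, abs_of_nonneg hx]
        nlinarith [min_le_right θ (1 / 2)]
  · calc _ ≤ 1 * Real.exp (θ * x) := by
          gcongr; exact min_le_left _ _
      _ ≤ _ := by
        rw [one_mul, Real.exp_le_exp, abs_of_nonpos hx]
        nlinarith [min_le_left θ (1 / 2)]

theorem continuous_sectorWeight : Continuous sectorWeight := by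
  unfold sectorWeight
  fun_prop

theorem integrable_sectorWeight_mul_exp {θ : ℝ} (hθ₀ : 0 < θ) (hθ₁ : θ ≤ 1) :
    Integrable fun x : ℝ => sectorWeight x * Real.exp (θ * x) := by
  refine (integrable_exp_neg_mul_abs (lt_min hθ₀ one_half_pos)).mono' ?_ ?_
  · have := continuous_sectorWeight
    exact (by fun_prop : Continuous fun x : ℝ =>
      sectorWeight x * Real.exp (θ * x)).aestronglyMeasurable
  · refine Eventually.of_forall fun x => ?_
    rw [Real.norm_of_nonneg (mul_nonneg (sectorWeight_nonneg x) (Real.exp_pos _).le)]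
    exact sectorWeight_mul_exp_le hθ₁ x

/-- The function `A (e ^ w) e ^ w` along a horizontal line. -/
noncomputable def rayFun (A : ℂ → ℂ) (η x : ℝ) : ℂ :=
  A (Complex.exp (x + η * Complex.I)) * Complex.exp (x + η * Complex.I)

theorem exp_re_pos {w : ℂ} (hw : |w.im| < Real.pi / 2) : 0 < (Complex.exp w).re := by
  rw [Complex.exp_re]
  exact mul_pos (Real.exp_pos _) (Real.cos_pos_of_mem_Ioo (abs_lt.1 hw))

/-- The analytic functions on the right half-plane that are dominated by a multiple of
`min 1 (|ζ| ^ (-3/2))` in the sector `|arg ζ| ≤ η`. -/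
structure SectorDecay (A : ℂ → ℂ) (η C : ℝ) : Prop where
  differentiableOn : DifferentiableOn ℂ A {p | 0 < p.re}
  bound : ∀ w : ℂ, |w.im| ≤ η → ‖A (Complex.exp w)‖ ≤ C * sectorWeight w.re

theorem continuous_rayFun {A : ℂ → ℂ} (hA : DifferentiableOn ℂ A {p | 0 < p.re}) {η : ℝ}
    (hη : |η| < Real.pi / 2) : Continuous (rayFun A η) := by
  refine Continuous.mul ?_ (by fun_prop)
  exact hA.continuousOn.comp_continuous (by fun_prop) fun x => exp_re_pos (by simpa using hη)

theorem norm_rayFun_le {A : ℂ → ℂ} {η C : ℝ} (hA : SectorDecay A η C) {σ : ℝ} (hσ : |σ| = η)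
    (x : ℝ) : ‖rayFun A σ x‖ ≤ C * (sectorWeight x * Real.exp (1 * x)) := by
  rw [rayFun, norm_mul, Complex.norm_exp, one_mul, ← mul_assoc]
  have := hA.bound (x + σ * Complex.I) (by simp [hσ])
  simp only [Complex.add_re, Complex.ofReal_re, Complex.mul_re, Complex.ofReal_im, Complex.I_re,
    Complex.I_im, mul_zero, zero_mul, sub_self, add_zero] at this ⊢
  gcongr

theorem integrable_rayFun {A : ℂ → ℂ} {η C : ℝ} (hA : SectorDecay A η C) (hη : η < Real.pi / 2)
    {σ : ℝ} (hσ : |σ| = η) : Integrable (rayFun A σ) :=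
  ((integrable_sectorWeight_mul_exp one_pos le_rfl).const_mul C).mono'
    (continuous_rayFun hA.differentiableOn (hσ ▸ hη)).aestronglyMeasurable
    (Eventually.of_forall fun x => norm_rayFun_le hA hσ x)

/-- The number s sin η is the distance from s to the line carrying the ray. -/
theorem le_norm_exp_sub {η s : ℝ} (hη₀ : 0 < η) (hη : η < Real.pi / 2) {σ : ℝ}
    (hσ : |σ| = η) (x : ℝ) :
    s * Real.sin η ≤ ‖Complex.exp (x + σ * Complex.I) - s‖ := by
  have hsin := Real.sin_pos_of_pos_of_lt_pi hη₀ (by linarith [Real.pi_pos])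
  refine le_of_sq_le_sq ?_ (norm_nonneg _)
  rw [← Complex.normSq_eq_norm_sq, Complex.normSq_apply]
  have e1 : (Complex.exp (x + σ * Complex.I) - s).re = Real.exp x * Real.cos η - s := by
    rw [Complex.sub_re, Complex.exp_re, ← hσ, Real.cos_abs]
    simp
  have e2 : (Complex.exp (x + σ * Complex.I) - s).im ^ 2 = (Real.exp x * Real.sin η) ^ 2 := by
    rw [Complex.sub_im, Complex.exp_im, ← hσ]
    rcases abs_choice σ with h | h <;> rw [h] <;> simp
  rw [← pow_two, ← pow_two, e1, e2]
  have h1 := Real.sin_sq_add_cos_sq η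
  have : (Real.exp x * Real.cos η - s) ^ 2 + (Real.exp x * Real.sin η) ^ 2 =
      (s * Real.sin η) ^ 2 + (Real.exp x - s * Real.cos η) ^ 2 := by
    linear_combination (Real.exp x ^ 2 - s ^ 2) * h1
  rw [this]
  nlinarith [sq_nonneg (Real.exp x - s * Real.cos η)]

/-- In the coordinate ζ = e^w the sector becomes a strip and the pole sits at w = log s. Subtracting
A(s)/(w - log s) removes it; the remainder integrates to zero around long rectangles, its vertical
sides vanish in the limit, and the subtracted term contributes 2πi A(s). The lower ray minus the
upper one is the positive orientation. -/
theorem cauchy_sector {A : ℂ → ℂ} {η C s : ℝ} (hA : SectorDecay A η C) (hη₀ : 0 < η)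
    (hη : η < Real.pi / 2) (hs : 0 < s) :
    (∫ x : ℝ, rayFun A (-η) x / (Complex.exp (x + (-η : ℝ) * Complex.I) - s)) -
      ∫ x : ℝ, rayFun A η x / (Complex.exp (x + η * Complex.I) - s) =
    2 * Real.pi * Complex.I * A s := by
  have hpi := Real.pi_pos
  have hC0 : 0 ≤ C := by
    have := (norm_nonneg _).trans (hA.bound 0 (by simpa using hη₀.le))
    simpa [sectorWeight] using this
  set ℓ : ℝ := Real.log s with hℓ
  have hexpℓ : Complex.exp ℓ = s := by
    rw [← Complex.ofReal_exp, hℓ, Real.exp_log hs]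
  set S : Set ℂ := {w : ℂ | |w.im| < Real.pi / 2} with hS
  have hSo : IsOpen S := isOpen_lt Complex.continuous_im.abs continuous_const
  have hℓS : (ℓ : ℂ) ∈ S := by simp [hS, hpi]
  set D : ℂ → ℂ := dslope Complex.exp ℓ with hD
  have hDne : ∀ w : ℂ, w ≠ ℓ → D w = (Complex.exp w - s) / (w - ℓ) := by
    intro w hw
    rw [hD, dslope_of_ne _ hw, slope_def_field, hexpℓ]
  have hDℓ : D ℓ = s := by rw [hD, dslope_same, Complex.deriv_exp, hexpℓ]
  have hexpne : ∀ w ∈ S, w ≠ ℓ → Complex.exp w - s ≠ 0 := by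
    intro w hw hne h
    rw [← hexpℓ, sub_eq_zero] at h
    refine hne ?_
    have h1 := abs_lt.1 (show |w.im| < Real.pi / 2 from hw)
    exact Complex.exp_inj_of_neg_pi_lt_of_le_pi (by linarith) (by linarith) (by simpa using hpi)
      (by simpa using hpi.le) h
  have hs0 : (s : ℂ) ≠ 0 := by exact_mod_cast hs.ne'
  have hD0 : ∀ w ∈ S, D w ≠ 0 := by
    intro w hw
    by_cases h : w = ℓ
    · rw [h, hDℓ]; exact hs0
    · rw [hDne w h]
      exact div_ne_zero (hexpne w hw h) (sub_ne_zero.2 h)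
  have hDd : DifferentiableOn ℂ D S :=
    (Complex.differentiableOn_dslope (hSo.mem_nhds hℓS)).2 Complex.differentiable_exp.differentiableOn
  -- Dividing by the divided difference of exp gives (w - ℓ) times the Cauchy integrand without a
  -- singularity at ℓ; a second divided difference then subtracts the pole.
  set M : ℂ → ℂ := fun w => A (Complex.exp w) * Complex.exp w / D w with hM
  have hMd : DifferentiableOn ℂ M S := by
    refine DifferentiableOn.div (DifferentiableOn.mul ?_ (by fun_prop)) hDd hD0
    exact hA.differentiableOn.comp (by fun_prop) fun w hw => exp_re_pos hw
  have hMℓ : M ℓ = A s := by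
    simp only [hM, hDℓ, hexpℓ]
    field_simp
  set h : ℂ → ℂ := dslope M ℓ with hh
  have hhd : DifferentiableOn ℂ h S := (Complex.differentiableOn_dslope (hSo.mem_nhds hℓS)).2 hMd
  have hhe : ∀ w ∈ S, w ≠ ℓ → h w =
      A (Complex.exp w) * Complex.exp w / (Complex.exp w - s) - A s * (w - ℓ)⁻¹ := by
    intro w hw hne
    have h1 := sub_ne_zero.2 hne
    have h2 := hexpne w hw hne
    rw [hh, dslope_of_ne _ hne, slope_def_field, hMℓ]
    simp only [hM, hDne w hne]
    field_simp
  -- the vertical sides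
  have hvert : ∀ τ : ℝ, |τ| = 1 → Tendsto (fun L : ℝ => ∫ y in (-η)..η,
      h (((ℓ + τ * L : ℝ) : ℂ) + y * Complex.I)) atTop (𝓝 0) := by
    intro τ hτ
    have hw : Tendsto (fun L : ℝ => (2 * (C * Real.exp (-|(ℓ + τ * L)| / 2)) * (1 + s⁻¹) +
        ‖A s‖ * L⁻¹) * |η - -η|) atTop (𝓝 0) := by
      have h1 : Tendsto (fun L : ℝ => -|(ℓ + τ * L)| / 2) atTop atBot := by
        refine (tendsto_neg_atTop_atBot.comp ?_).atBot_div_const two_pos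
        have : Tendsto (fun L : ℝ => L - |ℓ|) atTop atTop := tendsto_id.atTop_add tendsto_const_nhds
        refine tendsto_atTop_mono' _ ?_ this
        filter_upwards [eventually_ge_atTop 0] with L hL
        have h2 := abs_sub_abs_le_abs_sub (τ * L) (-ℓ)
        rw [abs_mul, hτ, one_mul, abs_of_nonneg hL, abs_neg] at h2
        convert! h2 using 2
        ring
      have h2 := ((((Real.tendsto_exp_atBot.comp h1).const_mul C).const_mul 2).mul_const
        (1 + s⁻¹)).add (tendsto_inv_atTop_zero.const_mul ‖A s‖)
      simpa using h2.mul_const |η - -η|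
    refine squeeze_zero_norm' ?_ hw
    -- The term log 2 forces |e^w| ≥ 2s or |e^w| ≤ s/2 on the vertical sides, hence |e^w - s| ≥ s/2.
    have hbig : ∀ᶠ L : ℝ in atTop, 1 + Real.log 2 ≤ L := eventually_ge_atTop _
    filter_upwards [hbig] with L hL
    have hlog2 : 0 < Real.log 2 := Real.log_pos one_lt_two
    have hL0 : 0 < L := by linarith
    refine intervalIntegral.norm_integral_le_of_norm_le_const fun y hy => ?_
    rw [uIoc_of_le (by linarith)] at hy
    set w : ℂ := ((ℓ + τ * L : ℝ) : ℂ) + y * Complex.I with hwd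
    have hwim : w.im = y := by simp [hwd]
    have hwre : w.re = ℓ + τ * L := by simp [hwd]
    have hyη : |w.im| ≤ η := by rw [hwim]; exact abs_le.2 ⟨hy.1.le, hy.2⟩
    have hwS : w ∈ S := lt_of_le_of_lt hyη hη
    have hLw : L ≤ ‖w - ℓ‖ := by
      calc L = |(w - ℓ).re| := by
            simp [hwre, abs_mul, hτ, abs_of_pos hL0]
        _ ≤ _ := Complex.abs_re_le_norm _
    have hne : w ≠ ℓ := fun h => by
      rw [h, sub_self, norm_zero] at hLw; linarith
    rw [hhe w hwS hne]
    refine (norm_sub_le _ _).trans (add_le_add ?_ ?_)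
    · rw [norm_div, norm_mul]
      have hAw := hA.bound w hyη
      have hew : ‖Complex.exp w‖ = Real.exp (ℓ + τ * L) := by rw [Complex.norm_exp, hwre]
      have hkey : sectorWeight w.re * (‖Complex.exp w‖ / ‖Complex.exp w - s‖) ≤
          2 * Real.exp (-|(ℓ + τ * L)| / 2) * (1 + s⁻¹) := by
        have hsw := sectorWeight_mul_exp_le (θ := 1) le_rfl w.re
        have hmin : min (1 : ℝ) (1 / 2) = 1 / 2 := by norm_num
        rw [hmin, one_mul, ← Complex.norm_exp] at hsw
        have hden : 1 ≤ 2 * (1 + s⁻¹) * ‖Complex.exp w - s‖ := by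
          have hlb : s / 2 ≤ ‖Complex.exp w - s‖ := by
            have hn : ‖(s : ℂ)‖ = s := by rw [Complex.norm_real, Real.norm_of_nonneg hs.le]
            rcases (abs_eq (zero_le_one' ℝ)).1 hτ with h | h
            · have h1 := norm_sub_norm_le (Complex.exp w) s
              rw [hn, hew, h, Real.exp_add, hℓ, Real.exp_log hs, one_mul] at h1
              have : (2 : ℝ) ≤ Real.exp L := by
                rw [← Real.log_le_iff_le_exp two_pos]; linarith
              nlinarith
            · have h1 := norm_sub_norm_le (s : ℂ) (Complex.exp w)
              rw [norm_sub_rev, hn, hew, h, Real.exp_add, hℓ, Real.exp_log hs] at h1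
              have : Real.exp (-1 * L) ≤ 1 / 2 := by
                have e : (1 / 2 : ℝ) = Real.exp (-Real.log 2) := by
                  rw [Real.exp_neg, Real.exp_log two_pos]; norm_num
                rw [e, Real.exp_le_exp]; linarith
              nlinarith
          have h3 : s⁻¹ * s = 1 := inv_mul_cancel₀ hs.ne'
          have h4 : 0 < s⁻¹ := inv_pos.2 hs
          nlinarith [norm_nonneg (Complex.exp w - s)]
        have hpos : 0 < ‖Complex.exp w - s‖ := norm_pos_iff.2 (hexpne w hwS hne)
        rw [mul_div_assoc', div_le_iff₀ hpos]
        calc sectorWeight w.re * ‖Complex.exp w‖ ≤ Real.exp (-(1 / 2 * |w.re|)) := hsw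
          _ = Real.exp (-|(ℓ + τ * L)| / 2) * 1 := by rw [hwre, mul_one]; ring_nf
          _ ≤ Real.exp (-|(ℓ + τ * L)| / 2) * (2 * (1 + s⁻¹) * ‖Complex.exp w - s‖) := by gcongr
          _ = _ := by ring
      calc _ = ‖A (Complex.exp w)‖ * (‖Complex.exp w‖ / ‖Complex.exp w - s‖) := by ring
        _ ≤ C * sectorWeight w.re * (‖Complex.exp w‖ / ‖Complex.exp w - s‖) := by gcongr
        _ = C * (sectorWeight w.re * (‖Complex.exp w‖ / ‖Complex.exp w - s‖)) := by ring
        _ ≤ C * (2 * Real.exp (-|(ℓ + τ * L)| / 2) * (1 + s⁻¹)) := by gcongr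
        _ = _ := by ring
    · rw [norm_mul, norm_inv]
      gcongr
  -- the horizontal sides
  have hsin : 0 < Real.sin η := Real.sin_pos_of_pos_of_lt_pi hη₀ (by linarith)
  have hfi : ∀ σ : ℝ, |σ| = η →
      Integrable fun x : ℝ => rayFun A σ x / (Complex.exp (x + σ * Complex.I) - s) := by
    intro σ hσ
    have hne : ∀ x : ℝ, 0 < ‖Complex.exp (x + σ * Complex.I) - s‖ := fun x =>
      lt_of_lt_of_le (by positivity) (le_norm_exp_sub hη₀ hη hσ x)
    refine ((integrable_rayFun hA hη hσ).norm.mul_const (s * Real.sin η)⁻¹).mono' ?_ ?_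
    · refine Continuous.aestronglyMeasurable ?_
      exact (continuous_rayFun hA.differentiableOn (hσ ▸ hη)).div₀ (by fun_prop)
        fun x => norm_pos_iff.1 (hne x)
    · refine Eventually.of_forall fun x => ?_
      rw [norm_div, div_eq_mul_inv]
      have := le_norm_exp_sub (s := s) hη₀ hη hσ x
      gcongr
  have hη' : |-η| = η := by rw [abs_neg, abs_of_pos hη₀]
  have hη'' : |η| = η := abs_of_pos hη₀
  have hpole := integral_two_mul_I_div (ℓ := ℓ) hη₀
  have hhor : ∀ x : ℝ, h ((x : ℂ) + (-η : ℝ) * Complex.I) - h ((x : ℂ) + η * Complex.I) =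
      (rayFun A (-η) x / (Complex.exp (x + (-η : ℝ) * Complex.I) - s) -
        rayFun A η x / (Complex.exp (x + η * Complex.I) - s)) -
      A s * (((x : ℂ) - η * Complex.I - ℓ)⁻¹ - ((x : ℂ) + η * Complex.I - ℓ)⁻¹) := by
    intro x
    have hS' : ∀ σ : ℝ, |σ| = η → (x : ℂ) + σ * Complex.I ∈ S := fun σ hσ => by
      simp [hS, hσ, hη]
    have hne : ∀ σ : ℝ, |σ| = η → (x : ℂ) + σ * Complex.I ≠ ℓ := fun σ hσ h => by
      have := congrArg Complex.im h
      simp at this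
      rw [this, abs_zero] at hσ
      exact hη₀.ne hσ
    rw [hhe _ (hS' (-η) hη') (hne _ hη'), hhe _ (hS' η hη'') (hne _ hη''), rayFun, rayFun]
    push_cast
    ring
  have hii : Integrable fun x : ℝ =>
      h ((x : ℂ) + (-η : ℝ) * Complex.I) - h ((x : ℂ) + η * Complex.I) := by
    simp_rw [hhor]
    exact ((hfi _ hη').sub (hfi _ hη'')).sub (hpole.1.const_mul _)
  have hlim := intervalIntegral_tendsto_integral hii
    (a := fun L : ℝ => ℓ + (-1) * L) (b := fun L : ℝ => ℓ + 1 * L) (l := atTop)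
    (tendsto_atBot_add_const_left atTop ℓ
      (tendsto_id.const_mul_atTop_of_neg (by norm_num : (-1 : ℝ) < 0)))
    (tendsto_atTop_add_const_left atTop ℓ (tendsto_id.const_mul_atTop one_pos))
  have hcont : ∀ σ : ℝ, |σ| = η → Continuous fun x : ℝ => h ((x : ℂ) + σ * Complex.I) := by
    intro σ hσ
    exact hhd.continuousOn.comp_continuous (by fun_prop) fun x => by simp [hS, hσ, hη]
  have hrect : ∀ L : ℝ, (∫ x in (ℓ + (-1) * L)..(ℓ + 1 * L),
      (h ((x : ℂ) + (-η : ℝ) * Complex.I) - h ((x : ℂ) + η * Complex.I))) =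
      Complex.I * (∫ y in (-η)..η, h (((ℓ + (-1) * L : ℝ) : ℂ) + y * Complex.I)) -
      Complex.I * (∫ y in (-η)..η, h (((ℓ + 1 * L : ℝ) : ℂ) + y * Complex.I)) := by
    intro L
    have := Complex.integral_boundary_rect_eq_zero_of_differentiableOn h
      ⟨ℓ + (-1) * L, -η⟩ ⟨ℓ + 1 * L, η⟩ (hhd.mono ?_)
    · rw [intervalIntegral.integral_sub ((hcont _ hη').intervalIntegrable _ _)
        ((hcont _ hη'').intervalIntegrable _ _)]
      simp only [smul_eq_mul] at this
      linear_combination this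
    · intro p hp
      have := (Complex.mem_reProdIm.1 hp).2
      simp only [uIcc_of_le (by linarith : -η ≤ η)] at this
      exact lt_of_le_of_lt (abs_le.2 this) hη
  have hlim0 := ((hvert (-1) (by simp)).const_mul Complex.I).sub
    ((hvert 1 (by simp)).const_mul Complex.I)
  have hfin := tendsto_nhds_unique (hlim.congr hrect) hlim0
  simp_rw [hhor] at hfin
  have hdiff : Integrable fun x : ℝ =>
      rayFun A (-η) x / (Complex.exp (x + (-η : ℝ) * Complex.I) - s) -
        rayFun A η x / (Complex.exp (x + η * Complex.I) - s) := (hfi _ hη').sub (hfi _ hη'')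
  rw [integral_sub hdiff (hpole.1.const_mul _),
    integral_sub (hfi _ hη') (hfi _ hη''), integral_const_mul, hpole.2] at hfin
  linear_combination hfin

theorem hasDerivAt_integral_div_sub_pow {a γ : ℝ → ℂ} (ha : Integrable a) (hγ : Continuous γ)
    {s₀ : ℂ} {d : ℝ} (hd : 0 < d) (h : ∀ x, d ≤ ‖γ x - s₀‖) (j : ℕ) :
    HasDerivAt (fun s => ∫ x, a x / (γ x - s) ^ (j + 1))
      ((j + 1) * ∫ x, a x / (γ x - s₀) ^ (j + 2)) s₀ := by
  have hball : ∀ s ∈ Metric.ball s₀ (d / 2), ∀ x, d / 2 ≤ ‖γ x - s‖ := by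
    intro s hs x
    rw [Metric.mem_ball, dist_eq_norm] at hs
    have h1 := norm_sub_norm_le (γ x - s₀) (s - s₀)
    have h2 := h x
    rw [sub_sub_sub_cancel_right] at h1
    linarith
  have hmeas : ∀ s ∈ Metric.ball s₀ (d / 2), ∀ k : ℕ,
      AEStronglyMeasurable (fun x => a x / (γ x - s) ^ k) := by
    intro s hs k
    have hc : Continuous fun x => ((γ x - s) ^ k)⁻¹ := by
      refine Continuous.inv₀ (by fun_prop) fun x => pow_ne_zero _ fun h0 => ?_
      have := hball s hs x
      rw [h0, norm_zero] at this
      linarith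
    simp_rw [div_eq_mul_inv]
    exact ha.1.mul hc.aestronglyMeasurable
  have hbound : ∀ s ∈ Metric.ball s₀ (d / 2), ∀ k : ℕ, ∀ x,
      ‖a x / (γ x - s) ^ k‖ ≤ ‖a x‖ * ((d / 2) ^ k)⁻¹ := by
    intro s hs k x
    rw [norm_div, norm_pow, div_eq_mul_inv]
    have := hball s hs x
    gcongr
  have hs₀ : s₀ ∈ Metric.ball s₀ (d / 2) := Metric.mem_ball_self (half_pos hd)
  have key := (hasDerivAt_integral_of_dominated_loc_of_deriv_le
    (F := fun s x => a x / (γ x - s) ^ (j + 1))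
    (F' := fun s x => (j + 1) * (a x / (γ x - s) ^ (j + 2)))
    (bound := fun x => (j + 1) * (‖a x‖ * ((d / 2) ^ (j + 2))⁻¹))
    (Metric.ball_mem_nhds s₀ (half_pos hd)) (μ := volume)
    (Filter.eventually_of_mem (Metric.ball_mem_nhds s₀ (half_pos hd)) fun s hs => hmeas s hs _)
    ((ha.norm.mul_const _).mono' (hmeas s₀ hs₀ _)
      (Eventually.of_forall (hbound s₀ hs₀ (j + 1))))
    ((hmeas s₀ hs₀ _).const_mul _)
    (Eventually.of_forall fun x s hs => ?_)
    ((ha.norm.mul_const _).const_mul _)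
    (Eventually.of_forall fun x s hs => ?_)).2
  · rwa [integral_const_mul] at key
  · rw [norm_mul]
    have : ‖((j : ℂ) + 1)‖ = (j : ℝ) + 1 := by
      have := Complex.norm_natCast (j + 1)
      push_cast at this
      exact this
    rw [this]
    have := hbound s hs (j + 2) x
    gcongr
  · have hne : γ x - s ≠ 0 := fun h0 => by
      have := hball s hs x
      rw [h0, norm_zero] at this
      linarith
    have h1 : HasDerivAt (fun s => (γ x - s) ^ (j + 1))
        (((j + 1 : ℕ) : ℂ) * (γ x - s) ^ j * (-1)) s := by
      simpa using ((hasDerivAt_id s).const_sub (γ x)).fun_pow (j + 1)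
    convert! (hasDerivAt_const s (a x)).div h1 (pow_ne_zero _ hne) using 1
    push_cast
    field_simp
    ring

theorem iterate_deriv_integral_div_sub {a₁ a₂ γ₁ γ₂ : ℝ → ℂ} (ha₁ : Integrable a₁)
    (ha₂ : Integrable a₂) (hγ₁ : Continuous γ₁) (hγ₂ : Continuous γ₂) {s₀ : ℂ} {d : ℝ}
    (h₁ : ∀ x, d ≤ ‖γ₁ x - s₀‖) (h₂ : ∀ x, d ≤ ‖γ₂ x - s₀‖) (j : ℕ) :
    ∀ s ∈ Metric.ball s₀ d,
      deriv^[j] (fun s => (∫ x, a₁ x / (γ₁ x - s)) - ∫ x, a₂ x / (γ₂ x - s)) s =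
      j.factorial * ((∫ x, a₁ x / (γ₁ x - s) ^ (j + 1)) - ∫ x, a₂ x / (γ₂ x - s) ^ (j + 1)) := by
  induction j with
  | zero => intro s _; simp
  | succ j ih =>
    intro s hs
    rw [Function.iterate_succ_apply']
    have heq := Filter.eventuallyEq_of_mem (Metric.isOpen_ball.mem_nhds hs) ih
    rw [heq.deriv_eq]
    have hd : 0 < d - dist s s₀ := sub_pos.2 hs
    have hdist : ∀ γ : ℝ → ℂ, (∀ x, d ≤ ‖γ x - s₀‖) → ∀ x, d - dist s s₀ ≤ ‖γ x - s‖ := by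
      intro γ h x
      have h1 := norm_sub_norm_le (γ x - s₀) (s - s₀)
      have h2 := h x
      rw [sub_sub_sub_cancel_right, ← dist_eq_norm s s₀] at h1
      linarith
    have := (((hasDerivAt_integral_div_sub_pow ha₁ hγ₁ hd (hdist γ₁ h₁) j).sub
      (hasDerivAt_integral_div_sub_pow ha₂ hγ₂ hd (hdist γ₂ h₂) j)).const_mul
      (j.factorial : ℂ)).deriv
    refine Eq.trans this ?_
    rw [Nat.factorial_succ]
    push_cast
    ring

theorem iterate_deriv_eventuallyEq {f g : ℂ → ℂ} {s : ℂ} (h : f =ᶠ[𝓝 s] g) (j : ℕ) :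
    deriv^[j] f =ᶠ[𝓝 s] deriv^[j] g := by
  induction j with
  | zero => exact h
  | succ j ih =>
    rw [Function.iterate_succ_apply', Function.iterate_succ_apply']
    exact ih.deriv

/-- Cauchy's formula is available only at real points. Both sides are holomorphic near s, so the
identity theorem extends it to a complex neighbourhood, where it can be differentiated under the
integral. -/
theorem iterate_deriv_eq_cauchy {A : ℂ → ℂ} {η C s : ℝ} (hA : SectorDecay A η C) (hη₀ : 0 < η)
    (hη : η < Real.pi / 2) (hs : 0 < s) (j : ℕ) :
    deriv^[j] A s = (2 * Real.pi * Complex.I)⁻¹ * (j.factorial *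
      ((∫ x : ℝ, rayFun A (-η) x / (Complex.exp (x + (-η : ℝ) * Complex.I) - s) ^ (j + 1)) -
      ∫ x : ℝ, rayFun A η x / (Complex.exp (x + η * Complex.I) - s) ^ (j + 1))) := by
  have hη' : |-η| = η := by rw [abs_neg, abs_of_pos hη₀]
  have hη'' : |η| = η := abs_of_pos hη₀
  have hd : 0 < s * Real.sin η :=
    mul_pos hs (Real.sin_pos_of_pos_of_lt_pi hη₀ (by linarith [Real.pi_pos]))
  set P : ℂ → ℂ := fun p =>
    (∫ x : ℝ, rayFun A (-η) x / (Complex.exp (x + (-η : ℝ) * Complex.I) - p)) -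
      ∫ x : ℝ, rayFun A η x / (Complex.exp (x + η * Complex.I) - p) with hP
  have hPj := iterate_deriv_integral_div_sub (integrable_rayFun hA hη hη')
    (integrable_rayFun hA hη hη'') (γ₁ := fun x => Complex.exp (x + (-η : ℝ) * Complex.I))
    (γ₂ := fun x => Complex.exp (x + η * Complex.I)) (by fun_prop) (by fun_prop)
    (fun x => le_norm_exp_sub (s := s) hη₀ hη hη' x) (fun x => le_norm_exp_sub hη₀ hη hη'' x)
  have hPd : DifferentiableOn ℂ P (Metric.ball (s : ℂ) (s * Real.sin η)) := by
    intro p hp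
    have hd' : 0 < s * Real.sin η - dist p s := sub_pos.2 hp
    have hdist : ∀ σ : ℝ, |σ| = η → ∀ x : ℝ,
        s * Real.sin η - dist p s ≤ ‖Complex.exp (x + σ * Complex.I) - p‖ := by
      intro σ hσ x
      have h1 := norm_sub_norm_le (Complex.exp (x + σ * Complex.I) - s) (p - s)
      have h2 := le_norm_exp_sub (s := s) hη₀ hη hσ x
      rw [sub_sub_sub_cancel_right, ← dist_eq_norm p s] at h1
      linarith
    have := ((hasDerivAt_integral_div_sub_pow (integrable_rayFun hA hη hη')
      (γ := fun x => Complex.exp (x + (-η : ℝ) * Complex.I)) (by fun_prop) hd'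
      (hdist _ hη') 0).sub (hasDerivAt_integral_div_sub_pow (integrable_rayFun hA hη hη'')
      (γ := fun x => Complex.exp (x + η * Complex.I)) (by fun_prop) hd'
      (hdist _ hη'') 0)).differentiableAt
    simp only [zero_add, pow_one] at this
    exact this.differentiableWithinAt
  have hPa : AnalyticAt ℂ P s := hPd.analyticAt (Metric.ball_mem_nhds _ hd)
  have hAa : AnalyticAt ℂ A s :=
    hA.differentiableOn.analyticAt (isOpen_re_pos.mem_nhds (by simpa using hs))
  have hpi : (2 * Real.pi * Complex.I : ℂ) ≠ 0 := by
    simp [Complex.I_ne_zero, Real.pi_ne_zero]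
  have heq : A =ᶠ[𝓝 (s : ℂ)] fun p => (2 * Real.pi * Complex.I)⁻¹ * P p := by
    have hPa' : AnalyticAt ℂ (fun p => (2 * Real.pi * Complex.I : ℂ)⁻¹ * P p) s :=
      analyticAt_const.mul hPa
    refine (hAa.frequently_eq_iff_eventually_eq hPa').1 ?_
    -- Real points accumulate at s, which is what the identity theorem needs.
    have ht : Tendsto (fun x : ℝ => (x : ℂ)) (𝓝[≠] s) (𝓝[≠] (s : ℂ)) := by
      refine tendsto_nhdsWithin_of_tendsto_nhds_of_eventually_within _
        (Complex.continuous_ofReal.continuousAt.tendsto.mono_left nhdsWithin_le_nhds) ?_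
      filter_upwards [self_mem_nhdsWithin] with x hx
      simpa using hx
    refine ht.frequently (Eventually.frequently ?_)
    filter_upwards [nhdsWithin_le_nhds (lt_mem_nhds hs)] with x hx
    have hPx : P (x : ℂ) = 2 * Real.pi * Complex.I * A x := cauchy_sector hA hη₀ hη hx
    rw [hPx, inv_mul_cancel_left₀ hpi]
  rw [(iterate_deriv_eventuallyEq heq j).eq_of_nhds]
  have hmul : ∀ k : ℕ, deriv^[k] (fun p => (2 * Real.pi * Complex.I : ℂ)⁻¹ * P p) =
      fun p => (2 * Real.pi * Complex.I : ℂ)⁻¹ * deriv^[k] P p := by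
    intro k
    induction k with
    | zero => rfl
    | succ k ih =>
      rw [Function.iterate_succ_apply', ih]
      funext p
      rw [deriv_const_mul_field, Function.iterate_succ_apply']
  rw [hmul j]
  simp only
  rw [hPj j s (Metric.mem_ball_self hd)]

/-- The distance d from s to the path dominates the j-th term by its coefficient times d^{-j-1}, a
summable sequence, so sum and integral may be interchanged. -/
theorem hasSum_integral_mlKernel {α b t : ℝ} (hα : 1 < α) (hb : 1 ≤ b) (ht : 0 < t) {a γ : ℝ → ℂ}
    (ha : Integrable a) (hγ : Continuous γ) {s : ℂ} {d : ℝ} (hd : 0 < d)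
    (h : ∀ x, d ≤ ‖γ x - s‖) :
    HasSum (fun j : ℕ => (mlCoeff α b t j : ℂ) * ∫ x, a x / (γ x - s) ^ (j + 1))
      (∫ x, a x * mlKernel α b t (γ x - s)) := by
  have hne : ∀ x, γ x - s ≠ 0 := fun x h0 => by
    have := h x
    rw [h0, norm_zero] at this
    linarith
  have hc : ∀ j : ℕ, Continuous fun x => ((γ x - s) ^ (j + 1))⁻¹ := fun j =>
    Continuous.inv₀ (by fun_prop) fun x => pow_ne_zero _ (hne x)
  set F : ℕ → ℝ → ℂ := fun j x => (mlCoeff α b t j : ℂ) * (a x / (γ x - s) ^ (j + 1)) with hF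
  have hbd : ∀ j x, ‖F j x‖ ≤ mlCoeff α b t j * (d ^ (j + 1))⁻¹ * ‖a x‖ := by
    intro j x
    have h0 := mlCoeff_nonneg hα hb ht j
    rw [hF, norm_mul, norm_div, norm_pow, Complex.norm_real, Real.norm_of_nonneg h0, mul_assoc,
      div_eq_mul_inv, mul_comm ‖a x‖]
    have := h x
    gcongr
  have hFi : ∀ j, Integrable (F j) := by
    intro j
    refine (ha.norm.const_mul _).mono' ?_ (Eventually.of_forall (hbd j))
    simp_rw [hF, div_eq_mul_inv]
    exact (ha.1.mul (hc j).aestronglyMeasurable).const_mul _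
  have hsm : Summable fun j => ∫ x, ‖F j x‖ := by
    refine ((summable_mlCoeff_mul hα hb ht hd).mul_right (∫ x, ‖a x‖)).of_nonneg_of_le
      (fun j => integral_nonneg fun x => norm_nonneg _) fun j => ?_
    rw [← integral_const_mul]
    exact integral_mono (hFi j).norm (ha.norm.const_mul _) (hbd j)
  have h1 := hasSum_integral_of_summable_integral_norm hFi hsm
  have h2 : ∀ x, ∑' j, F j x = a x * mlKernel α b t (γ x - s) := by
    intro x
    have := (hasSum_mlKernel hα hb ht (hne x)).mul_left (a x)
    rw [← this.tsum_eq]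
    refine tsum_congr fun j => ?_
    rw [hF]
    ring
  simp_rw [h2] at h1
  convert! h1 using 2 with j
  rw [hF, integral_const_mul]

/-- Decay in `t` of `∑ t ^ (α j + b - 1) / Γ(α j + b) A⁽ʲ⁾(s)`, uniformly in `s > 0`. -/
theorem exists_norm_hasSum_le {α b μ ε C : ℝ} (hα₁ : 1 < α) (hα₂ : α < 2) (hb : 1 ≤ b)
    (hε : ε = Real.pi * (2 - α) / 8) (hμ : 1 < μ) (hμ₁ : b + 1 - α < μ) (hμ₂ : μ < b + 1)
    {A : ℂ → ℂ} (hA : SectorDecay A (Real.pi / 2 - 2 * ε) C) :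
    ∃ C' : ℝ, ∀ t > 0, ∀ s : ℝ, 0 < s → ∃ S : ℂ,
      HasSum (fun j : ℕ => ((t ^ (α * j + b - 1) / Real.Gamma (α * j + b) : ℝ) : ℂ) *
        deriv^[j] A s) S ∧ ‖S‖ ≤ C' * t ^ (μ - 2) := by
  have hpi := Real.pi_pos
  have hε0 : 0 < ε := by rw [hε]; have := mul_pos hpi (sub_pos.2 hα₂); linarith
  have hε8 : ε < Real.pi / 8 := by rw [hε]; nlinarith
  -- The gap π - πα/2 is split into four parts ε. The contour rays have angle η = π/2 - 2ε and the
  -- Borel rays angle ψ = π - 3ε: thus ψ > πα/2 gives decay of E_{α,b}, ψ ≥ π/2 gives cos ψ ≤ 0, and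
  -- ψ - η = π/2 - ε has positive cosine.
  have hαε : Real.pi * α / 2 = Real.pi - 4 * ε := by rw [hε]; ring
  set η : ℝ := Real.pi / 2 - 2 * ε with hη
  set ψ : ℝ := Real.pi - 3 * ε with hψ
  have hη₀ : 0 < η := by rw [hη]; linarith
  have hη₁ : η < Real.pi / 2 := by rw [hη]; linarith
  have hψα : Real.pi * α / 2 < ψ := by rw [hαε, hψ]; linarith
  have hψπ : ψ ≤ Real.pi := by rw [hψ]; linarith
  have hψ0 : 0 < ψ := by rw [hψ]; linarith
  have hα0 : 0 < α := by linarith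
  set θ : ℝ := (b + 1 - μ) / α with hθd
  have hθ1 : θ < 1 := by rw [hθd, div_lt_one hα0]; linarith
  have hθ0 : 0 < θ := div_pos (by linarith) hα0
  have hC0 : 0 ≤ C := by
    have := (norm_nonneg _).trans (hA.bound 0 (by simpa using hη₀.le))
    simpa [sectorWeight] using this
  have hcosε : 0 < Real.cos (ψ - η) := by
    refine Real.cos_pos_of_mem_Ioo ⟨?_, ?_⟩ <;> rw [hψ, hη] <;> linarith
  have hcosψ : Real.cos ψ ≤ 0 :=
    Real.cos_nonpos_of_pi_div_two_le_of_le (by rw [hψ]; linarith) (by linarith)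
  -- one ray
  have ray : ∀ τ : ℝ, |τ| = 1 → ∃ B : ℝ, ∀ t > 0, ∀ s : ℝ, 0 < s →
      ‖∫ x : ℝ, rayFun A (τ * η) x *
        mlKernel α b t (Complex.exp (x + (τ * η : ℝ) * Complex.I) - s)‖ ≤ B * t ^ (μ - 2) := by
    intro τ hτ
    -- The Borel direction is turned to the side opposite to the contour ray, so that arg(ζz) has
    -- modulus ψ - η < π/2.
    set z : ℂ := Complex.exp ((-τ * ψ : ℝ) * Complex.I) with hz
    have hz1 : ‖z‖ = 1 := Complex.norm_exp_ofReal_mul_I _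
    obtain ⟨D, hD⟩ := norm_mlPower_le (b := b) (χ := -τ * ψ) hα₁ hb hψα hψπ
      (by rw [abs_mul, abs_neg, hτ, one_mul, abs_of_pos hψ0]) hμ hμ₁.le hμ₂.le
    have hD0 : 0 ≤ D := by
      have := (norm_nonneg _).trans (hD 1 one_pos)
      simpa using this
    have hτη : |τ * η| = η := by rw [abs_mul, hτ, one_mul, abs_of_pos hη₀]
    have hcos1 : Real.cos (τ * ψ) = Real.cos ψ := by
      rcases (abs_eq (zero_le_one' ℝ)).1 hτ with h | h <;> simp [h]
    have hcos2 : Real.cos (τ * η - τ * ψ) = Real.cos (ψ - η) := by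
      rcases (abs_eq (zero_le_one' ℝ)).1 hτ with h | h
      · rw [h, one_mul, one_mul, ← Real.cos_neg]; ring_nf
      · rw [h]; ring_nf
    -- The point s contributes -s cos ψ ≥ 0 to Re((ζ - s)z). Dropping it gives a lower bound free of
    -- s, the source of the uniformity in s.
    have hre : ∀ x s : ℝ, 0 < s → Real.exp x * Real.cos (ψ - η) ≤
        ((Complex.exp (x + (τ * η : ℝ) * Complex.I) - s) * z).re := by
      intro x s hs
      have e : (Complex.exp (x + (τ * η : ℝ) * Complex.I) - s) * z =
          Complex.exp (x + (τ * η - τ * ψ : ℝ) * Complex.I) -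
            s * Complex.exp ((-τ * ψ : ℝ) * Complex.I) := by
        rw [sub_mul, hz, ← Complex.exp_add]
        push_cast
        ring_nf
      rw [e, Complex.sub_re, Complex.exp_re, Complex.re_ofReal_mul, Complex.exp_ofReal_mul_I_re]
      have e2 : Real.cos (-τ * ψ) = Real.cos ψ := by rw [neg_mul, Real.cos_neg, hcos1]
      have e3 : ((x : ℂ) + (τ * η - τ * ψ : ℝ) * Complex.I).re = x := by simp
      have e4 : ((x : ℂ) + (τ * η - τ * ψ : ℝ) * Complex.I).im = τ * η - τ * ψ := by simp
      rw [e2, e3, e4, hcos2]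
      nlinarith
    refine ⟨C * D * Real.cos (ψ - η) ^ (θ - 1) * Real.Gamma (1 - θ) *
      ∫ x : ℝ, sectorWeight x * Real.exp (θ * x), fun t ht s hs => ?_⟩
    have hG : 0 < Real.Gamma (1 - θ) := Real.Gamma_pos_of_pos (by linarith)
    have e : C * D * Real.cos (ψ - η) ^ (θ - 1) * Real.Gamma (1 - θ) *
        (∫ x : ℝ, sectorWeight x * Real.exp (θ * x)) * t ^ (μ - 2) =
        ∫ x : ℝ, (C * D * Real.cos (ψ - η) ^ (θ - 1) * Real.Gamma (1 - θ) * t ^ (μ - 2)) *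
          (sectorWeight x * Real.exp (θ * x)) := by
      rw [integral_const_mul]; ring
    rw [e]
    refine norm_integral_le_of_norm_le
      ((integrable_sectorWeight_mul_exp hθ0 hθ1.le).const_mul _) (Eventually.of_forall fun x => ?_)
    have hx := hre x s hs
    have hxp : 0 < Real.exp x * Real.cos (ψ - η) := mul_pos (Real.exp_pos _) hcosε
    have h1 := norm_mlKernel_le hα₁ hb hz1 hD hθ1 ht (hxp.trans_le hx)
    have h2 := norm_rayFun_le hA hτη x
    have h3 := Real.rpow_le_rpow_of_nonpos hxp hx (by linarith : θ - 1 ≤ 0)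
    rw [Real.mul_rpow (Real.exp_pos _).le hcosε.le, ← Real.exp_mul] at h3
    have hsw := sectorWeight_nonneg x
    rw [norm_mul]
    calc _ ≤ (C * (sectorWeight x * Real.exp (1 * x))) * (D * t ^ (μ - 2) *
          ((Real.exp (x * (θ - 1)) * Real.cos (ψ - η) ^ (θ - 1)) * Real.Gamma (1 - θ))) := by
          refine mul_le_mul h2 (h1.trans ?_) (norm_nonneg _) (by positivity)
          gcongr
      _ = (C * D * Real.cos (ψ - η) ^ (θ - 1) * Real.Gamma (1 - θ) * t ^ (μ - 2)) *
          (sectorWeight x * (Real.exp (1 * x) * Real.exp (x * (θ - 1)))) := by ring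
      _ = _ := by
          rw [← Real.exp_add]
          ring_nf
  obtain ⟨B₁, hB₁⟩ := ray (-1) (by simp)
  obtain ⟨B₂, hB₂⟩ := ray 1 (by simp)
  refine ⟨(2 * Real.pi)⁻¹ * (B₁ + B₂), fun t ht s hs => ?_⟩
  have hη' : |-η| = η := by rw [abs_neg, abs_of_pos hη₀]
  have hη'' : |η| = η := abs_of_pos hη₀
  have hd : 0 < s * Real.sin η :=
    mul_pos hs (Real.sin_pos_of_pos_of_lt_pi hη₀ (by linarith [Real.pi_pos]))
  have k₁ := hasSum_integral_mlKernel hα₁ hb ht (integrable_rayFun hA hη₁ hη')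
    (γ := fun x => Complex.exp (x + (-η : ℝ) * Complex.I)) (by fun_prop) hd
    (fun x => le_norm_exp_sub hη₀ hη₁ hη' x)
  have k₂ := hasSum_integral_mlKernel hα₁ hb ht (integrable_rayFun hA hη₁ hη'')
    (γ := fun x => Complex.exp (x + η * Complex.I)) (by fun_prop) hd
    (fun x => le_norm_exp_sub hη₀ hη₁ hη'' x)
  have k := (k₁.sub k₂).mul_left (2 * Real.pi * Complex.I)⁻¹
  have hfun : (fun j : ℕ => ((t ^ (α * j + b - 1) / Real.Gamma (α * j + b) : ℝ) : ℂ) *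
      deriv^[j] A s) = fun j : ℕ => (2 * Real.pi * Complex.I)⁻¹ *
        ((mlCoeff α b t j : ℂ) *
          (∫ x : ℝ, rayFun A (-η) x / (Complex.exp (x + (-η : ℝ) * Complex.I) - s) ^ (j + 1)) -
        (mlCoeff α b t j : ℂ) *
          ∫ x : ℝ, rayFun A η x / (Complex.exp (x + η * Complex.I) - s) ^ (j + 1)) := by
    funext j
    rw [iterate_deriv_eq_cauchy hA hη₀ hη₁ hs j, mlCoeff]
    push_cast
    ring
  rw [hfun]
  refine ⟨_, k, ?_⟩
  have n₁ := hB₁ t ht s hs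
  have n₂ := hB₂ t ht s hs
  rw [neg_one_mul] at n₁
  rw [one_mul] at n₂
  have hn : ‖(2 * Real.pi * Complex.I : ℂ)⁻¹‖ = (2 * Real.pi)⁻¹ := by
    simp [abs_of_pos hpi]
  rw [norm_mul, hn, mul_assoc, add_mul]
  gcongr
  exact (norm_sub_le _ _).trans (add_le_add n₁ n₂)

/-! ### Riemann-Liouville integrals -/

theorem integral_rpow_mul_rpow {a b t : ℝ} (ha : 0 < a) (hb : 0 < b) (ht : 0 < t) :
    ∫ x in (0 : ℝ)..t, (t - x) ^ (a - 1) / Real.Gamma a * (x ^ (b - 1) / Real.Gamma b) =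
      t ^ (a + b - 1) / Real.Gamma (a + b) := by
  have h1 := Complex.betaIntegral_scaled (b : ℂ) (a : ℂ) ht
  rw [Complex.betaIntegral_eq_Gamma_mul_div _ _ (by simpa) (by simpa)] at h1
  have h2 : ∫ x in (0 : ℝ)..t, (x : ℂ) ^ ((b : ℂ) - 1) * ((t : ℂ) - x) ^ ((a : ℂ) - 1) =
      ((∫ x in (0 : ℝ)..t, x ^ (b - 1) * (t - x) ^ (a - 1) : ℝ) : ℂ) := by
    rw [← intervalIntegral.integral_ofReal]
    refine intervalIntegral.integral_congr fun x hx => ?_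
    rw [uIcc_of_le ht.le] at hx
    rw [Complex.ofReal_mul, Complex.ofReal_cpow hx.1, Complex.ofReal_cpow (sub_nonneg.2 hx.2)]
    push_cast
    rfl
  rw [h2] at h1
  have h3 : ∫ x in (0 : ℝ)..t, x ^ (b - 1) * (t - x) ^ (a - 1) =
      t ^ (b + a - 1) * (Real.Gamma b * Real.Gamma a / Real.Gamma (b + a)) := by
    apply Complex.ofReal_injective
    rw [h1]
    push_cast [Complex.ofReal_cpow ht.le, ← Complex.Gamma_ofReal]
    rfl
  have ha' := (Real.Gamma_pos_of_pos ha).ne'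
  have hb' := (Real.Gamma_pos_of_pos hb).ne'
  have e : ∀ x : ℝ, (t - x) ^ (a - 1) / Real.Gamma a * (x ^ (b - 1) / Real.Gamma b) =
      (Real.Gamma a * Real.Gamma b)⁻¹ * (x ^ (b - 1) * (t - x) ^ (a - 1)) := by
    intro x; field_simp
  simp_rw [e]
  rw [intervalIntegral.integral_const_mul, h3, add_comm b a]
  field_simp

/-- A non-integrable function has integral zero by convention, whereas the Beta integral is
positive. -/
theorem intervalIntegrable_rpow_mul_rpow {a b t : ℝ} (ha : 0 < a) (hb : 0 < b) (ht : 0 < t) :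
    IntervalIntegrable
      (fun x => (t - x) ^ (a - 1) / Real.Gamma a * (x ^ (b - 1) / Real.Gamma b)) volume 0 t := by
  by_contra h
  have h1 := integral_rpow_mul_rpow ha hb ht
  rw [intervalIntegral.integral_undef h] at h1
  have := Real.Gamma_pos_of_pos (add_pos ha hb)
  have : 0 < t ^ (a + b - 1) / Real.Gamma (a + b) := by positivity
  linarith

/-- The Riemann-Liouville integral of order `a` of a function on `[0, ∞)`. -/
noncomputable def rlIntegral (a : ℝ) (f : ℝ → ℂ) (t : ℝ) : ℂ :=
  ∫ τ in (0 : ℝ)..t, (((t - τ) ^ (a - 1) / Real.Gamma a : ℝ) : ℂ) * f τ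

theorem intervalIntegrable_rlKernel {a : ℝ} (ha : 0 < a) (t : ℝ) :
    IntervalIntegrable (fun τ => (t - τ) ^ (a - 1) / Real.Gamma a) volume 0 t := by
  have := (intervalIntegral.intervalIntegrable_rpow' (a := t) (b := 0)
    (by linarith : -1 < a - 1)).comp_sub_left t
  simpa using this.div_const (Real.Gamma a)

theorem intervalIntegrable_rlIntegrand {a t : ℝ} (ha : 0 < a) (ht : 0 ≤ t) {f : ℝ → ℂ}
    (hf : ContinuousOn f (Icc 0 t)) :
    IntervalIntegrable (fun τ => (((t - τ) ^ (a - 1) / Real.Gamma a : ℝ) : ℂ) * f τ) volume 0 t :=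
  IntervalIntegrable.mul_continuousOn (f := fun τ => (((t - τ) ^ (a - 1) / Real.Gamma a : ℝ) : ℂ))
    ⟨(intervalIntegrable_rlKernel ha t).1.ofReal, (intervalIntegrable_rlKernel ha t).2.ofReal⟩
    (by rwa [uIcc_of_le ht])

theorem rlIntegral_congr {a t : ℝ} (ht : 0 ≤ t) {f g : ℝ → ℂ} (h : ∀ τ ∈ Icc 0 t, f τ = g τ) :
    rlIntegral a f t = rlIntegral a g t := by
  refine intervalIntegral.integral_congr fun x hx => ?_
  rw [uIcc_of_le ht] at hx
  simp only [h x hx]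

theorem rlIntegral_add {a t : ℝ} (ha : 0 < a) (ht : 0 ≤ t) {f g : ℝ → ℂ}
    (hf : ContinuousOn f (Icc 0 t)) (hg : ContinuousOn g (Icc 0 t)) :
    rlIntegral a (fun τ => f τ + g τ) t = rlIntegral a f t + rlIntegral a g t := by
  simp only [rlIntegral, mul_add]
  exact intervalIntegral.integral_add (intervalIntegrable_rlIntegrand ha ht hf)
    (intervalIntegrable_rlIntegrand ha ht hg)

theorem rlIntegral_sub {a t : ℝ} (ha : 0 < a) (ht : 0 ≤ t) {f g : ℝ → ℂ}
    (hf : ContinuousOn f (Icc 0 t)) (hg : ContinuousOn g (Icc 0 t)) :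
    rlIntegral a (fun τ => f τ - g τ) t = rlIntegral a f t - rlIntegral a g t := by
  simp only [rlIntegral, mul_sub]
  exact intervalIntegral.integral_sub (intervalIntegrable_rlIntegrand ha ht hf)
    (intervalIntegrable_rlIntegrand ha ht hg)

theorem rlIntegral_const_mul (a t : ℝ) (c : ℂ) (f : ℝ → ℂ) :
    rlIntegral a (fun τ => c * f τ) t = c * rlIntegral a f t := by
  simp only [rlIntegral]
  rw [← intervalIntegral.integral_const_mul]
  congr 1 with τ
  ring

theorem rlIntegral_one (f : ℝ → ℂ) (t : ℝ) : rlIntegral 1 f t = ∫ τ in (0 : ℝ)..t, f τ := by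
  simp [rlIntegral]

theorem rlIntegral_rpow {a β t : ℝ} (ha : 0 < a) (hβ : 0 ≤ β) (ht : 0 ≤ t) :
    rlIntegral a (fun τ => ((τ ^ β / Real.Gamma (β + 1) : ℝ) : ℂ)) t =
      ((t ^ (a + β) / Real.Gamma (a + β + 1) : ℝ) : ℂ) := by
  rcases ht.eq_or_lt with rfl | ht
  · rw [Real.zero_rpow (by linarith)]
    simp [rlIntegral]
  have := integral_rpow_mul_rpow ha (by linarith : 0 < β + 1) ht
  simp only [add_sub_cancel_right, ← add_assoc] at this
  rw [← this, ← intervalIntegral.integral_ofReal, rlIntegral]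
  push_cast
  rfl

theorem norm_rlIntegral_le {a β K t : ℝ} (ha : 0 < a) (hβ : 0 ≤ β) (ht : 0 ≤ t) {f : ℝ → ℂ}
    (hf : ∀ τ ∈ Icc 0 t, ‖f τ‖ ≤ K * (τ ^ β / Real.Gamma (β + 1))) :
    ‖rlIntegral a f t‖ ≤ K * (t ^ (a + β) / Real.Gamma (a + β + 1)) := by
  rcases ht.eq_or_lt with rfl | ht
  · rw [Real.zero_rpow (by linarith)]
    simp [rlIntegral]
  have hG := Real.Gamma_pos_of_pos ha
  have := integral_rpow_mul_rpow ha (by linarith : 0 < β + 1) ht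
  have hi := intervalIntegrable_rpow_mul_rpow ha (by linarith : 0 < β + 1) ht
  simp only [add_sub_cancel_right, ← add_assoc] at this hi
  rw [← this, rlIntegral, ← intervalIntegral.integral_const_mul]
  refine intervalIntegral.norm_integral_le_of_norm_le ht.le (Eventually.of_forall fun τ hτ => ?_)
    (hi.const_mul K)
  have h0 : 0 ≤ t - τ := sub_nonneg.2 hτ.2
  rw [norm_mul, Complex.norm_real, Real.norm_of_nonneg (by positivity), mul_left_comm]
  exact mul_le_mul_of_nonneg_left (hf τ ⟨hτ.1.le, hτ.2⟩) (by positivity)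

/-- The kernel of the Riemann-Liouville integral, extended by zero. -/
noncomputable def rlKernel (a x : ℝ) : ℝ := if 0 < x then x ^ (a - 1) / Real.Gamma a else 0

theorem measurable_rlKernel (a : ℝ) : Measurable (rlKernel a) :=
  Measurable.ite measurableSet_Ioi (by fun_prop) measurable_const

theorem rlKernel_nonneg {a : ℝ} (ha : 0 < a) (x : ℝ) : 0 ≤ rlKernel a x := by
  have := Real.Gamma_pos_of_pos ha
  rw [rlKernel]
  split_ifs <;> positivity

theorem setIntegral_rlKernel {a t T : ℝ} (ht : 0 ≤ t) (hT : t ≤ T) (f : ℝ → ℂ) :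
    ∫ τ in Ioc 0 T, (rlKernel a (t - τ) : ℂ) * f τ = rlIntegral a f t := by
  have h : ∫ τ in Ioc 0 T, (rlKernel a (t - τ) : ℂ) * f τ =
      ∫ τ in Ioc 0 t, (rlKernel a (t - τ) : ℂ) * f τ := by
    refine setIntegral_eq_of_subset_of_forall_sdiff_eq_zero measurableSet_Ioc
      (Ioc_subset_Ioc_right hT) fun x hx => ?_
    have : ¬ 0 < t - x := fun h => hx.2 ⟨hx.1.1, by linarith⟩
    rw [rlKernel, if_neg this]
    simp
  rw [h, rlIntegral, intervalIntegral.integral_of_le ht, integral_Ioc_eq_integral_Ioo,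
    integral_Ioc_eq_integral_Ioo]
  refine setIntegral_congr_fun measurableSet_Ioo fun x hx => ?_
  rw [rlKernel, if_pos (sub_pos.2 hx.2)]

theorem integrableOn_rlKernel_mul_rlKernel {a b σ t : ℝ} (ha : 0 < a) (hb : 0 < b) (hσ : 0 ≤ σ)
    (hσt : σ < t) :
    IntegrableOn (fun τ => rlKernel a (t - τ) * rlKernel b (τ - σ)) (Ioc 0 t) ∧
    ∫ τ in Ioc 0 t, rlKernel a (t - τ) * rlKernel b (τ - σ) = rlKernel (a + b) (t - σ) := by
  have hd : 0 < t - σ := sub_pos.2 hσt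
  have h0 : ∀ x ∈ Ioc 0 t \ Ioo σ t, rlKernel a (t - x) * rlKernel b (x - σ) = 0 := by
    intro x hx
    by_cases h : σ < x
    · have : ¬ 0 < t - x := fun h' => hx.2 ⟨h, by linarith⟩
      rw [rlKernel, if_neg this, zero_mul]
    · have : ¬ 0 < x - σ := fun h' => h (by linarith)
      rw [show rlKernel b (x - σ) = 0 from if_neg this, mul_zero]
  have hsub : Ioo σ t ⊆ Ioc 0 t := fun x hx => ⟨hσ.trans_lt hx.1, hx.2.le⟩
  have hsub' : Ioo σ t ⊆ Icc σ t := Ioo_subset_Icc_self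
  have heq : EqOn (fun τ => rlKernel a (t - τ) * rlKernel b (τ - σ))
      (fun τ => ((t - σ) - (τ - σ)) ^ (a - 1) / Real.Gamma a *
        ((τ - σ) ^ (b - 1) / Real.Gamma b)) (Ioo σ t) := by
    intro x hx
    simp only
    rw [rlKernel, rlKernel, if_pos (sub_pos.2 hx.2), if_pos (sub_pos.2 hx.1), sub_sub_sub_cancel_right]
  have hi := (intervalIntegrable_rpow_mul_rpow ha hb hd).comp_sub_right σ
  have hv := intervalIntegral.integral_comp_sub_right (a := σ) (b := t)
    (fun x => ((t - σ) - x) ^ (a - 1) / Real.Gamma a * (x ^ (b - 1) / Real.Gamma b)) σ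
  rw [zero_add, sub_add_cancel, intervalIntegrable_iff_integrableOn_Ioo_of_le hσt.le] at hi
  rw [sub_self, integral_rpow_mul_rpow ha hb hd, intervalIntegral.integral_of_le hσt.le,
    integral_Ioc_eq_integral_Ioo] at hv
  constructor
  · have h1 : IntegrableOn (fun τ => rlKernel a (t - τ) * rlKernel b (τ - σ)) (Ioo σ t) :=
      hi.congr_fun heq.symm measurableSet_Ioo
    exact h1.of_forall_sdiff_eq_zero measurableSet_Ioc h0
  · rw [setIntegral_eq_of_subset_of_forall_sdiff_eq_zero measurableSet_Ioc hsub h0,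
      setIntegral_congr_fun measurableSet_Ioo heq, hv, rlKernel, if_pos hd]

/-- The semigroup property of the Riemann-Liouville integrals. -/
theorem rlIntegral_rlIntegral {a b t : ℝ} (ha : 0 < a) (hb : 0 < b) (ht : 0 ≤ t) {f : ℝ → ℂ}
    (hf : ContinuousOn f (Icc 0 t)) :
    rlIntegral a (rlIntegral b f) t = rlIntegral (a + b) f t := by
  set g : ℝ → ℂ := (Ioc 0 t).indicator f with hg
  have hgm : AEStronglyMeasurable g (volume.restrict (Ioc 0 t)) := by
    refine AEStronglyMeasurable.congr (f := f) ?_ ?_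
    · exact (hf.mono Ioc_subset_Icc_self).aestronglyMeasurable measurableSet_Ioc
    · filter_upwards [ae_restrict_mem measurableSet_Ioc] with x hx
      rw [hg, indicator_of_mem hx]
  obtain ⟨K, hK⟩ := isCompact_Icc.exists_bound_of_continuousOn hf
  have hfg : ∀ τ ∈ Ioc 0 t, g τ = f τ := fun τ hτ => by rw [hg, indicator_of_mem hτ]
  have e1 : rlIntegral a (rlIntegral b f) t = ∫ τ in Ioc 0 t, ∫ σ in Ioc 0 t,
      (rlKernel a (t - τ) : ℂ) * ((rlKernel b (τ - σ) : ℂ) * g σ) := by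
    rw [← setIntegral_rlKernel ht le_rfl]
    refine setIntegral_congr_fun measurableSet_Ioc fun τ hτ => ?_
    rw [← setIntegral_rlKernel hτ.1.le hτ.2, ← integral_const_mul]
    refine setIntegral_congr_fun measurableSet_Ioc fun σ hσ => ?_
    simp only [hfg σ hσ]
  have hnorm : ∀ τ σ, ‖(rlKernel a (t - τ) : ℂ) * ((rlKernel b (τ - σ) : ℂ) * g σ)‖ =
      rlKernel a (t - τ) * rlKernel b (τ - σ) * ‖g σ‖ := by
    intro τ σ
    rw [norm_mul, norm_mul, Complex.norm_real, Complex.norm_real,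
      Real.norm_of_nonneg (rlKernel_nonneg ha _), Real.norm_of_nonneg (rlKernel_nonneg hb _),
      mul_assoc]
  have hlt : ∀ᵐ σ ∂(volume.restrict (Ioc 0 t)), σ ∈ Ioo 0 t := by
    rw [← restrict_Ioo_eq_restrict_Ioc]
    exact ae_restrict_mem measurableSet_Ioo
  have hint : Integrable (Function.uncurry fun τ σ =>
      (rlKernel a (t - τ) : ℂ) * ((rlKernel b (τ - σ) : ℂ) * g σ))
      ((volume.restrict (Ioc 0 t)).prod (volume.restrict (Ioc 0 t))) := by
    -- Integrating the two kernels in τ first gives exactly the kernel of order a + b, by the Beta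
    -- integral; against the bounded f this is integrable in σ.
    rw [integrable_prod_iff']
    · constructor
      · filter_upwards [hlt] with σ hσ
        have := (integrableOn_rlKernel_mul_rlKernel ha hb hσ.1.le hσ.2).1.ofReal (𝕜 := ℂ)
        refine (this.mul_const (g σ)).congr (Eventually.of_forall fun τ => ?_)
        simp [Function.uncurry, mul_assoc]
      · have hb1 : IntegrableOn (fun σ => rlKernel (a + b) (t - σ) * K) (Ioc 0 t) := by
          have h1 := intervalIntegrable_rlKernel (add_pos ha hb) t
          rw [intervalIntegrable_iff_integrableOn_Ioo_of_le ht] at h1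
          rw [integrableOn_Ioc_iff_integrableOn_Ioo]
          refine IntegrableOn.congr_fun (h1.mul_const K) (fun x hx => ?_) measurableSet_Ioo
          rw [rlKernel, if_pos (sub_pos.2 hx.2)]
        refine Integrable.mono' hb1 ?_ ?_
        · refine AEStronglyMeasurable.congr (f := fun σ => rlKernel (a + b) (t - σ) * ‖g σ‖) ?_ ?_
          · exact ((measurable_rlKernel _).comp
              (measurable_const.sub measurable_id)).aestronglyMeasurable.mul hgm.norm
          · filter_upwards [hlt] with σ hσ
            simp only [Function.uncurry, hnorm]
            rw [integral_mul_const, (integrableOn_rlKernel_mul_rlKernel ha hb hσ.1.le hσ.2).2]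
        · filter_upwards [hlt] with σ hσ
          simp only [Function.uncurry, hnorm]
          rw [integral_mul_const, (integrableOn_rlKernel_mul_rlKernel ha hb hσ.1.le hσ.2).2,
            Real.norm_of_nonneg (mul_nonneg (rlKernel_nonneg (add_pos ha hb) _) (norm_nonneg _)),
            hfg σ ⟨hσ.1, hσ.2.le⟩]
          exact mul_le_mul_of_nonneg_left (hK σ ⟨hσ.1.le, hσ.2.le⟩)
            (rlKernel_nonneg (add_pos ha hb) _)
    · refine AEStronglyMeasurable.mul ?_ (AEStronglyMeasurable.mul ?_ ?_)
      · exact (Complex.measurable_ofReal.comp ((measurable_rlKernel a).comp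
          (measurable_const.sub measurable_fst))).aestronglyMeasurable
      · exact (Complex.measurable_ofReal.comp ((measurable_rlKernel b).comp
          (measurable_fst.sub measurable_snd))).aestronglyMeasurable
      · exact hgm.comp_snd
  rw [e1, integral_integral_swap hint, ← setIntegral_rlKernel ht le_rfl]
  refine integral_congr_ae ?_
  filter_upwards [hlt] with σ hσ
  have h2 := (integrableOn_rlKernel_mul_rlKernel ha hb hσ.1.le hσ.2).2
  have h3 : ∀ τ, (rlKernel a (t - τ) : ℂ) * ((rlKernel b (τ - σ) : ℂ) * g σ) =
      ((rlKernel a (t - τ) * rlKernel b (τ - σ) : ℝ) : ℂ) * g σ := by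
    intro τ; push_cast; ring
  simp_rw [h3]
  rw [integral_mul_const, integral_complex_ofReal, h2, hfg σ ⟨hσ.1, hσ.2.le⟩]

theorem continuousOn_rpow_div {β c : ℝ} (hβ : 0 ≤ β) (S : Set ℝ) :
    ContinuousOn (fun τ : ℝ => ((τ ^ β / c : ℝ) : ℂ)) S :=
  (Complex.continuous_ofReal.comp
    ((Real.continuous_rpow_const hβ).div_const c)).continuousOn

theorem hasSum_mlOscillation {α ω t : ℝ} (hα : 1 < α) (ht : 0 ≤ t) :
    HasSum (fun k : ℕ => iomegaPow α ω ^ k * ((t ^ (α * k) / Real.Gamma (α * k + 1) : ℝ) : ℂ))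
      (mlOscillation α ω t) := by
  have := hasSum_mittagLeffler₂ hα le_rfl (iomegaPow α ω * ((t ^ α : ℝ) : ℂ))
  rw [mittagLeffler₂_one] at this
  convert! this using 2 with k
  rw [mul_pow, Real.rpow_mul ht, Real.rpow_natCast]
  push_cast
  ring

theorem continuousOn_mlOscillation {α ω : ℝ} (hα : 1 < α) (S : Set ℝ) :
    ContinuousOn (mlOscillation α ω) S := by
  have h := continuous_mittagLeffler₂ hα (le_refl (1 : ℝ))
  have h2 : Continuous fun t : ℝ => t ^ α := Real.continuous_rpow_const (by linarith)
  exact (h.comp (by fun_prop : Continuous fun t : ℝ =>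
    iomegaPow α ω * ((t ^ α : ℝ) : ℂ))).continuousOn

/-- I^α sends τ^{αk}/Γ(αk+1) to t^{α(k+1)}/Γ(α(k+1)+1), that is, it shifts the Mittag-Leffler series
by one place. -/
theorem mlOscillation_volterra {α ω t : ℝ} (hα : 1 < α) (ht : 0 ≤ t) :
    mlOscillation α ω t = 1 + iomegaPow α ω * rlIntegral α (mlOscillation α ω) t := by
  have hα0 : 0 < α := by linarith
  set z := iomegaPow α ω with hz
  have hk : HasSum (fun k : ℕ => z ^ k *
      ((t ^ (α * (k + 1)) / Real.Gamma (α * (k + 1) + 1) : ℝ) : ℂ))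
      (rlIntegral α (mlOscillation α ω) t) := by
    have e : ∀ k : ℕ, z ^ k * ((t ^ (α * (k + 1)) / Real.Gamma (α * (k + 1) + 1) : ℝ) : ℂ) =
        ∫ τ in (0 : ℝ)..t, (((t - τ) ^ (α - 1) / Real.Gamma α : ℝ) : ℂ) *
          (z ^ k * ((τ ^ (α * k) / Real.Gamma (α * k + 1) : ℝ) : ℂ)) := by
      intro k
      have h1 := rlIntegral_const_mul α t (z ^ k)
        (fun τ => ((τ ^ (α * k) / Real.Gamma (α * k + 1) : ℝ) : ℂ))
      rw [rlIntegral_rpow hα0 (by positivity) ht] at h1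
      rw [show α * ((k : ℝ) + 1) = α + α * k by ring, ← h1, rlIntegral]
    simp_rw [e]
    have hs := summable_pow_div_Gamma (x := ‖z‖ * t ^ α) hα le_rfl (by positivity)
    refine intervalIntegral.hasSum_integral_of_dominated_convergence
      (fun k τ => ((t - τ) ^ (α - 1) / Real.Gamma α) *
        ((‖z‖ * t ^ α) ^ k / Real.Gamma (α * k + 1))) (fun k => ?_) (fun k => ?_) ?_ ?_ ?_
    · rw [uIoc_of_le ht]
      exact (intervalIntegrable_rlIntegrand hα0 ht (f := fun τ => z ^ k *
        ((τ ^ (α * k) / Real.Gamma (α * k + 1) : ℝ) : ℂ))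
        (continuousOn_const.mul (continuousOn_rpow_div (by positivity) _))).1.aestronglyMeasurable
    · refine Eventually.of_forall fun τ hτ => ?_
      rw [uIoc_of_le ht] at hτ
      have h0 : 0 ≤ t - τ := sub_nonneg.2 hτ.2
      have hG := Real.Gamma_pos_of_pos hα0
      have hG' := Real.Gamma_pos_of_pos (by positivity : 0 < α * k + 1)
      have hτ0 := hτ.1.le
      rw [norm_mul, norm_mul, Complex.norm_real, Complex.norm_real,
        Real.norm_of_nonneg (by positivity), Real.norm_of_nonneg (by positivity), norm_pow,
        mul_pow, Real.rpow_mul hτ0, Real.rpow_natCast, mul_div_assoc]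
      have := hτ.2
      gcongr
    · exact Eventually.of_forall fun τ _ => hs.mul_left _
    · simp_rw [tsum_mul_left]
      exact (intervalIntegrable_rlKernel hα0 t).mul_const _
    · refine Eventually.of_forall fun τ hτ => ?_
      rw [uIoc_of_le ht] at hτ
      exact (hasSum_mlOscillation hα hτ.1.le).mul_left _
  have h2 := (hasSum_nat_add_iff' 1).2 (hasSum_mlOscillation (ω := ω) hα ht)
  have h3 := (hk.mul_left z).unique (by
    convert! h2 using 2 with k
    rw [pow_succ]
    push_cast
    ring)
  rw [h3]
  simp

/-! ### Series solution of a Volterra equation for holomorphic functions -/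

theorem deriv_iterate_differentiableOn {A : ℂ → ℂ} {S : Set ℂ} (hS : IsOpen S)
    (hA : DifferentiableOn ℂ A S) (k : ℕ) : DifferentiableOn ℂ (deriv^[k] A) S := by
  induction k with
  | zero => exact hA
  | succ k ih =>
    rw [Function.iterate_succ_apply']
    exact ih.deriv hS

/-- Iterating `w = A + t b + I^α ∂ₛ w` for bounded holomorphic `w`. -/
theorem tendsto_sum_of_volterra {α T ρ M : ℝ} (hα : 1 < α) (hρ : 0 < ρ) (hT : 0 ≤ T)
    {w : ℝ → ℂ → ℂ} {A b : ℂ → ℂ} {s₀ : ℂ}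
    (hw : ∀ τ ∈ Icc 0 T, DifferentiableOn ℂ (w τ) (Metric.ball s₀ ρ))
    (hwc : ∀ s ∈ Metric.ball s₀ ρ, ContinuousOn (fun τ => deriv (w τ) s) (Icc 0 T))
    (hA : DifferentiableOn ℂ A (Metric.ball s₀ ρ)) (hb : DifferentiableOn ℂ b (Metric.ball s₀ ρ))
    (hM : ∀ τ ∈ Icc 0 T, ∀ s ∈ Metric.ball s₀ ρ, ‖w τ s‖ ≤ M)
    (heq : ∀ τ ∈ Icc 0 T, ∀ s ∈ Metric.ball s₀ ρ,
      w τ s = A s + τ * b s + rlIntegral α (fun τ' => deriv (w τ') s) τ) :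
    Tendsto (fun N : ℕ => ∑ k ∈ Finset.range N,
      (((T ^ (α * k + 1 - 1) / Real.Gamma (α * k + 1) : ℝ) : ℂ) * deriv^[k] A s₀ +
        ((T ^ (α * k + 2 - 1) / Real.Gamma (α * k + 2) : ℝ) : ℂ) * deriv^[k] b s₀))
      atTop (𝓝 (w T s₀)) := by
  have hα0 : 0 < α := by linarith
  set B : Set ℂ := Metric.ball s₀ ρ with hB
  have hBo : IsOpen B := Metric.isOpen_ball
  have hAk := deriv_iterate_differentiableOn hBo hA
  have hbk := deriv_iterate_differentiableOn hBo hb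
  set P : ℕ → ℝ → ℂ → ℂ := fun k τ s =>
    ((τ ^ (α * k + 1 - 1) / Real.Gamma (α * k + 1) : ℝ) : ℂ) * deriv^[k] A s +
      ((τ ^ (α * k + 2 - 1) / Real.Gamma (α * k + 2) : ℝ) : ℂ) * deriv^[k] b s with hP
  set P' : ℕ → ℝ → ℂ → ℂ := fun k τ s =>
    ((τ ^ (α * k + 1 - 1) / Real.Gamma (α * k + 1) : ℝ) : ℂ) * deriv^[k + 1] A s +
      ((τ ^ (α * k + 2 - 1) / Real.Gamma (α * k + 2) : ℝ) : ℂ) * deriv^[k + 1] b s with hP'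
  have hPd : ∀ k τ, ∀ s ∈ B, HasDerivAt (P k τ) (P' k τ s) s := by
    intro k τ s hs
    have h1 := ((hAk k).differentiableAt (hBo.mem_nhds hs)).hasDerivAt
    have h2 := ((hbk k).differentiableAt (hBo.mem_nhds hs)).hasDerivAt
    rw [← Function.iterate_succ_apply' deriv] at h1 h2
    exact (h1.const_mul _).add (h2.const_mul _)
  have hnn1 : ∀ k : ℕ, 0 ≤ α * k + 1 - 1 := fun k => by
    have : 0 ≤ α * k := by positivity
    linarith
  have hnn2 : ∀ k : ℕ, 0 ≤ α * k + 2 - 1 := fun k => by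
    have : 0 ≤ α * k := by positivity
    linarith
  have hP'c : ∀ k s, ∀ S : Set ℝ, ContinuousOn (fun τ => P' k τ s) S := fun k s S =>
    ((continuousOn_rpow_div (hnn1 k) S).mul continuousOn_const).add
      ((continuousOn_rpow_div (hnn2 k) S).mul continuousOn_const)
  -- The terms of the expected series satisfy I^α ∂ₛP_k = P_{k+1}.
  have hPI : ∀ k, ∀ τ ∈ Icc 0 T, ∀ s, rlIntegral α (fun τ' => P' k τ' s) τ = P (k + 1) τ s := by
    intro k τ hτ s
    simp only [hP']
    rw [rlIntegral_add hα0 hτ.1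
      (f := fun τ' => ((τ' ^ (α * k + 1 - 1) / Real.Gamma (α * k + 1) : ℝ) : ℂ) *
        deriv^[k + 1] A s)
      (g := fun τ' => ((τ' ^ (α * k + 2 - 1) / Real.Gamma (α * k + 2) : ℝ) : ℂ) *
        deriv^[k + 1] b s)
      ((continuousOn_rpow_div (hnn1 k) _).mul continuousOn_const)
      ((continuousOn_rpow_div (hnn2 k) _).mul continuousOn_const)]
    simp_rw [mul_comm _ (deriv^[k + 1] _ s)]
    rw [rlIntegral_const_mul, rlIntegral_const_mul]
    have e1 := rlIntegral_rpow hα0 (hnn1 k) hτ.1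
    have e2 := rlIntegral_rpow hα0 (hnn2 k) hτ.1
    rw [sub_add_cancel] at e1 e2
    rw [e1, e2]
    simp only [hP]
    push_cast
    ring_nf
  -- The remainders R_N after N terms obey R_{N+1} = I^α ∂ₛR_N, with R_0 = w bounded.
  have hw1 : ∀ N : ℕ, ∀ τ ∈ Icc 0 T, ∀ s ∈ B, w τ s - ∑ k ∈ Finset.range (N + 1), P k τ s =
      rlIntegral α (fun τ' => deriv (w τ') s - ∑ k ∈ Finset.range N, P' k τ' s) τ := by
    intro N τ hτ s hs
    induction N with
    | zero =>
      simp only [zero_add, Finset.range_one, Finset.sum_singleton, Finset.range_zero,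
        Finset.sum_empty, sub_zero]
      rw [heq τ hτ s hs]
      simp only [hP]
      norm_num [Real.Gamma_two]
    | succ N ih =>
      have hsub : Icc 0 τ ⊆ Icc 0 T := Icc_subset_Icc_right hτ.2
      have e : (fun τ' => deriv (w τ') s - ∑ k ∈ Finset.range (N + 1), P' k τ' s) =
          fun τ' => (deriv (w τ') s - ∑ k ∈ Finset.range N, P' k τ' s) - P' N τ' s := by
        funext τ'
        rw [Finset.sum_range_succ]
        ring
      rw [e, rlIntegral_sub hα0 hτ.1
        (f := fun τ' => deriv (w τ') s - ∑ k ∈ Finset.range N, P' k τ' s) (((hwc s hs).mono hsub).sub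
        (continuousOn_finsetSum _ fun k _ => hP'c k s _)) (hP'c N s _), ← ih, hPI N τ hτ,
        Finset.sum_range_succ _ (N + 1)]
      ring
  set R : ℕ → ℝ → ℂ → ℂ := fun N τ s => w τ s - ∑ k ∈ Finset.range N, P k τ s with hR
  have hRd : ∀ N : ℕ, ∀ τ ∈ Icc 0 T, ∀ s ∈ B,
      HasDerivAt (R N τ) (deriv (w τ) s - ∑ k ∈ Finset.range N, P' k τ s) s := by
    intro N τ hτ s hs
    refine (((hw τ hτ).differentiableAt (hBo.mem_nhds hs)).hasDerivAt).sub ?_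
    exact HasDerivAt.fun_sum fun k _ => hPd k τ s hs
  have hM0 : 0 ≤ M :=
    (norm_nonneg _).trans (hM 0 ⟨le_rfl, hT⟩ s₀ (Metric.mem_ball_self hρ))
  -- The number N of steps is fixed in advance, and each Cauchy estimate for ∂ₛ spends ρ/(N+1) of
  -- the radius. After N steps a disc of radius ρ/(N+1) about s₀ is still left.
  have hbound : ∀ N j : ℕ, j ≤ N → ∀ τ ∈ Icc 0 T,
      ∀ s ∈ Metric.ball s₀ (ρ - j * (ρ / (N + 1))),
      ‖R j τ s‖ ≤ M * ((N + 1) / ρ) ^ j * (τ ^ (α * j) / Real.Gamma (α * j + 1)) := by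
    intro N j
    induction j with
    | zero =>
      intro _ τ hτ s hs
      simp only [Nat.cast_zero, zero_mul, sub_zero] at hs
      simpa [hR] using hM τ hτ s hs
    | succ j ih =>
      intro hj τ hτ s hs
      have hd : 0 < ρ / (N + 1) := by positivity
      have hj0 : (0 : ℝ) ≤ j * (ρ / (N + 1)) := by positivity
      push_cast at hs
      have hs' : dist s s₀ < ρ - (j + 1) * (ρ / (N + 1)) := hs
      have hsB : s ∈ B := by
        rw [hB, Metric.mem_ball]; nlinarith
      have h1 : R (j + 1) τ s = rlIntegral α (fun τ' => deriv (R j τ') s) τ := by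
        rw [hR]
        simp only
        rw [hw1 j τ hτ s hsB]
        refine rlIntegral_congr hτ.1 fun τ' hτ' => ?_
        exact (hRd j τ' ⟨hτ'.1, hτ'.2.trans hτ.2⟩ s hsB).deriv.symm
      rw [h1, show α * ((j + 1 : ℕ) : ℝ) = α + α * j by push_cast; ring]
      refine norm_rlIntegral_le hα0 (by positivity) hτ.1 fun τ' hτ' => ?_
      have hτ'T : τ' ∈ Icc 0 T := ⟨hτ'.1, hτ'.2.trans hτ.2⟩
      have hcl : Metric.closedBall s (ρ / (N + 1)) ⊆ Metric.ball s₀ (ρ - j * (ρ / (N + 1))) := by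
        refine Metric.closedBall_subset_ball' ?_
        linarith
      have hclB : Metric.closedBall s (ρ / (N + 1)) ⊆ B :=
        hcl.trans (Metric.ball_subset_ball (by linarith))
      have h2 := Complex.norm_deriv_le_of_forall_mem_sphere_norm_le (f := R j τ') hd
        (C := M * ((N + 1) / ρ) ^ j * (τ' ^ (α * j) / Real.Gamma (α * j + 1)))
        ⟨fun z hz => (hRd j τ' hτ'T z
          (hclB (Metric.ball_subset_closedBall hz))).differentiableAt.differentiableWithinAt,
        fun z hz => (hRd j τ' hτ'T z (hclB (by
          rwa [closure_ball _ hd.ne'] at hz))).continuousAt.continuousWithinAt⟩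
        fun z hz => ih (by omega) τ' hτ'T z (hcl (Metric.sphere_subset_closedBall hz))
      refine h2.trans_eq ?_
      rw [pow_succ]
      field_simp
  have hlim : Tendsto (fun N : ℕ => M * Real.exp 1 *
      (N.factorial * (Real.exp 1 * (T ^ α / ρ)) ^ N / Real.Gamma (α * N + 1))) atTop (𝓝 0) := by
    have := (summable_factorial_mul_pow_div_Gamma hα (le_refl (1 : ℝ))
      (x := Real.exp 1 * (T ^ α / ρ)) (by positivity)).tendsto_atTop_zero
    simpa using this.const_mul (M * Real.exp 1)
  have hR0 : Tendsto (fun N => R N T s₀) atTop (𝓝 0) := by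
    refine squeeze_zero_norm (fun N => ?_) hlim
    have hs₀ : s₀ ∈ Metric.ball s₀ (ρ - N * (ρ / (N + 1))) := by
      refine Metric.mem_ball_self ?_
      have : ρ - N * (ρ / (N + 1)) = ρ / (N + 1) := by field_simp; ring
      rw [this]; positivity
    refine (hbound N N le_rfl T ⟨hT, le_rfl⟩ s₀ hs₀).trans ?_
    have hG := Real.Gamma_pos_of_pos (by positivity : 0 < α * N + 1)
    -- From (N+1)^N ≤ e^{N+1} N! the loss over all N steps is only factorial times geometric.
    have h1 := Real.pow_div_factorial_le_exp (x := (N + 1 : ℝ)) (by positivity) N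
    rw [div_le_iff₀ (by positivity)] at h1
    have h2 : Real.exp (N + 1) = Real.exp 1 * Real.exp 1 ^ N := by
      rw [Real.exp_add, mul_comm, ← Real.exp_nat_mul, mul_one]
    rw [h2] at h1
    have h3 : T ^ (α * N) = (T ^ α) ^ N := by rw [Real.rpow_mul hT, Real.rpow_natCast]
    rw [h3, div_pow, mul_pow, div_pow]
    calc M * (((N : ℝ) + 1) ^ N / ρ ^ N) * ((T ^ α) ^ N / Real.Gamma (α * N + 1))
        = ((N : ℝ) + 1) ^ N * (M * ((T ^ α) ^ N / ρ ^ N / Real.Gamma (α * N + 1))) := by ring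
      _ ≤ Real.exp 1 * Real.exp 1 ^ N * N.factorial *
          (M * ((T ^ α) ^ N / ρ ^ N / Real.Gamma (α * N + 1))) := by gcongr
      _ = _ := by ring
  have := hR0.const_sub (w T s₀)
  simp only [hR, sub_zero, sub_sub_cancel] at this
  exact this

/-! ### The heat kernel with complex time -/

/-- The heat kernel at the complex time `ζ`, as a function of the squared distance. -/
noncomputable def gaussProfile (n : ℕ) (ζ : ℂ) (q : ℝ) : ℂ :=
  (4 * Real.pi * ζ) ^ ((-(n / 2 : ℝ) : ℝ) : ℂ) * Complex.exp (-(q : ℂ) / (4 * ζ))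

/-- The derivative of the heat kernel with respect to time. -/
noncomputable def gaussProfileDeriv (n : ℕ) (ζ : ℂ) (q : ℝ) : ℂ :=
  ((q : ℂ) / (4 * ζ ^ 2) - n / (2 * ζ)) * gaussProfile n ζ q

theorem ne_zero_of_re_pos {ζ : ℂ} (h : 0 < ζ.re) : ζ ≠ 0 := fun h0 => by simp [h0] at h

theorem norm_gaussProfile {n : ℕ} {ζ : ℂ} (hζ : 0 < ζ.re) (q : ℝ) :
    ‖gaussProfile n ζ q‖ =
      (4 * Real.pi * ‖ζ‖) ^ (-(n / 2 : ℝ)) * Real.exp (-(ζ.re / (4 * ‖ζ‖ ^ 2)) * q) := by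
  have h0 := ne_zero_of_re_pos hζ
  have hp : (4 * Real.pi * ζ : ℂ) ≠ 0 := by
    simp [h0, Real.pi_ne_zero]
  rw [gaussProfile, norm_mul, norm_cpow_real hp, Complex.norm_exp]
  congr 2
  · simp [abs_of_pos Real.pi_pos]
  · have h1 : (ζ⁻¹).re = ζ.re / ‖ζ‖ ^ 2 := by
      rw [Complex.inv_re, Complex.normSq_eq_norm_sq]
    have h2 : -(q : ℂ) / (4 * ζ) = ((-q / 4 : ℝ) : ℂ) * ζ⁻¹ := by
      push_cast
      field_simp
    rw [h2, Complex.re_ofReal_mul, h1]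
    ring

theorem hasDerivAt_gaussProfile {n : ℕ} {ζ : ℂ} (hζ : 0 < ζ.re) (q : ℝ) :
    HasDerivAt (fun ζ => gaussProfile n ζ q) (gaussProfileDeriv n ζ q) ζ := by
  have h0 := ne_zero_of_re_pos hζ
  have hp : (4 * Real.pi * ζ : ℂ) ∈ Complex.slitPlane := by
    refine Or.inl ?_
    have : (4 * Real.pi * ζ : ℂ) = ((4 * Real.pi : ℝ) : ℂ) * ζ := by push_cast; ring
    rw [this, Complex.re_ofReal_mul]
    have := Real.pi_pos
    positivity
  have hp0 := Complex.slitPlane_ne_zero hp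
  have hpi : (Real.pi : ℂ) ≠ 0 := by exact_mod_cast Real.pi_ne_zero
  have h1 : HasDerivAt (fun ζ : ℂ => (4 * Real.pi * ζ : ℂ)) (4 * Real.pi) ζ := by
    simpa using (hasDerivAt_id ζ).const_mul (4 * Real.pi : ℂ)
  have h2 := h1.cpow_const (c := ((-(n / 2 : ℝ) : ℝ) : ℂ)) hp
  have h3 : HasDerivAt (fun ζ : ℂ => -(q : ℂ) / (4 * ζ)) ((q : ℂ) / (4 * ζ ^ 2)) ζ := by
    convert! (hasDerivAt_const ζ (-(q : ℂ))).div ((hasDerivAt_id ζ).const_mul (4 : ℂ))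
      (mul_ne_zero (by norm_num : (4 : ℂ) ≠ 0) h0) using 1
    simp only [id]
    field_simp
    ring
  convert! h2.mul h3.cexp using 1
  rw [gaussProfileDeriv, gaussProfile, Complex.cpow_sub _ _ hp0, Complex.cpow_one]
  push_cast
  field_simp
  ring

theorem continuous_gaussProfile (n : ℕ) (ζ : ℂ) : Continuous (gaussProfile n ζ) := by
  unfold gaussProfile
  fun_prop

theorem continuous_gaussProfileDeriv (n : ℕ) (ζ : ℂ) : Continuous (gaussProfileDeriv n ζ) := by
  have := continuous_gaussProfile n ζ
  unfold gaussProfileDeriv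
  fun_prop

/-- A Gaussian bound uniform in a complex disc of times, as needed for differentiating under the
integral; the factor 1 + q absorbs the polynomial produced by the time derivative. -/
theorem exists_gaussProfile_bound (n : ℕ) {ζ₀ : ℂ} (hζ₀ : 0 < ζ₀.re) :
    ∃ K κ : ℝ, 0 ≤ K ∧ 0 < κ ∧ ∀ ζ ∈ Metric.ball ζ₀ (ζ₀.re / 2), 0 < ζ.re ∧ ∀ q : ℝ, 0 ≤ q →
      ‖gaussProfile n ζ q‖ ≤ K * ((1 + q) * Real.exp (-κ * q)) ∧
      ‖gaussProfileDeriv n ζ q‖ ≤ K * ((1 + q) * Real.exp (-κ * q)) := by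
  set d := ζ₀.re with hd
  have hd0 : 0 < ‖ζ₀‖ := norm_pos_iff.2 (ne_zero_of_re_pos hζ₀)
  have hdn : d ≤ ‖ζ₀‖ := Complex.re_le_norm _
  have hpi := Real.pi_pos
  set B : ℝ := (2 * Real.pi * d) ^ (-(n / 2 : ℝ)) with hB
  have hB0 : 0 ≤ B := by positivity
  refine ⟨B + (1 / d ^ 2 + n / d) * B, d / 2 / (4 * (2 * ‖ζ₀‖) ^ 2), by positivity, by positivity,
    fun ζ hζ => ?_⟩
  rw [Metric.mem_ball, dist_eq_norm] at hζ
  have hre : d / 2 ≤ ζ.re := by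
    have := (Complex.abs_re_le_norm (ζ - ζ₀)).trans hζ.le
    rw [Complex.sub_re] at this
    have := (abs_le.1 this).1
    linarith
  have hnorm : d / 2 ≤ ‖ζ‖ := hre.trans (Complex.re_le_norm _)
  have hnorm' : ‖ζ‖ ≤ 2 * ‖ζ₀‖ := by
    have := norm_sub_norm_le ζ ζ₀
    linarith
  have hpos : 0 < ζ.re := by linarith
  have hzp : 0 < ‖ζ‖ := by linarith
  refine ⟨hpos, fun q hq => ?_⟩
  have h1 : ‖gaussProfile n ζ q‖ ≤ B * Real.exp (-(d / 2 / (4 * (2 * ‖ζ₀‖) ^ 2)) * q) := by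
    rw [norm_gaussProfile hpos]
    have e1 : (4 * Real.pi * ‖ζ‖) ^ (-(n / 2 : ℝ)) ≤ B := by
      refine Real.rpow_le_rpow_of_nonpos (by positivity) ?_ (by
        have : (0 : ℝ) ≤ n := Nat.cast_nonneg n
        linarith)
      nlinarith
    have e2 : d / 2 / (4 * (2 * ‖ζ₀‖) ^ 2) ≤ ζ.re / (4 * ‖ζ‖ ^ 2) := by gcongr
    refine mul_le_mul e1 (Real.exp_le_exp.2 ?_) (Real.exp_pos _).le hB0
    nlinarith
  set X := Real.exp (-(d / 2 / (4 * (2 * ‖ζ₀‖) ^ 2)) * q)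
  have hX : 0 ≤ X := (Real.exp_pos _).le
  have hBX : 0 ≤ B * X := mul_nonneg hB0 hX
  have hc : 0 ≤ 1 / d ^ 2 + n / d := by positivity
  constructor
  · refine h1.trans ?_
    have : 0 ≤ (1 / d ^ 2 + n / d) * (B * X) * (1 + q) := by positivity
    nlinarith
  · rw [gaussProfileDeriv, norm_mul]
    have h2 : ‖(q : ℂ) / (4 * ζ ^ 2) - n / (2 * ζ)‖ ≤ (1 / d ^ 2 + n / d) * (1 + q) := by
      refine (norm_sub_le _ _).trans ?_
      have e1 : ‖(q : ℂ) / (4 * ζ ^ 2)‖ ≤ 1 / d ^ 2 * q := by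
        rw [norm_div, Complex.norm_real, Real.norm_of_nonneg hq, norm_mul, norm_pow, div_eq_mul_inv,
          one_div, mul_comm]
        have : d ^ 2 ≤ ‖(4 : ℂ)‖ * ‖ζ‖ ^ 2 := by
          rw [show ‖(4 : ℂ)‖ = 4 by simp]
          nlinarith
        gcongr
      have e2 : ‖(n : ℂ) / (2 * ζ)‖ ≤ n / d := by
        rw [norm_div, Complex.norm_natCast, norm_mul]
        have : d ≤ ‖(2 : ℂ)‖ * ‖ζ‖ := by
          rw [show ‖(2 : ℂ)‖ = 2 by simp]
          linarith
        gcongr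
      have e3 : (0 : ℝ) ≤ n / d * q := by positivity
      have e4 : (0 : ℝ) ≤ 1 / d ^ 2 := by positivity
      linarith
    calc _ ≤ (1 / d ^ 2 + n / d) * (1 + q) * (B * X) := by gcongr
      _ ≤ _ := by nlinarith [mul_nonneg hBX hq]

section Heat

variable {n : ℕ}

theorem integrable_exp_neg_mul_sq_norm {κ : ℝ} (hκ : 0 < κ) :
    Integrable fun x : EuclideanSpace ℝ (Fin n) => Real.exp (-κ * ‖x‖ ^ 2) := by
  have h := GaussianFourier.integrable_cexp_neg_mul_sq_norm_add (V := EuclideanSpace ℝ (Fin n))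
    (b := κ) (by simpa) 0 0
  refine h.norm.congr (Eventually.of_forall fun x => ?_)
  simp only [zero_mul, add_zero]
  rw [Complex.norm_exp]
  congr 1
  rw [← Complex.ofReal_pow, ← Complex.ofReal_neg, ← Complex.ofReal_mul, Complex.ofReal_re]

theorem integrable_one_add_mul_exp_neg {κ : ℝ} (hκ : 0 < κ) (y : EuclideanSpace ℝ (Fin n)) :
    Integrable fun x : EuclideanSpace ℝ (Fin n) =>
      (1 + ‖x - y‖ ^ 2) * Real.exp (-κ * ‖x - y‖ ^ 2) := by
  have h : Integrable fun x : EuclideanSpace ℝ (Fin n) =>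
      (1 + ‖x‖ ^ 2) * Real.exp (-κ * ‖x‖ ^ 2) := by
    refine ((integrable_exp_neg_mul_sq_norm (half_pos hκ)).const_mul (1 + 2 / κ)).mono'
      (by fun_prop) (Eventually.of_forall fun x => ?_)
    rw [Real.norm_of_nonneg (by positivity)]
    have e : Real.exp (-κ * ‖x‖ ^ 2) =
        Real.exp (-(κ / 2) * ‖x‖ ^ 2) * Real.exp (-(κ / 2) * ‖x‖ ^ 2) := by
      rw [← Real.exp_add]; ring_nf
    have h1 : (1 + ‖x‖ ^ 2) * Real.exp (-(κ / 2) * ‖x‖ ^ 2) ≤ 1 + 2 / κ := by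
      have h2 := Real.add_one_le_exp (κ / 2 * ‖x‖ ^ 2)
      rw [neg_mul, Real.exp_neg, ← div_eq_mul_inv, div_le_iff₀ (Real.exp_pos _)]
      calc 1 + ‖x‖ ^ 2 ≤ (1 + 2 / κ) * (κ / 2 * ‖x‖ ^ 2 + 1) := by
            have : 2 / κ * (κ / 2 * ‖x‖ ^ 2) = ‖x‖ ^ 2 := by field_simp
            have h3 : 0 ≤ 2 / κ := by positivity
            have h4 : 0 ≤ κ / 2 * ‖x‖ ^ 2 := by positivity
            nlinarith
        _ ≤ _ := by gcongr
    rw [e, ← mul_assoc]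
    gcongr
  exact h.comp_sub_right y

theorem integrable_gaussProfile {ζ : ℂ} (hζ : 0 < ζ.re) (y : EuclideanSpace ℝ (Fin n)) :
    Integrable (fun x : EuclideanSpace ℝ (Fin n) => gaussProfile n ζ (‖x - y‖ ^ 2)) ∧
    Integrable (fun x : EuclideanSpace ℝ (Fin n) => gaussProfileDeriv n ζ (‖x - y‖ ^ 2)) := by
  obtain ⟨K, κ, _, hκ, hb⟩ := exists_gaussProfile_bound n hζ
  have hb := (hb ζ (Metric.mem_ball_self (half_pos hζ))).2
  have hi := (integrable_one_add_mul_exp_neg hκ y).const_mul K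
  have c1 := continuous_gaussProfile n ζ
  have c2 := continuous_gaussProfileDeriv n ζ
  exact ⟨hi.mono' (by fun_prop) (Eventually.of_forall fun x => (hb _ (by positivity)).1),
    hi.mono' (by fun_prop) (Eventually.of_forall fun x => (hb _ (by positivity)).2)⟩

theorem integral_gaussProfile {ζ : ℂ} (hζ : 0 < ζ.re) (y : EuclideanSpace ℝ (Fin n)) :
    ∫ x : EuclideanSpace ℝ (Fin n), gaussProfile n ζ (‖x - y‖ ^ 2) = 1 := by
  rw [integral_sub_right_eq_self (fun x : EuclideanSpace ℝ (Fin n) =>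
    gaussProfile n ζ (‖x‖ ^ 2)) y]
  have h0 := ne_zero_of_re_pos hζ
  have hb : 0 < ((4 * ζ)⁻¹).re := by
    rw [Complex.inv_re]
    refine div_pos (by simpa using hζ) (Complex.normSq_pos.2 (mul_ne_zero (by norm_num : (4 : ℂ) ≠ 0) h0))
  have h := GaussianFourier.integral_cexp_neg_mul_sq_norm (V := EuclideanSpace ℝ (Fin n)) hb
  have e : ∀ x : EuclideanSpace ℝ (Fin n), gaussProfile n ζ (‖x‖ ^ 2) =
      (4 * Real.pi * ζ) ^ ((-(n / 2 : ℝ) : ℝ) : ℂ) * Complex.exp (-(4 * ζ)⁻¹ * ‖x‖ ^ 2) := by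
    intro x
    rw [gaussProfile]
    push_cast
    congr 2
    field_simp
  simp_rw [e]
  rw [integral_const_mul, h, finrank_euclideanSpace_fin]
  have hp : (4 * Real.pi * ζ : ℂ) ≠ 0 := by simp [h0, Real.pi_ne_zero]
  have e2 : (Real.pi : ℂ) / (4 * ζ)⁻¹ = 4 * Real.pi * ζ := by
    field_simp
  rw [e2, ← Complex.cpow_add _ _ hp]
  push_cast
  simp

/-- This norm is constant along rays from the origin: it is what makes the heat extension of a
bounded function bounded on every sector of half-angle below π/2. -/
theorem integral_norm_gaussProfile {ζ : ℂ} (hζ : 0 < ζ.re) (y : EuclideanSpace ℝ (Fin n)) :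
    ∫ x : EuclideanSpace ℝ (Fin n), ‖gaussProfile n ζ (‖x - y‖ ^ 2)‖ =
      (‖ζ‖ / ζ.re) ^ (n / 2 : ℝ) := by
  rw [integral_sub_right_eq_self (fun x : EuclideanSpace ℝ (Fin n) =>
    ‖gaussProfile n ζ (‖x‖ ^ 2)‖) y]
  have h0 : 0 < ‖ζ‖ := norm_pos_iff.2 (ne_zero_of_re_pos hζ)
  have hpi := Real.pi_pos
  simp_rw [norm_gaussProfile hζ]
  rw [integral_const_mul, GaussianFourier.integral_rexp_neg_mul_sq_norm (by positivity),
    finrank_euclideanSpace_fin, Real.rpow_neg (by positivity), ← Real.inv_rpow (by positivity),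
    ← Real.mul_rpow (by positivity) (by positivity)]
  congr 1
  field_simp

/-- The heat extension of a bounded function to complex times. -/
noncomputable def heatExt (h : EuclideanSpace ℝ (Fin n) → ℂ) (ζ : ℂ)
    (y : EuclideanSpace ℝ (Fin n)) : ℂ :=
  ∫ x, h x * gaussProfile n ζ (‖x - y‖ ^ 2)

theorem norm_heatExt_le {h : EuclideanSpace ℝ (Fin n) → ℂ} {M : ℝ} (hM : ∀ x, ‖h x‖ ≤ M) {ζ : ℂ}
    (hζ : 0 < ζ.re) (y : EuclideanSpace ℝ (Fin n)) :
    ‖heatExt h ζ y‖ ≤ M * (‖ζ‖ / ζ.re) ^ (n / 2 : ℝ) := by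
  rw [← integral_norm_gaussProfile hζ y, ← integral_const_mul]
  refine norm_integral_le_of_norm_le ((integrable_gaussProfile hζ y).1.norm.const_mul M)
    (Eventually.of_forall fun x => ?_)
  rw [norm_mul]
  exact mul_le_mul_of_nonneg_right (hM x) (norm_nonneg _)

theorem norm_heatExt_le_integral {h : EuclideanSpace ℝ (Fin n) → ℂ} (hi : Integrable h) {ζ : ℂ}
    (hζ : 0 < ζ.re) (y : EuclideanSpace ℝ (Fin n)) :
    ‖heatExt h ζ y‖ ≤ (∫ x, ‖h x‖) * (4 * Real.pi * ‖ζ‖) ^ (-(n / 2 : ℝ)) := by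
  rw [← integral_mul_const]
  refine norm_integral_le_of_norm_le (hi.norm.mul_const _) (Eventually.of_forall fun x => ?_)
  rw [norm_mul, norm_gaussProfile hζ]
  refine mul_le_mul_of_nonneg_left ?_ (norm_nonneg _)
  have h0 : 0 < ‖ζ‖ := norm_pos_iff.2 (ne_zero_of_re_pos hζ)
  have hpi := Real.pi_pos
  refine mul_le_of_le_one_right (by positivity) (Real.exp_le_one_iff.2 ?_)
  have : 0 ≤ ζ.re / (4 * ‖ζ‖ ^ 2) * ‖x - y‖ ^ 2 := by positivity
  linarith

theorem integrable_mul_gaussProfile {h : EuclideanSpace ℝ (Fin n) → ℂ} {M : ℝ}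
    (hm : AEStronglyMeasurable h) (hM : ∀ x, ‖h x‖ ≤ M) {ζ : ℂ} (hζ : 0 < ζ.re)
    (y : EuclideanSpace ℝ (Fin n)) :
    Integrable (fun x => h x * gaussProfile n ζ (‖x - y‖ ^ 2)) ∧
    Integrable (fun x => h x * gaussProfileDeriv n ζ (‖x - y‖ ^ 2)) :=
  ⟨(integrable_gaussProfile hζ y).1.bdd_mul hm (Eventually.of_forall hM),
    (integrable_gaussProfile hζ y).2.bdd_mul hm (Eventually.of_forall hM)⟩

theorem hasDerivAt_heatExt {h : EuclideanSpace ℝ (Fin n) → ℂ} {M : ℝ}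
    (hm : AEStronglyMeasurable h) (hM : ∀ x, ‖h x‖ ≤ M) {ζ : ℂ} (hζ : 0 < ζ.re)
    (y : EuclideanSpace ℝ (Fin n)) :
    HasDerivAt (fun ζ => heatExt h ζ y) (∫ x, h x * gaussProfileDeriv n ζ (‖x - y‖ ^ 2)) ζ := by
  obtain ⟨K, κ, hK, hκ, hb⟩ := exists_gaussProfile_bound n hζ
  have hball := Metric.ball_mem_nhds ζ (half_pos hζ)
  have hM0 : 0 ≤ M := (norm_nonneg _).trans (hM 0)
  refine (hasDerivAt_integral_of_dominated_loc_of_deriv_le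
    (F := fun ζ x => h x * gaussProfile n ζ (‖x - y‖ ^ 2))
    (F' := fun ζ x => h x * gaussProfileDeriv n ζ (‖x - y‖ ^ 2))
    (bound := fun x => M * (K * ((1 + ‖x - y‖ ^ 2) * Real.exp (-κ * ‖x - y‖ ^ 2))))
    hball ?_ (integrable_mul_gaussProfile hm hM hζ y).1
    (integrable_mul_gaussProfile hm hM hζ y).2.1 ?_ ?_ ?_).2
  · filter_upwards [hball] with z hz
    exact (integrable_mul_gaussProfile hm hM (hb z hz).1 y).1.1
  · refine Eventually.of_forall fun x z hz => ?_
    rw [norm_mul]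
    exact mul_le_mul (hM x) ((hb z hz).2 _ (by positivity)).2 (norm_nonneg _) hM0
  · exact ((integrable_one_add_mul_exp_neg hκ y).const_mul K).const_mul M
  · exact Eventually.of_forall fun x z hz =>
      (hasDerivAt_gaussProfile (hb z hz).1 _).const_mul (h x)

/-- For |ζ| ≤ 1 the L¹ norm of the kernel, at most (1/cos η)^{n/2} in the sector, is paired with the
supremum of h. For |ζ| ≥ 1 the supremum of the kernel, at most |ζ|^{-n/2}, is paired with the
integral of |h|; n ≥ 3 turns this into |ζ|^{-3/2}, integrable along the rays at infinity. -/
theorem sectorDecay_heatExt (hn : 3 ≤ n) {h : EuclideanSpace ℝ (Fin n) → ℂ} {M η : ℝ}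
    (hi : Integrable h) (hM : ∀ x, ‖h x‖ ≤ M) (hη : η < Real.pi / 2)
    (y : EuclideanSpace ℝ (Fin n)) :
    ∃ C, SectorDecay (fun ζ => heatExt h ζ y) η C := by
  have hpi := Real.pi_pos
  have hM0 : 0 ≤ M := (norm_nonneg _).trans (hM 0)
  have hI0 : 0 ≤ ∫ x, ‖h x‖ := integral_nonneg fun _ => norm_nonneg _
  refine ⟨M * (1 / Real.cos η) ^ (n / 2 : ℝ) + ∫ x, ‖h x‖, ⟨fun ζ hζ =>
    (hasDerivAt_heatExt hi.1 hM hζ y).differentiableAt.differentiableWithinAt, fun w hw => ?_⟩⟩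
  have hη0 : 0 ≤ η := (abs_nonneg _).trans hw
  have hre := exp_re_pos (hw.trans_lt hη)
  have hcos : 0 < Real.cos η := Real.cos_pos_of_mem_Ioo ⟨by linarith, hη⟩
  have hcw : Real.cos η ≤ Real.cos w.im := by
    rw [← Real.cos_abs w.im]
    exact Real.cos_le_cos_of_nonneg_of_le_pi (abs_nonneg _) (by linarith) hw
  have hMc : 0 ≤ M * (1 / Real.cos η) ^ (n / 2 : ℝ) := by positivity
  rcases le_total w.re 0 with h0 | h0
  · have hs : sectorWeight w.re = 1 := by
      refine min_eq_left (Real.one_le_exp ?_)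
      linarith
    rw [hs, mul_one]
    refine (norm_heatExt_le hM hre y).trans ?_
    have : ‖Complex.exp w‖ / (Complex.exp w).re ≤ 1 / Real.cos η := by
      rw [Complex.norm_exp, Complex.exp_re]
      have := Real.exp_pos w.re
      rw [show Real.exp w.re / (Real.exp w.re * Real.cos w.im) = 1 / Real.cos w.im by
        field_simp]
      gcongr
    have h2 : M * (‖Complex.exp w‖ / (Complex.exp w).re) ^ (n / 2 : ℝ) ≤
        M * (1 / Real.cos η) ^ (n / 2 : ℝ) := by
      gcongr
    linarith
  · have hs : sectorWeight w.re = Real.exp (-(3 / 2 * w.re)) := by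
      refine min_eq_right (Real.exp_le_one_iff.2 ?_)
      linarith
    rw [hs]
    refine (norm_heatExt_le_integral hi hre y).trans ?_
    have h1 : (4 * Real.pi * ‖Complex.exp w‖) ^ (-(n / 2 : ℝ)) ≤ Real.exp (-(3 / 2 * w.re)) := by
      have hn' : (3 : ℝ) ≤ n := by exact_mod_cast hn
      calc (4 * Real.pi * ‖Complex.exp w‖) ^ (-(n / 2 : ℝ))
          ≤ (Real.exp w.re) ^ (-(n / 2 : ℝ)) := by
            refine Real.rpow_le_rpow_of_nonpos (Real.exp_pos _) ?_ (by linarith)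
            rw [Complex.norm_exp]
            have := Real.pi_gt_three
            nlinarith [Real.exp_pos w.re]
        _ = Real.exp (w.re * (-(n / 2 : ℝ))) := (Real.exp_mul _ _).symm
        _ ≤ _ := by
            rw [Real.exp_le_exp]
            nlinarith
    have h2 := Real.exp_pos (-(3 / 2 * w.re))
    calc _ ≤ (∫ x, ‖h x‖) * Real.exp (-(3 / 2 * w.re)) := by gcongr
      _ ≤ _ := by
        gcongr
        linarith

end Heat

/-! ### Green's formula and the heat equation for the complex-time kernel -/

theorem laplacian_eq_sum_fderiv {n : ℕ} {f : EuclideanSpace ℝ (Fin n) → ℂ} (hf : ContDiff ℝ 2 f)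
    (x : EuclideanSpace ℝ (Fin n)) :
    (Δ f) x = ∑ i, fderiv ℝ (fun z => fderiv ℝ f z (EuclideanSpace.basisFun (Fin n) ℝ i)) x
      (EuclideanSpace.basisFun (Fin n) ℝ i) := by
  rw [InnerProductSpace.laplacian_eq_iteratedFDeriv_orthonormalBasis f
    (EuclideanSpace.basisFun (Fin n) ℝ)]
  refine Finset.sum_congr rfl fun i _ => ?_
  rw [iteratedFDeriv_two_apply]
  have h : DifferentiableAt ℝ (fderiv ℝ f) x :=
    ((hf.fderiv_right (m := 1) (by norm_num)).differentiable one_ne_zero) x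
  rw [fderiv_clm_apply h (differentiableAt_const _)]
  simp

theorem contDiff_fderiv_apply {n : ℕ} {f : EuclideanSpace ℝ (Fin n) → ℂ} (hf : ContDiff ℝ 2 f)
    (v : EuclideanSpace ℝ (Fin n)) : ContDiff ℝ 1 (fun z => fderiv ℝ f z v) :=
  (hf.fderiv_right (m := 1) (by norm_num)).clm_apply contDiff_const

theorem continuous_laplacian {n : ℕ} {f : EuclideanSpace ℝ (Fin n) → ℂ} (hf : ContDiff ℝ 2 f) :
    Continuous (Δ f) := by
  have : Δ f = fun x => ∑ i, fderiv ℝ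
      (fun z => fderiv ℝ f z (EuclideanSpace.basisFun (Fin n) ℝ i)) x
      (EuclideanSpace.basisFun (Fin n) ℝ i) := funext (laplacian_eq_sum_fderiv hf)
  rw [this]
  refine continuous_finsetSum _ fun i _ => ?_
  exact ((contDiff_fderiv_apply hf _).continuous_fderiv one_ne_zero).clm_apply continuous_const

theorem hasCompactSupport_laplacian {n : ℕ} {f : EuclideanSpace ℝ (Fin n) → ℂ}
    (hc : HasCompactSupport f) : HasCompactSupport (Δ f) := by
  refine HasCompactSupport.intro hc fun x hx => ?_
  have h0 : f =ᶠ[𝓝 x] fun _ => 0 := by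
    filter_upwards [(isClosed_tsupport f).isOpen_compl.mem_nhds hx] with z hz
    exact image_eq_zero_of_notMem_tsupport hz
  have h1 := InnerProductSpace.laplacian_congr_nhds h0
  rw [h1.eq_of_nhds]
  simp

theorem integral_fderiv_mul_eq_neg {n : ℕ} {f g : EuclideanSpace ℝ (Fin n) → ℂ}
    (hf : ContDiff ℝ 1 f) (hg : ContDiff ℝ 1 g) (hc : HasCompactSupport g)
    (v : EuclideanSpace ℝ (Fin n)) :
    ∫ x, fderiv ℝ f x v * g x = -∫ x, f x * fderiv ℝ g x v := by
  have hf' : Continuous fun x => fderiv ℝ f x v :=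
    (hf.continuous_fderiv one_ne_zero).clm_apply continuous_const
  have hg' : Continuous fun x => fderiv ℝ g x v :=
    (hg.continuous_fderiv one_ne_zero).clm_apply continuous_const
  rw [integral_mul_fderiv_eq_neg_fderiv_mul_of_integrable, neg_neg]
  · exact (hf'.mul hg.continuous).integrable_of_hasCompactSupport hc.mul_left
  · exact (hf.continuous.mul hg').integrable_of_hasCompactSupport (hc.fderiv_apply ℝ v).mul_left
  · exact (hf.continuous.mul hg.continuous).integrable_of_hasCompactSupport hc.mul_left
  · exact fun x _ => hf.differentiable one_ne_zero x
  · exact fun x _ => hg.differentiable one_ne_zero x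

/-- Green's formula. -/
theorem integral_laplacian_mul_eq {n : ℕ} {f g : EuclideanSpace ℝ (Fin n) → ℂ}
    (hf : ContDiff ℝ 2 f) (hg : ContDiff ℝ 2 g) (hc : HasCompactSupport g) :
    ∫ x, (Δ f) x * g x = ∫ x, f x * (Δ g) x := by
  simp_rw [laplacian_eq_sum_fderiv hf, laplacian_eq_sum_fderiv hg, Finset.sum_mul, Finset.mul_sum]
  have c2 : ∀ {h : EuclideanSpace ℝ (Fin n) → ℂ}, ContDiff ℝ 2 h → ∀ v,
      Continuous fun x => fderiv ℝ (fun z => fderiv ℝ h z v) x v := fun hh v =>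
    ((contDiff_fderiv_apply hh _).continuous_fderiv one_ne_zero).clm_apply continuous_const
  have h1 : ContDiff ℝ 1 f := hf.of_le (by norm_num)
  have h2 : ContDiff ℝ 1 g := hg.of_le (by norm_num)
  rw [integral_finsetSum, integral_finsetSum]
  · refine Finset.sum_congr rfl fun i _ => ?_
    rw [integral_fderiv_mul_eq_neg (contDiff_fderiv_apply hf _) h2 hc,
      integral_fderiv_mul_eq_neg h1 (contDiff_fderiv_apply hg _) (hc.fderiv_apply ℝ _), neg_neg]
  · exact fun i _ => (hf.continuous.mul (c2 hg _)).integrable_of_hasCompactSupport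
      ((hc.fderiv_apply ℝ _).fderiv_apply ℝ _).mul_left
  · exact fun i _ => ((c2 hf _).mul hg.continuous).integrable_of_hasCompactSupport hc.mul_left

/-- For q = |x - y|² one has |∇q|² = 4q and Δq = 2n. Applied to the heat kernel this turns Δ into
the time derivative. -/
theorem laplacian_radial {n : ℕ} {P P' P'' : ℝ → ℂ} (hP : ContDiff ℝ 2 P)
    (h1 : ∀ q, HasDerivAt P (P' q) q) (h2 : ∀ q, HasDerivAt P' (P'' q) q)
    (y x : EuclideanSpace ℝ (Fin n)) :
    (Δ fun x : EuclideanSpace ℝ (Fin n) => P (‖x - y‖ ^ 2)) x =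
      4 * (‖x - y‖ ^ 2 : ℝ) * P'' (‖x - y‖ ^ 2) + 2 * n * P' (‖x - y‖ ^ 2) := by
  have hq : ContDiff ℝ 2 fun x : EuclideanSpace ℝ (Fin n) => ‖x - y‖ ^ 2 :=
    (contDiff_id.sub contDiff_const).norm_sq ℝ
  have hqd : ∀ z, HasFDerivAt (fun x : EuclideanSpace ℝ (Fin n) => ‖x - y‖ ^ 2)
      (2 • innerSL ℝ (z - y)) z := by
    intro z
    have := (((hasFDerivAt_id z).sub_const y)).norm_sq
    simpa using this
  have hPq : ContDiff ℝ 2 fun x : EuclideanSpace ℝ (Fin n) => P (‖x - y‖ ^ 2) := hP.comp hq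
  rw [laplacian_eq_sum_fderiv hPq]
  have e1 : ∀ z v, fderiv ℝ (fun x : EuclideanSpace ℝ (Fin n) => P (‖x - y‖ ^ 2)) z v =
      ((2 * inner ℝ (z - y) v : ℝ) : ℂ) * P' (‖z - y‖ ^ 2) := by
    intro z v
    have := (h1 (‖z - y‖ ^ 2)).hasFDerivAt.comp z (hqd z)
    rw [show (fun x : EuclideanSpace ℝ (Fin n) => P (‖x - y‖ ^ 2)) =
      P ∘ (fun x => ‖x - y‖ ^ 2) from rfl, this.fderiv]
    simp [inner_sub_left]
    ring
  have e2 : ∀ v, fderiv ℝ (fun z : EuclideanSpace ℝ (Fin n) =>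
      ((2 * inner ℝ (z - y) v : ℝ) : ℂ) * P' (‖z - y‖ ^ 2)) x v =
      4 * ((inner ℝ (x - y) v ^ 2 : ℝ) : ℂ) * P'' (‖x - y‖ ^ 2) +
        2 * ((inner ℝ v v : ℝ) : ℂ) * P' (‖x - y‖ ^ 2) := by
    intro v
    have d1 : HasFDerivAt (fun z : EuclideanSpace ℝ (Fin n) => ((2 * inner ℝ (z - y) v : ℝ) : ℂ))
        (Complex.ofRealCLM ∘L ((2 : ℝ) • innerSL ℝ v)) x := by
      refine Complex.ofRealCLM.hasFDerivAt.comp x ?_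
      have := ((innerSL ℝ v).hasFDerivAt (x := x - y)).comp x ((hasFDerivAt_id x).sub_const y)
      have := this.const_smul (2 : ℝ)
      convert! this using 1
      · ext z
        simp [real_inner_comm]
        rfl
    have d2 := (h2 (‖x - y‖ ^ 2)).hasFDerivAt.comp x (hqd x)
    have := d1.mul d2
    rw [show (fun z : EuclideanSpace ℝ (Fin n) =>
      ((2 * inner ℝ (z - y) v : ℝ) : ℂ) * P' (‖z - y‖ ^ 2)) =
      (fun z : EuclideanSpace ℝ (Fin n) => ((2 * inner ℝ (z - y) v : ℝ) : ℂ)) *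
        (P' ∘ fun z => ‖z - y‖ ^ 2) from rfl, this.fderiv]
    simp [inner_sub_left]
    ring
  simp_rw [e1, e2]
  rw [Finset.sum_add_distrib, ← Finset.sum_mul, ← Finset.sum_mul, ← Finset.mul_sum,
    ← Finset.mul_sum, ← Complex.ofReal_sum, ← Complex.ofReal_sum]
  have s1 : ∑ i, inner ℝ (x - y) (EuclideanSpace.basisFun (Fin n) ℝ i) ^ 2 = ‖x - y‖ ^ 2 := by
    have := (EuclideanSpace.basisFun (Fin n) ℝ).sum_sq_norm_inner_left (x - y)
    simpa using this
  have s2 : ∑ i, inner ℝ (EuclideanSpace.basisFun (Fin n) ℝ i)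
      (EuclideanSpace.basisFun (Fin n) ℝ i) = (n : ℝ) := by
    simp
  rw [s1, s2]
  push_cast
  ring

theorem exists_cutoff : ∃ (χ χ' χ'' : ℝ → ℝ) (C : ℝ), ContDiff ℝ 2 χ ∧
    (∀ q, HasDerivAt χ (χ' q) q) ∧ (∀ q, HasDerivAt χ' (χ'' q) q) ∧
    (∀ q, |χ q| ≤ C ∧ |χ' q| ≤ C ∧ |χ'' q| ≤ C) ∧
    (∀ q < 1, χ q = 1 ∧ χ' q = 0 ∧ χ'' q = 0) ∧ ∀ q, 2 ≤ q → χ q = 0 := by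
  set χ : ℝ → ℝ := fun q => Real.smoothTransition (2 - q) with hχ
  have hs : ContDiff ℝ 2 χ :=
    (Real.smoothTransition.contDiff (n := 2)).comp (contDiff_const.sub contDiff_id)
  have hs1 : ContDiff ℝ 1 (deriv χ) := ((contDiff_succ_iff_deriv (n := 1)).1 hs).2.2
  have h1 : ∀ q < 1, χ =ᶠ[𝓝 q] fun _ => 1 := by
    intro q hq
    filter_upwards [gt_mem_nhds hq] with z hz
    exact Real.smoothTransition.one_of_one_le (by linarith)
  have h1' : ∀ q < 1, deriv χ q = 0 := fun q hq => by rw [(h1 q hq).deriv_eq]; simp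
  have h1'' : ∀ q < 1, deriv (deriv χ) q = 0 := fun q hq => by
    have : deriv χ =ᶠ[𝓝 q] fun _ => 0 := by
      filter_upwards [gt_mem_nhds hq] with z hz
      exact h1' z hz
    rw [this.deriv_eq]; simp
  have h2 : ∀ q > 2, deriv χ q = 0 := by
    intro q hq
    have : χ =ᶠ[𝓝 q] fun _ => 0 := by
      filter_upwards [lt_mem_nhds hq] with z hz
      exact Real.smoothTransition.zero_of_nonpos (by linarith)
    rw [this.deriv_eq]; simp
  have hc : HasCompactSupport (deriv χ) := by
    refine HasCompactSupport.intro (isCompact_Icc (a := (1 : ℝ)) (b := 2)) fun q hq => ?_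
    rcases lt_or_ge q 1 with h | h
    · exact h1' q h
    · exact h2 q (not_le.1 fun h' => hq ⟨h, h'⟩)
  obtain ⟨C₁, hC₁⟩ := hc.exists_bound_of_continuous hs1.continuous
  obtain ⟨C₂, hC₂⟩ := hc.deriv.exists_bound_of_continuous (hs1.continuous_deriv le_rfl)
  refine ⟨χ, deriv χ, deriv (deriv χ), max 1 (max C₁ C₂), hs,
    fun q => (hs.differentiable two_ne_zero q).hasDerivAt,
    fun q => (hs1.differentiable one_ne_zero q).hasDerivAt, fun q => ⟨?_, ?_, ?_⟩,
    fun q hq => ⟨(h1 q hq).eq_of_nhds, h1' q hq, h1'' q hq⟩,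
    fun q hq => Real.smoothTransition.zero_of_nonpos (by linarith)⟩
  · rw [abs_of_nonneg (Real.smoothTransition.nonneg _)]
    exact (Real.smoothTransition.le_one _).trans (le_max_left _ _)
  · exact (hC₁ q).trans ((le_max_left _ _).trans (le_max_right _ _))
  · exact (hC₂ q).trans ((le_max_right _ _).trans (le_max_right _ _))

theorem hasDerivAt_gaussProfile_real {n : ℕ} {ζ : ℂ} (q : ℝ) :
    HasDerivAt (gaussProfile n ζ) (-(4 * ζ)⁻¹ * gaussProfile n ζ q) q := by
  have h : HasDerivAt (fun q : ℝ => -(q : ℂ) / (4 * ζ)) (-(4 * ζ)⁻¹) q := by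
    convert! ((hasDerivAt_id q).ofReal_comp.neg).div_const (4 * ζ) using 1
    simp [neg_div]
  convert! (h.cexp.const_mul ((4 * Real.pi * ζ) ^ ((-(n / 2 : ℝ) : ℝ) : ℂ))) using 1
  rw [gaussProfile]
  ring

/-- Compactly supported `C²` approximations of the heat kernel. -/
theorem exists_approx_gaussProfile {n : ℕ} {ζ : ℂ} (hζ : 0 < ζ.re)
    (y : EuclideanSpace ℝ (Fin n)) :
    ∃ (ψ : ℕ → EuclideanSpace ℝ (Fin n) → ℂ) (B : EuclideanSpace ℝ (Fin n) → ℝ),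
      (∀ k, ContDiff ℝ 2 (ψ k)) ∧ (∀ k, HasCompactSupport (ψ k)) ∧ Integrable B ∧
      (∀ k x, ‖ψ k x‖ ≤ B x) ∧ (∀ k x, ‖(Δ (ψ k)) x‖ ≤ B x) ∧
      (∀ x, Tendsto (fun k => ψ k x) atTop (𝓝 (gaussProfile n ζ (‖x - y‖ ^ 2)))) ∧
      ∀ x, Tendsto (fun k => (Δ (ψ k)) x) atTop (𝓝 (gaussProfileDeriv n ζ (‖x - y‖ ^ 2))) := by
  obtain ⟨χ, χ', χ'', C, hs, h1, h2, hC, hlt, hge⟩ := exists_cutoff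
  set p := gaussProfile n ζ with hp
  set a : ℂ := -(4 * ζ)⁻¹ with ha
  have hp1 : ∀ q, HasDerivAt p (a * p q) q := fun q => hasDerivAt_gaussProfile_real q
  have hp2 : ContDiff ℝ 2 p := by
    rw [hp]
    unfold gaussProfile
    refine contDiff_const.mul (ContDiff.cexp ?_)
    exact (Complex.ofRealCLM.contDiff.neg).div_const _
  -- The cutoff acts on the squared distance at scale R ≥ 1, so the scaled derivatives keep the
  -- bounds of the unscaled ones and a single majorant serves all k.
  set R : ℕ → ℝ := fun k => (k : ℝ) + 1 with hR
  have hR1 : ∀ k, 1 ≤ R k := fun k => by simp [hR]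
  have hR0 : ∀ k, 0 < R k := fun k => by linarith [hR1 k]
  have hRi : ∀ k, (R k)⁻¹ ≤ 1 := fun k => inv_le_one_of_one_le₀ (hR1 k)
  set P : ℕ → ℝ → ℂ := fun k q => p q * (χ ((R k)⁻¹ * q) : ℂ) with hP
  set P' : ℕ → ℝ → ℂ := fun k q => a * p q * (χ ((R k)⁻¹ * q) : ℂ) +
    p q * (((R k)⁻¹ * χ' ((R k)⁻¹ * q) : ℝ) : ℂ) with hP'
  set P'' : ℕ → ℝ → ℂ := fun k q => a * (a * p q) * (χ ((R k)⁻¹ * q) : ℂ) +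
    2 * (a * p q * (((R k)⁻¹ * χ' ((R k)⁻¹ * q) : ℝ) : ℂ)) +
    p q * (((R k)⁻¹ * ((R k)⁻¹ * χ'' ((R k)⁻¹ * q)) : ℝ) : ℂ) with hP''
  have hlin : ∀ k q, HasDerivAt (fun q => (R k)⁻¹ * q) (R k)⁻¹ q := fun k q => by
    simpa using (hasDerivAt_id q).const_mul (R k)⁻¹
  have hd0 : ∀ k q, HasDerivAt (fun q => (χ ((R k)⁻¹ * q) : ℂ))
      (((R k)⁻¹ * χ' ((R k)⁻¹ * q) : ℝ) : ℂ) q := by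
    intro k q
    have := ((h1 ((R k)⁻¹ * q)).comp q (hlin k q)).ofReal_comp
    rw [mul_comm] at this
    exact this
  have hd1 : ∀ k q, HasDerivAt (fun q => (((R k)⁻¹ * χ' ((R k)⁻¹ * q) : ℝ) : ℂ))
      (((R k)⁻¹ * ((R k)⁻¹ * χ'' ((R k)⁻¹ * q)) : ℝ) : ℂ) q := by
    intro k q
    have := (((h2 ((R k)⁻¹ * q)).comp q (hlin k q)).const_mul (R k)⁻¹).ofReal_comp
    rw [mul_comm (χ'' _)] at this
    exact this
  have hPd : ∀ k q, HasDerivAt (P k) (P' k q) q := fun k q => (hp1 q).mul (hd0 k q)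
  have hP'd : ∀ k q, HasDerivAt (P' k) (P'' k q) q := by
    intro k q
    convert! (((hp1 q).const_mul a).mul (hd0 k q)).add ((hp1 q).mul (hd1 k q)) using 1
    simp only [hP'']
    ring
  have hPs : ∀ k, ContDiff ℝ 2 (P k) := fun k =>
    hp2.mul (Complex.ofRealCLM.contDiff.comp (hs.comp (contDiff_const.mul contDiff_id)))
  have hq : ContDiff ℝ 2 fun x : EuclideanSpace ℝ (Fin n) => ‖x - y‖ ^ 2 :=
    (contDiff_id.sub contDiff_const).norm_sq ℝ
  have hlap : ∀ k x, (Δ fun x : EuclideanSpace ℝ (Fin n) => P k (‖x - y‖ ^ 2)) x =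
      4 * (‖x - y‖ ^ 2 : ℝ) * P'' k (‖x - y‖ ^ 2) + 2 * n * P' k (‖x - y‖ ^ 2) :=
    fun k x => laplacian_radial (hPs k) (hPd k) (hP'd k) y x
  have hC0 : 0 ≤ C := (abs_nonneg _).trans (hC 0).1
  have hpR : ∀ k, 0 ≤ (R k)⁻¹ := fun k => (inv_pos.2 (hR0 k)).le
  have hn0 : ∀ k q, ‖(χ ((R k)⁻¹ * q) : ℂ)‖ ≤ C := fun k q => by
    rw [Complex.norm_real]; exact (hC _).1
  have hn1 : ∀ k q, ‖(((R k)⁻¹ * χ' ((R k)⁻¹ * q) : ℝ) : ℂ)‖ ≤ C := fun k q => by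
    rw [Complex.norm_real, norm_mul, Real.norm_of_nonneg (hpR k)]
    exact (mul_le_of_le_one_left (norm_nonneg _) (hRi k)).trans (hC _).2.1
  have hn2 : ∀ k q, ‖(((R k)⁻¹ * ((R k)⁻¹ * χ'' ((R k)⁻¹ * q)) : ℝ) : ℂ)‖ ≤ C := fun k q => by
    rw [Complex.norm_real, norm_mul, norm_mul, Real.norm_of_nonneg (hpR k)]
    exact (mul_le_of_le_one_left (by positivity) (hRi k)).trans
      ((mul_le_of_le_one_left (norm_nonneg _) (hRi k)).trans (hC _).2.2)
  have hb' : ∀ k q, ‖P' k q‖ ≤ (‖a‖ * C + C) * ‖p q‖ := by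
    intro k q
    refine (norm_add_le _ _).trans ?_
    rw [norm_mul, norm_mul, norm_mul (p q)]
    have := hn0 k q
    have := hn1 k q
    calc _ ≤ ‖a‖ * ‖p q‖ * C + ‖p q‖ * C := by gcongr
      _ = _ := by ring
  have hb'' : ∀ k q, ‖P'' k q‖ ≤ (‖a‖ ^ 2 * C + 2 * ‖a‖ * C + C) * ‖p q‖ := by
    intro k q
    have e1 : ‖a * (a * p q) * (χ ((R k)⁻¹ * q) : ℂ)‖ ≤ ‖a‖ * (‖a‖ * ‖p q‖) * C := by
      rw [norm_mul, norm_mul, norm_mul]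
      have := hn0 k q
      gcongr
    have e2 : ‖2 * (a * p q * (((R k)⁻¹ * χ' ((R k)⁻¹ * q) : ℝ) : ℂ))‖ ≤
        2 * (‖a‖ * ‖p q‖ * C) := by
      rw [norm_mul, norm_mul, norm_mul, Complex.norm_ofNat]
      have := hn1 k q
      gcongr
    have e3 : ‖p q * (((R k)⁻¹ * ((R k)⁻¹ * χ'' ((R k)⁻¹ * q)) : ℝ) : ℂ)‖ ≤ ‖p q‖ * C := by
      rw [norm_mul]
      have := hn2 k q
      gcongr
    calc _ ≤ ‖a‖ * (‖a‖ * ‖p q‖) * C + 2 * (‖a‖ * ‖p q‖ * C) + ‖p q‖ * C :=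
          (norm_add₃_le).trans (add_le_add (add_le_add e1 e2) e3)
      _ = _ := by ring
  set D : ℝ := 4 * (‖a‖ ^ 2 * C + 2 * ‖a‖ * C + C) + 2 * n * (‖a‖ * C + C) + C with hD
  have hpn := fun q => norm_gaussProfile (n := n) hζ q
  set κ : ℝ := ζ.re / (4 * ‖ζ‖ ^ 2) with hκ
  have hκ0 : 0 < κ := by
    have := norm_pos_iff.2 (ne_zero_of_re_pos hζ)
    positivity
  set b : ℝ := (4 * Real.pi * ‖ζ‖) ^ (-(n / 2 : ℝ)) with hb
  have hkey : ∀ q : ℝ, (1 + q) * ‖p q‖ = b * ((1 + q) * Real.exp (-κ * q)) := fun q => by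
    rw [hp, hpn]; ring
  refine ⟨fun k x => P k (‖x - y‖ ^ 2),
    fun x => D * (b * ((1 + ‖x - y‖ ^ 2) * Real.exp (-κ * ‖x - y‖ ^ 2))),
    fun k => (hPs k).comp hq, fun k => ?_,
    ((integrable_one_add_mul_exp_neg hκ0 y).const_mul b).const_mul D, fun k x => ?_, fun k x => ?_,
    fun x => ?_, fun x => ?_⟩
  · refine HasCompactSupport.intro (isCompact_closedBall y (Real.sqrt (2 * R k))) fun x hx => ?_
    rw [Metric.mem_closedBall, dist_eq_norm, not_le] at hx
    rw [Real.sqrt_lt' ((Real.sqrt_nonneg _).trans_lt hx)] at hx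
    have : 2 ≤ (R k)⁻¹ * ‖x - y‖ ^ 2 := by
      rw [inv_mul_eq_div, le_div_iff₀ (hR0 k)]
      exact hx.le
    simp [hP, hge _ this]
  · beta_reduce
    rw [← hkey, norm_mul]
    have h := hn0 k (‖x - y‖ ^ 2)
    have : C ≤ D := by
      have : 0 ≤ 4 * (‖a‖ ^ 2 * C + 2 * ‖a‖ * C + C) + 2 * n * (‖a‖ * C + C) := by positivity
      linarith
    calc _ ≤ ‖p (‖x - y‖ ^ 2)‖ * D := by gcongr; exact h.trans this
      _ ≤ _ := by
        have h3 : 0 ≤ D * ‖p (‖x - y‖ ^ 2)‖ * ‖x - y‖ ^ 2 := by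
          have := hC0.trans this
          positivity
        nlinarith
  · beta_reduce
    rw [← hkey, hlap]
    refine (norm_add_le _ _).trans ?_
    rw [norm_mul, norm_mul, norm_mul, norm_mul, Complex.norm_real, Complex.norm_natCast,
      Real.norm_of_nonneg (by positivity : 0 ≤ ‖x - y‖ ^ 2), Complex.norm_ofNat,
      Complex.norm_ofNat]
    have g1 := hb' k (‖x - y‖ ^ 2)
    have g2 := hb'' k (‖x - y‖ ^ 2)
    set Q := ‖x - y‖ ^ 2 with hQ
    have hQ0 : 0 ≤ Q := by positivity
    calc _ ≤ 4 * Q * ((‖a‖ ^ 2 * C + 2 * ‖a‖ * C + C) * ‖p Q‖) +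
          2 * n * ((‖a‖ * C + C) * ‖p Q‖) := by gcongr
      _ ≤ _ := by
        have k1 : 0 ≤ 4 * (‖a‖ ^ 2 * C + 2 * ‖a‖ * C + C) * ‖p Q‖ := by positivity
        have k2 : 0 ≤ 2 * n * (‖a‖ * C + C) * ‖p Q‖ * Q := by positivity
        have k3 : 0 ≤ C * ‖p Q‖ * (1 + Q) := by positivity
        rw [hD]
        nlinarith
  -- At a fixed point the cutoff is eventually 1 in a neighbourhood, so the sequences are eventually
  -- constant.
  · refine tendsto_const_nhds.congr' ?_
    filter_upwards [eventually_gt_atTop ⌈‖x - y‖ ^ 2⌉₊] with k hk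
    have : (R k)⁻¹ * ‖x - y‖ ^ 2 < 1 := by
      rw [inv_mul_eq_div, div_lt_one (hR0 k)]
      have := Nat.lt_of_ceil_lt hk
      simp only [hR]
      linarith
    simp [hP, hlt _ this]
  · refine tendsto_const_nhds.congr' ?_
    filter_upwards [eventually_gt_atTop ⌈‖x - y‖ ^ 2⌉₊] with k hk
    have : (R k)⁻¹ * ‖x - y‖ ^ 2 < 1 := by
      rw [inv_mul_eq_div, div_lt_one (hR0 k)]
      have := Nat.lt_of_ceil_lt hk
      simp only [hR]
      linarith
    have h0 := ne_zero_of_re_pos hζ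
    obtain ⟨m1, m2, m3⟩ := hlt _ this
    rw [hlap]
    simp only [hP', hP'', m1, m2, m3, gaussProfileDeriv, ha, ← hp]
    push_cast
    field_simp
    ring

theorem tendsto_integral_mul_of_dominated {n : ℕ} {h : EuclideanSpace ℝ (Fin n) → ℂ} {M : ℝ}
    (hm : AEStronglyMeasurable h) (hM : ∀ x, ‖h x‖ ≤ M) {ψ : ℕ → EuclideanSpace ℝ (Fin n) → ℂ}
    {g : EuclideanSpace ℝ (Fin n) → ℂ} {B : EuclideanSpace ℝ (Fin n) → ℝ}
    (hψ : ∀ k, Continuous (ψ k)) (hB : Integrable B) (hle : ∀ k x, ‖ψ k x‖ ≤ B x)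
    (hlim : ∀ x, Tendsto (fun k => ψ k x) atTop (𝓝 (g x))) :
    Tendsto (fun k => ∫ x, h x * ψ k x) atTop (𝓝 (∫ x, h x * g x)) := by
  refine tendsto_integral_of_dominated_convergence (fun x => M * B x)
    (fun k => hm.mul (hψ k).aestronglyMeasurable) (hB.const_mul M)
    (fun k => Eventually.of_forall fun x => ?_)
    (Eventually.of_forall fun x => (hlim x).const_mul _)
  rw [norm_mul]
  exact mul_le_mul (hM x) (hle k x) (norm_nonneg _) ((norm_nonneg _).trans (hM x))

/-- Green's formula is applied to the compactly supported approximations and the cutoff removed by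
dominated convergence, so no decay of f at infinity is required. -/
theorem integral_laplacian_mul_gaussProfile {n : ℕ} {f : EuclideanSpace ℝ (Fin n) → ℂ}
    {M M' : ℝ} (hf : ContDiff ℝ 2 f) (hM : ∀ x, ‖f x‖ ≤ M) (hM' : ∀ x, ‖(Δ f) x‖ ≤ M') {ζ : ℂ}
    (hζ : 0 < ζ.re) (y : EuclideanSpace ℝ (Fin n)) :
    heatExt (Δ f) ζ y = ∫ x, f x * gaussProfileDeriv n ζ (‖x - y‖ ^ 2) := by
  obtain ⟨ψ, B, h1, h2, h3, h4, h5, h6, h7⟩ := exists_approx_gaussProfile hζ y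
  have l1 := tendsto_integral_mul_of_dominated (continuous_laplacian hf).aestronglyMeasurable hM'
    (fun k => (h1 k).continuous) h3 h4 h6
  have l2 := tendsto_integral_mul_of_dominated hf.continuous.aestronglyMeasurable hM
    (fun k => continuous_laplacian (h1 k)) h3 h5 h7
  simp_rw [integral_laplacian_mul_eq hf (h1 _) (h2 _)] at l1
  exact tendsto_nhds_unique l1 l2

theorem norm_gaussProfile_smul {n : ℕ} {e : ℂ} (he : 0 < e.re) {r : ℝ} (hr : 0 < r) (q : ℝ) :
    ‖gaussProfile n (r * e) (r * q)‖ = r ^ (-(n / 2 : ℝ)) * ‖gaussProfile n e q‖ := by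
  have hre : 0 < ((r : ℂ) * e).re := by
    rw [Complex.re_ofReal_mul]
    positivity
  have h0 : 0 < ‖e‖ := norm_pos_iff.2 (ne_zero_of_re_pos he)
  have hpi := Real.pi_pos
  rw [norm_gaussProfile hre, norm_gaussProfile he, norm_mul, Complex.norm_real,
    Real.norm_of_nonneg hr.le, Complex.re_ofReal_mul,
    show 4 * Real.pi * (r * ‖e‖) = r * (4 * Real.pi * ‖e‖) by ring,
    Real.mul_rpow hr.le (by positivity), mul_assoc]
  congr 3
  field_simp

/-- The heat extension attains the initial value along rays. -/
theorem tendsto_heatExt {n : ℕ} {h : EuclideanSpace ℝ (Fin n) → ℂ} {M : ℝ} (hc : Continuous h)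
    (hM : ∀ x, ‖h x‖ ≤ M) {e : ℂ} (he : 0 < e.re) (y : EuclideanSpace ℝ (Fin n)) :
    Tendsto (fun r : ℝ => heatExt h (r * e) y) (𝓝[>] 0) (𝓝 (h y)) := by
  rw [tendsto_iff_norm_sub_tendsto_zero]
  -- After the substitution x ↦ y + √r x the modulus of the kernel no longer depends on r, and
  -- dominated convergence applies.
  set I : ℝ → ℝ := fun r => ∫ x : EuclideanSpace ℝ (Fin n),
    ‖h (Real.sqrt r • x + y) - h y‖ * ‖gaussProfile n e (‖x‖ ^ 2)‖ with hI
  have hgi : Integrable fun x : EuclideanSpace ℝ (Fin n) => ‖gaussProfile n e (‖x‖ ^ 2)‖ := by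
    simpa using (integrable_gaussProfile he (0 : EuclideanSpace ℝ (Fin n))).1.norm
  have hgc := continuous_gaussProfile n e
  have hlim : Tendsto I (𝓝[>] 0) (𝓝 0) := by
    suffices h0 : Tendsto I (𝓝[>] 0) (𝓝 (∫ x : EuclideanSpace ℝ (Fin n), (0 : ℝ))) by
      simpa using h0
    refine tendsto_integral_filter_of_dominated_convergence
      (fun x => (M + M) * ‖gaussProfile n e (‖x‖ ^ 2)‖) ?_ ?_ (hgi.const_mul _) ?_
    · exact Eventually.of_forall fun r => by fun_prop
    · refine Eventually.of_forall fun r => Eventually.of_forall fun x => ?_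
      rw [norm_mul, norm_norm, norm_norm]
      exact mul_le_mul_of_nonneg_right
        ((norm_sub_le _ _).trans (add_le_add (hM _) (hM _))) (norm_nonneg _)
    · refine Eventually.of_forall fun x => ?_
      have hcont : Continuous fun r : ℝ =>
          ‖h (Real.sqrt r • x + y) - h y‖ * ‖gaussProfile n e (‖x‖ ^ 2)‖ := by
        have := Real.continuous_sqrt
        fun_prop
      have := hcont.tendsto 0
      simp only [Real.sqrt_zero, zero_smul, zero_add, sub_self, norm_zero, zero_mul] at this
      exact this.mono_left nhdsWithin_le_nhds
  refine squeeze_zero' (Eventually.of_forall fun _ => norm_nonneg _) ?_ hlim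
  filter_upwards [self_mem_nhdsWithin] with r hr
  have hr0 : 0 < r := hr
  have hre : 0 < ((r : ℂ) * e).re := by
    rw [Complex.re_ofReal_mul]
    positivity
  have hg := integrable_gaussProfile hre y
  have e1 : heatExt h (r * e) y - h y =
      ∫ x, (h x - h y) * gaussProfile n (r * e) (‖x - y‖ ^ 2) := by
    simp_rw [sub_mul]
    rw [integral_sub (integrable_mul_gaussProfile hc.aestronglyMeasurable hM hre y).1
      (hg.1.const_mul _), integral_const_mul, integral_gaussProfile hre, mul_one, heatExt]
  rw [e1]
  refine (norm_integral_le_integral_norm _).trans (le_of_eq ?_)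
  simp_rw [norm_mul]
  rw [← integral_add_right_eq_self (fun x : EuclideanSpace ℝ (Fin n) =>
    ‖h x - h y‖ * ‖gaussProfile n (r * e) (‖x - y‖ ^ 2)‖) y]
  simp only [add_sub_cancel_right]
  have hs := Measure.integral_comp_smul (volume : Measure (EuclideanSpace ℝ (Fin n)))
    (fun x => ‖h (x + y) - h y‖ * ‖gaussProfile n (r * e) (‖x‖ ^ 2)‖) (Real.sqrt r)
  have hsr : 0 < Real.sqrt r := Real.sqrt_pos.2 hr0
  rw [finrank_euclideanSpace_fin, abs_of_pos (by positivity), smul_eq_mul,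
    eq_inv_mul_iff_mul_eq₀ (by positivity)] at hs
  rw [← hs, ← integral_const_mul, hI]
  refine integral_congr_ae (Eventually.of_forall fun x => ?_)
  simp only
  rw [norm_smul, mul_pow, Real.norm_of_nonneg hsr.le, Real.sq_sqrt hr0.le,
    norm_gaussProfile_smul he hr0]
  have : Real.sqrt r ^ n * r ^ (-(n / 2 : ℝ)) = 1 := by
    rw [Real.sqrt_eq_rpow, ← Real.rpow_natCast, ← Real.rpow_mul hr0.le, ← Real.rpow_add hr0]
    ring_nf
    exact Real.rpow_zero r
  linear_combination ‖h (Real.sqrt r • x + y) - h y‖ * ‖gaussProfile n e (‖x‖ ^ 2)‖ * this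

/-! ### From the classical equation to Volterra equations -/

theorem tendsto_rlIntegral {a t K : ℝ} (ha : 0 < a) (ht : 0 ≤ t) {f : ℕ → ℝ → ℂ} {g : ℝ → ℂ}
    (hf : ∀ k, ContinuousOn (f k) (Icc 0 t)) (hK : ∀ k, ∀ τ ∈ Icc 0 t, ‖f k τ‖ ≤ K)
    (hlim : ∀ τ ∈ Icc 0 t, Tendsto (fun k => f k τ) atTop (𝓝 (g τ))) :
    Tendsto (fun k => rlIntegral a (f k) t) atTop (𝓝 (rlIntegral a g t)) := by
  have hG := Real.Gamma_pos_of_pos ha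
  refine intervalIntegral.tendsto_integral_filter_of_dominated_convergence
    (fun τ => (t - τ) ^ (a - 1) / Real.Gamma a * K) (Eventually.of_forall fun k => ?_)
    (Eventually.of_forall fun k => Eventually.of_forall fun τ hτ => ?_)
    ((intervalIntegrable_rlKernel ha t).mul_const K) (Eventually.of_forall fun τ hτ => ?_)
  · rw [uIoc_of_le ht]
    exact (intervalIntegrable_rlIntegrand ha ht (hf k)).1.aestronglyMeasurable
  · rw [uIoc_of_le ht] at hτ
    have h0 : 0 ≤ t - τ := sub_nonneg.2 hτ.2
    rw [norm_mul, Complex.norm_real, Real.norm_of_nonneg (by positivity)]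
    exact mul_le_mul_of_nonneg_left (hK k τ ⟨hτ.1.le, hτ.2⟩) (by positivity)
  · rw [uIoc_of_le ht] at hτ
    exact (hlim τ ⟨hτ.1.le, hτ.2⟩).const_mul _

/-- Interchanging a time integral with the integral against a test function. -/
theorem integral_intervalIntegral_mul_swap {n : ℕ} {a b : ℝ} (hab : a ≤ b) {k : ℝ → ℂ}
    (hk : IntervalIntegrable k volume a b) {G : ℝ → EuclideanSpace ℝ (Fin n) → ℂ}
    (hG : ContinuousOn (Function.uncurry G) (Icc a b ×ˢ univ))
    {ψ : EuclideanSpace ℝ (Fin n) → ℂ} (hψ : Continuous ψ) (hc : HasCompactSupport ψ) :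
    Integrable (fun x => (∫ τ in a..b, k τ * G τ x) * ψ x) ∧
    ∫ x, (∫ τ in a..b, k τ * G τ x) * ψ x = ∫ τ in a..b, k τ * ∫ x, G τ x * ψ x := by
  simp_rw [intervalIntegral.integral_of_le hab, ← integral_mul_const, ← integral_const_mul]
  obtain ⟨K, hK⟩ := (isCompact_Icc.prod hc).exists_bound_of_continuousOn
    (hG.mono (prod_mono_right (subset_univ (tsupport ψ))))
  have hk' : Integrable k (volume.restrict (Ioc a b)) :=
    (intervalIntegrable_iff_integrableOn_Ioc_of_le hab).1 hk
  have hbd : ∀ τ ∈ Icc a b, ∀ x, ‖G τ x * ψ x‖ ≤ K * ‖ψ x‖ := by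
    intro τ hτ x
    rw [norm_mul]
    by_cases hx : x ∈ tsupport ψ
    · exact mul_le_mul_of_nonneg_right (hK (τ, x) ⟨hτ, hx⟩) (norm_nonneg _)
    · simp [image_eq_zero_of_notMem_tsupport hx]
  have hint : Integrable (Function.uncurry fun τ x => k τ * (G τ x * ψ x))
      ((volume.restrict (Ioc a b)).prod volume) := by
    have hb := hk'.norm.mul_prod
      ((hψ.integrable_of_hasCompactSupport (μ := volume) hc).norm.const_mul K)
    refine hb.mono' ?_ ?_
    · refine AEStronglyMeasurable.mul hk'.1.comp_fst ?_
      have hGc : ContinuousOn (fun p : ℝ × EuclideanSpace ℝ (Fin n) => G p.1 p.2 * ψ p.2)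
          (Ioc a b ×ˢ univ) :=
        (hG.mono (prod_mono_left Ioc_subset_Icc_self)).mul
          (hψ.comp continuous_snd).continuousOn
      have := hGc.aestronglyMeasurable (μ := (volume : Measure ℝ).prod volume)
        (measurableSet_Ioc.prod MeasurableSet.univ)
      rwa [← Measure.prod_restrict, Measure.restrict_univ] at this
    · have : ∀ᵐ p ∂((volume.restrict (Ioc a b)).prod
          (volume : Measure (EuclideanSpace ℝ (Fin n)))), p ∈ Ioc a b ×ˢ univ := by
        rw [← Measure.restrict_univ (μ := (volume : Measure (EuclideanSpace ℝ (Fin n)))),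
          Measure.prod_restrict]
        exact ae_restrict_mem (measurableSet_Ioc.prod MeasurableSet.univ)
      filter_upwards [this] with p hp
      simp only [Function.uncurry]
      rw [norm_mul]
      exact mul_le_mul_of_nonneg_left (hbd _ (Ioc_subset_Icc_self hp.1) _) (norm_nonneg _)
  simp_rw [mul_assoc]
  exact ⟨hint.integral_prod_right, (integral_integral_swap hint).symm⟩

theorem fracIntegralDeriv_eq_rlIntegral (α : ℝ) (y : ℝ → ℂ) (t : ℝ) :
    fracIntegralDeriv α y t = rlIntegral (2 - α) (halfLineDeriv y) t := by
  rw [fracIntegralDeriv, rlIntegral, ← intervalIntegral.integral_const_mul]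
  congr 1 with τ
  rw [show 2 - α - 1 = 1 - α by ring]
  push_cast
  ring

theorem continuousOn_integral_mul {n : ℕ} {S : Set ℝ} {G : ℝ → EuclideanSpace ℝ (Fin n) → ℂ}
    (hG : ContinuousOn (Function.uncurry G) (S ×ˢ univ)) {ψ : EuclideanSpace ℝ (Fin n) → ℂ}
    (hψ : Continuous ψ) (hc : HasCompactSupport ψ) :
    ContinuousOn (fun τ => ∫ x, G τ x * ψ x) S := by
  refine continuousOn_integral_of_compact_support hc (f := fun τ x => G τ x * ψ x) ?_ ?_
  · exact hG.mul (hψ.comp continuous_snd).continuousOn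
  · intro τ x _ hx
    rw [image_eq_zero_of_notMem_tsupport hx, mul_zero]

theorem continuousOn_section {n : ℕ} {S : Set ℝ} {G : ℝ → EuclideanSpace ℝ (Fin n) → ℂ}
    (hG : ContinuousOn (Function.uncurry G) (S ×ˢ univ)) (x : EuclideanSpace ℝ (Fin n)) :
    ContinuousOn (fun τ => G τ x) S :=
  hG.comp (f := fun τ : ℝ => (τ, x)) (by fun_prop) fun τ hτ => ⟨hτ, mem_univ _⟩

theorem continuous_slice {n : ℕ} {S : Set ℝ} {G : ℝ → EuclideanSpace ℝ (Fin n) → ℂ}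
    (hG : ContinuousOn (Function.uncurry G) (S ×ˢ univ)) {τ : ℝ} (hτ : τ ∈ S) :
    Continuous (G τ) :=
  hG.comp_continuous (f := fun x => (τ, x)) (by fun_prop) fun x => ⟨hτ, mem_univ _⟩

theorem rlIntegral_smul_power {a β t : ℝ} (ha : 0 < a) (hβ : 0 ≤ β) (ht : 0 ≤ t) (b : ℂ) :
    rlIntegral a (fun τ => b * ((τ ^ β / Real.Gamma (β + 1) : ℝ) : ℂ)) t =
      b * ((t ^ (a + β) / Real.Gamma (a + β + 1) : ℝ) : ℂ) := by
  rw [rlIntegral_const_mul, rlIntegral_rpow ha hβ ht]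

theorem integral_add_add_mul {n : ℕ} {g₁ g₂ g₃ ψ : EuclideanSpace ℝ (Fin n) → ℂ}
    (h₁ : Continuous g₁) (h₂ : Continuous g₂) (h₃ : Continuous g₃) (hψ : Continuous ψ)
    (hc : HasCompactSupport ψ) (a b : ℂ) :
    ∫ x, (g₁ x + a * g₂ x + b * g₃ x) * ψ x =
      (∫ x, g₁ x * ψ x) + a * (∫ x, g₂ x * ψ x) + b * ∫ x, g₃ x * ψ x := by
  have hi : ∀ {g : EuclideanSpace ℝ (Fin n) → ℂ}, Continuous g →
      Integrable fun x => g x * ψ x := fun hg =>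
    (hg.mul hψ).integrable_of_hasCompactSupport hc.mul_left
  have e : ∀ x, (g₁ x + a * g₂ x + b * g₃ x) * ψ x =
      (g₁ x * ψ x + a * (g₂ x * ψ x)) + b * (g₃ x * ψ x) := fun x => by ring
  have hi₂ : Integrable fun x => g₁ x * ψ x + a * (g₂ x * ψ x) :=
    (hi h₁).add ((hi h₂).const_mul a)
  simp_rw [e]
  rw [integral_add hi₂ ((hi h₃).const_mul b), integral_add (hi h₁) ((hi h₂).const_mul a),
    integral_const_mul, integral_const_mul]

namespace IsClassicalSolution

variable {n : ℕ} {α : ℝ} {f : ℝ → EuclideanSpace ℝ (Fin n) → ℂ}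
  {u₀ u₁ : EuclideanSpace ℝ (Fin n) → ℂ} {u : ℝ → EuclideanSpace ℝ (Fin n) → ℂ}

theorem continuousOn_uncurry (hu : IsClassicalSolution α f u₀ u₁ u) :
    ContinuousOn (Function.uncurry u) (Ici 0 ×ˢ univ) :=
  hu.contDiffOn_one.continuousOn

theorem hasFDerivWithinAt_curve {S : Set ℝ} (x : EuclideanSpace ℝ (Fin n)) (τ : ℝ) :
    HasFDerivWithinAt (fun τ : ℝ => (τ, x))
      (ContinuousLinearMap.inl ℝ ℝ (EuclideanSpace ℝ (Fin n))) S τ :=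
  ((hasFDerivAt_id τ).prodMk (hasFDerivAt_const x τ)).hasFDerivWithinAt

theorem hasDerivWithinAt (hu : IsClassicalSolution α f u₀ u₁ u) (x : EuclideanSpace ℝ (Fin n))
    {τ : ℝ} (hτ : 0 ≤ τ) :
    HasDerivWithinAt (fun τ => u τ x) (halfLineDeriv (fun τ => u τ x) τ) (Ici 0) τ ∧
    halfLineDeriv (fun τ => u τ x) τ = fderivWithin ℝ
      (fun p : ℝ × EuclideanSpace ℝ (Fin n) => u p.1 p.2) (Ici 0 ×ˢ univ) (τ, x) (1, 0) := by
  have h1 := (hu.contDiffOn_one.differentiableOn one_ne_zero (τ, x)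
    ⟨hτ, mem_univ _⟩).hasFDerivWithinAt
  have hmaps : MapsTo (fun τ : ℝ => (τ, x)) (Ici 0) (Ici 0 ×ˢ univ) :=
    fun z hz => ⟨hz, mem_univ _⟩
  have h2 := (h1.comp τ (hasFDerivWithinAt_curve x τ) hmaps).hasDerivWithinAt
  have h3 : HasDerivWithinAt (fun τ => u τ x) _ (Ici 0) τ := h2
  refine ⟨h3.differentiableWithinAt.hasDerivWithinAt, ?_⟩
  rw [halfLineDeriv, h3.derivWithin (uniqueDiffOn_Ici 0 τ hτ)]
  simp

theorem continuousOn_halfLineDeriv (hu : IsClassicalSolution α f u₀ u₁ u) :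
    ContinuousOn (Function.uncurry fun τ x => halfLineDeriv (fun τ => u τ x) τ)
      (Ici 0 ×ˢ univ) := by
  have h := hu.contDiffOn_one.continuousOn_fderivWithin
    ((uniqueDiffOn_Ici 0).prod uniqueDiffOn_univ) le_rfl
  refine (h.clm_apply (continuousOn_const (c := ((1 : ℝ), (0 : EuclideanSpace ℝ (Fin n)))))).congr
    fun p hp => ?_
  exact (hu.hasDerivWithinAt p.2 hp.1).2

theorem integral_halfLineDeriv (hu : IsClassicalSolution α f u₀ u₁ u)
    (x : EuclideanSpace ℝ (Fin n)) {t : ℝ} (ht : 0 ≤ t) :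
    ∫ τ in (0 : ℝ)..t, halfLineDeriv (fun τ => u τ x) τ = u t x - u 0 x := by
  have hsub : Icc 0 t ⊆ Ici 0 := Icc_subset_Ici_self
  refine intervalIntegral.integral_eq_sub_of_hasDeriv_right_of_le ht
    ((continuousOn_section hu.continuousOn_uncurry x).mono hsub) (fun τ hτ => ?_) ?_
  · exact (hu.hasDerivWithinAt x hτ.1.le).1.mono fun z hz => hτ.1.le.trans (le_of_lt hz)
  · refine ContinuousOn.intervalIntegrable ?_
    rw [uIcc_of_le ht]
    exact (continuousOn_section hu.continuousOn_halfLineDeriv x).mono hsub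

theorem deriv_fracIntegralDeriv (hu : IsClassicalSolution α f u₀ u₁ u)
    (x : EuclideanSpace ℝ (Fin n)) {t : ℝ} (ht : 0 < t) :
    deriv (fracIntegralDeriv α fun τ => u τ x) t =
      (Δ (u t)) x + f t x + ((t ^ (1 - α) / Real.Gamma (2 - α) : ℝ) : ℂ) * u₁ x := by
  have h := hu.equation t ht x
  rw [caputoDeriv, hu.initial_one] at h
  linear_combination h

/-- The integrated equation starts at ε > 0 because the equation and the regularity of the
fractional integral are assumed only for t > 0. -/
theorem sub_fracIntegralDeriv (hu : IsClassicalSolution α f u₀ u₁ u)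
    (x : EuclideanSpace ℝ (Fin n)) {ε t : ℝ} (hε : 0 < ε) (ht : ε ≤ t) :
    ∫ τ in ε..t, ((Δ (u τ)) x + f τ x + ((τ ^ (1 - α) / Real.Gamma (2 - α) : ℝ) : ℂ) * u₁ x) =
      fracIntegralDeriv α (fun τ => u τ x) t - fracIntegralDeriv α (fun τ => u τ x) ε := by
  have hc := hu.contDiffOn_fracIntegral x
  have hsub : uIcc ε t ⊆ Ioi 0 := by
    rw [uIcc_of_le ht]
    exact fun z hz => hε.trans_le hz.1
  rw [← intervalIntegral.integral_deriv_eq_sub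
    (fun τ hτ => ((hc.differentiableOn one_ne_zero).differentiableAt
      (isOpen_Ioi.mem_nhds (hsub hτ))))
    ((hc.continuousOn_deriv_of_isOpen isOpen_Ioi le_rfl).mono hsub).intervalIntegrable]
  refine intervalIntegral.integral_congr fun τ hτ => ?_
  exact (hu.deriv_fracIntegralDeriv x (hsub hτ)).symm

theorem integral_fracIntegralDeriv_mul (hu : IsClassicalSolution α f u₀ u₁ u) (hα₂ : α < 2)
    {ψ : EuclideanSpace ℝ (Fin n) → ℂ} (hψ : Continuous ψ) (hc : HasCompactSupport ψ) {t : ℝ}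
    (ht : 0 ≤ t) :
    Integrable (fun x => fracIntegralDeriv α (fun τ => u τ x) t * ψ x) ∧
    ∫ x, fracIntegralDeriv α (fun τ => u τ x) t * ψ x =
      rlIntegral (2 - α) (fun τ => ∫ x, halfLineDeriv (fun τ => u τ x) τ * ψ x) t := by
  simp_rw [fracIntegralDeriv_eq_rlIntegral, rlIntegral]
  refine integral_intervalIntegral_mul_swap ht
    (k := fun τ => (((t - τ) ^ (2 - α - 1) / Real.Gamma (2 - α) : ℝ) : ℂ))
    ⟨(intervalIntegrable_rlKernel (by linarith) t).1.ofReal,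
      (intervalIntegrable_rlKernel (by linarith) t).2.ofReal⟩
    (hu.continuousOn_halfLineDeriv.mono (prod_mono_left Icc_subset_Ici_self)) hψ hc

/-- No growth bound on Δu is available, so the equation is tested only against compactly supported
functions; Green's formula then moves Δ onto ψ, after which bounds on u alone will suffice. -/
theorem sub_rlIntegral_integral_halfLineDeriv_mul {φ : ℝ → ℂ} {F : EuclideanSpace ℝ (Fin n) → ℂ}
    (hu : IsClassicalSolution α (fun t x => φ t * F x) u₀ u₁ u) (hα₂ : α < 2)
    (hφ : ContinuousOn φ (Ici 0)) (hF : Continuous F) (hu₁ : Continuous u₁)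
    {ψ : EuclideanSpace ℝ (Fin n) → ℂ} (hψ : ContDiff ℝ 2 ψ) (hc : HasCompactSupport ψ) {ε t : ℝ}
    (hε : 0 < ε) (hεt : ε ≤ t) :
    rlIntegral (2 - α) (fun τ => ∫ x, halfLineDeriv (fun τ => u τ x) τ * ψ x) t -
      rlIntegral (2 - α) (fun τ => ∫ x, halfLineDeriv (fun τ => u τ x) τ * ψ x) ε =
    ∫ τ in ε..t, ((∫ x, u τ x * (Δ ψ) x) + φ τ * (∫ x, F x * ψ x) +
      ((τ ^ (1 - α) / Real.Gamma (2 - α) : ℝ) : ℂ) * ∫ x, u₁ x * ψ x) := by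
  have hψc := hψ.continuous
  have hj := fun t ht => hu.integral_fracIntegralDeriv_mul hα₂ hψc hc (t := t) ht
  have hIoi : Icc ε t ⊆ Ioi 0 := fun z hz => hε.trans_le hz.1
  rw [← (hj t (hε.le.trans hεt)).2, ← (hj ε hε.le).2,
    ← integral_sub (hj t (hε.le.trans hεt)).1 (hj ε hε.le).1]
  simp_rw [← sub_mul, ← hu.sub_fracIntegralDeriv _ hε hεt]
  have hGc : ContinuousOn (Function.uncurry fun τ x => (Δ (u τ)) x + φ τ * F x +
      ((τ ^ (1 - α) / Real.Gamma (2 - α) : ℝ) : ℂ) * u₁ x) (Icc ε t ×ˢ univ) := by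
    have c1 : ContinuousOn (fun p : ℝ × EuclideanSpace ℝ (Fin n) => φ p.1) (Icc ε t ×ˢ univ) :=
      hφ.comp continuousOn_fst fun p hp => mem_Ici.2 (le_of_lt (hIoi hp.1))
    have c2 : ContinuousOn (fun p : ℝ × EuclideanSpace ℝ (Fin n) =>
        ((p.1 ^ (1 - α) / Real.Gamma (2 - α) : ℝ) : ℂ)) (Icc ε t ×ˢ univ) := by
      refine Complex.continuous_ofReal.comp_continuousOn (ContinuousOn.div_const ?_ _)
      exact continuousOn_fst.rpow_const fun p hp => Or.inl (hIoi hp.1).ne'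
    exact ((hu.continuousOn_laplacian.mono (prod_mono_left hIoi)).add
      (c1.mul (hF.comp continuous_snd).continuousOn)).add
      (c2.mul (hu₁.comp continuous_snd).continuousOn)
  have hsw := (integral_intervalIntegral_mul_swap hεt (k := fun _ => 1)
    intervalIntegrable_const hGc hψc hc).2
  simp only [one_mul] at hsw
  rw [hsw]
  refine intervalIntegral.integral_congr fun τ hτ => ?_
  rw [uIcc_of_le hεt] at hτ
  have hτ0 : 0 < τ := hIoi hτ
  have h2 := hu.contDiff_two τ hτ0
  rw [← integral_laplacian_mul_eq h2 hψ hc]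
  exact integral_add_add_mul (continuous_laplacian h2) hF hu₁ hψc hc _ _

/-- The equation tested against a compactly supported function, as a Volterra equation. -/
theorem integral_mul_eq_rlIntegral {φ : ℝ → ℂ} {F : EuclideanSpace ℝ (Fin n) → ℂ}
    (hu : IsClassicalSolution α (fun t x => φ t * F x) u₀ u₁ u) (hα₁ : 1 < α) (hα₂ : α < 2)
    (hφ : ContinuousOn φ (Ici 0)) (hF : Continuous F) (hu₁ : Continuous u₁)
    {ψ : EuclideanSpace ℝ (Fin n) → ℂ} (hψ : ContDiff ℝ 2 ψ) (hc : HasCompactSupport ψ) {t : ℝ}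
    (ht : 0 ≤ t) :
    ∫ x, u t x * ψ x = (∫ x, u₀ x * ψ x) + t * (∫ x, u₁ x * ψ x) +
      rlIntegral α (fun τ => (∫ x, u τ x * (Δ ψ) x) + φ τ * ∫ x, F x * ψ x) t := by
  set b : ℂ := ∫ x, u₁ x * ψ x with hb
  set dm : ℝ → ℂ := fun τ => ∫ x, halfLineDeriv (fun τ => u τ x) τ * ψ x with hdm
  set h : ℝ → ℂ := fun τ => (∫ x, u τ x * (Δ ψ) x) + φ τ * ∫ x, F x * ψ x with hh
  have hG : 0 < Real.Gamma (2 - α) := Real.Gamma_pos_of_pos (by linarith)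
  have hψc := hψ.continuous
  have hdmc : ContinuousOn dm (Ici 0) :=
    continuousOn_integral_mul hu.continuousOn_halfLineDeriv hψc hc
  have hhc : ContinuousOn h (Ici 0) :=
    (continuousOn_integral_mul hu.continuousOn_uncurry (continuous_laplacian hψ)
      (hasCompactSupport_laplacian hc)).add (hφ.mul continuousOn_const)
  have hI : ∀ t, Icc 0 t ⊆ Ici (0 : ℝ) := fun t => Icc_subset_Ici_self
  have hmul : ∀ {g : EuclideanSpace ℝ (Fin n) → ℂ}, Continuous g →
      Integrable fun x => g x * ψ x := fun hg =>
    (hg.mul hψc).integrable_of_hasCompactSupport hc.mul_left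
  have hjd : ∀ ε t, 0 < ε → ε ≤ t → rlIntegral (2 - α) dm t - rlIntegral (2 - α) dm ε =
      ∫ τ in ε..t, (h τ + ((τ ^ (1 - α) / Real.Gamma (2 - α) : ℝ) : ℂ) * b) := fun ε t hε hεt =>
    hu.sub_rlIntegral_integral_halfLineDeriv_mul hα₂ hφ hF hu₁ hψ hc hε hεt
  have hκi : ∀ t, IntervalIntegrable
      (fun τ : ℝ => ((τ ^ (1 - α) / Real.Gamma (2 - α) : ℝ) : ℂ) * b) volume 0 t := by
    intro t
    have := (intervalIntegral.intervalIntegrable_rpow' (a := 0) (b := t)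
      (by linarith : -1 < 1 - α)).div_const (Real.Gamma (2 - α))
    exact IntervalIntegrable.mul_const ⟨this.1.ofReal, this.2.ofReal⟩ b
  have hhi : ∀ t, 0 ≤ t → IntervalIntegrable h volume 0 t := fun t ht => by
    refine ContinuousOn.intervalIntegrable ?_
    rw [uIcc_of_le ht]
    exact hhc.mono (hI t)
  -- Let ε → 0 in the integrated equation: the left term at ε vanishes like ε^{2-α}, and the right
  -- side is integrable at 0 because 1 - α > -1.
  have hj2 : ∀ t, 0 ≤ t → rlIntegral (2 - α) dm t =
      rlIntegral 1 h t + b * ((t ^ (2 - α) / Real.Gamma (2 - α + 1) : ℝ) : ℂ) := by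
    intro t ht
    rcases ht.eq_or_lt with rfl | ht
    · rw [Real.zero_rpow (by linarith)]
      simp [rlIntegral]
    have hi := (hhi t ht.le).add (hκi t)
    have hlim1 : Tendsto (fun ε => rlIntegral (2 - α) dm t - rlIntegral (2 - α) dm ε) (𝓝[>] 0)
        (𝓝 (rlIntegral (2 - α) dm t - 0)) := by
      refine Tendsto.sub tendsto_const_nhds ?_
      obtain ⟨K, hK⟩ := isCompact_Icc.exists_bound_of_continuousOn (hdmc.mono (hI 1))
      refine squeeze_zero_norm' (a := fun ε : ℝ =>
        K * (ε ^ (2 - α + 0) / Real.Gamma (2 - α + 0 + 1))) ?_ ?_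
      · filter_upwards [Ioc_mem_nhdsGT (zero_lt_one' ℝ)] with ε hε
        refine norm_rlIntegral_le (by linarith) le_rfl hε.1.le fun τ hτ => ?_
        simpa using hK τ ⟨hτ.1, hτ.2.trans hε.2⟩
      · have : Continuous fun ε : ℝ => K * (ε ^ (2 - α + 0) / Real.Gamma (2 - α + 0 + 1)) :=
          ((Real.continuous_rpow_const (by linarith)).div_const _).const_mul _
        have := this.tendsto 0
        rw [Real.zero_rpow (by linarith)] at this
        simp only [zero_div, mul_zero] at this
        exact this.mono_left nhdsWithin_le_nhds
    have hlim2 : Tendsto (fun ε => rlIntegral (2 - α) dm t - rlIntegral (2 - α) dm ε) (𝓝[>] 0)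
        (𝓝 ((∫ τ in (0 : ℝ)..t, (h τ + ((τ ^ (1 - α) / Real.Gamma (2 - α) : ℝ) : ℂ) * b)) -
          ∫ τ in (0 : ℝ)..0, (h τ + ((τ ^ (1 - α) / Real.Gamma (2 - α) : ℝ) : ℂ) * b))) := by
      have hp := intervalIntegral.continuousOn_primitive_interval' hi (left_mem_uIcc)
      have hp0 := (hp 0 left_mem_uIcc).tendsto
      have hp1 : Tendsto (fun ε => ∫ τ in (0 : ℝ)..ε,
          (h τ + ((τ ^ (1 - α) / Real.Gamma (2 - α) : ℝ) : ℂ) * b)) (𝓝[>] 0)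
          (𝓝 (∫ τ in (0 : ℝ)..0, (h τ + ((τ ^ (1 - α) / Real.Gamma (2 - α) : ℝ) : ℂ) * b))) := by
        refine hp0.mono_left (nhdsWithin_le_iff.2 ?_)
        rw [uIcc_of_le ht.le]
        exact Icc_mem_nhdsGT ht
      refine (hp1.const_sub _).congr' ?_
      filter_upwards [Ioc_mem_nhdsGT ht] with ε hε
      rw [hjd ε t hε.1 hε.2]
      refine intervalIntegral.integral_interval_sub_left hi ?_
      exact hi.mono_set (by
        rw [uIcc_of_le hε.1.le, uIcc_of_le ht.le]; exact Icc_subset_Icc_right hε.2)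
    have := tendsto_nhds_unique hlim1 hlim2
    rw [sub_zero, intervalIntegral.integral_same, sub_zero,
      intervalIntegral.integral_add (hhi t ht.le) (hκi t)] at this
    rw [this, rlIntegral_one, intervalIntegral.integral_mul_const, intervalIntegral.integral_ofReal,
      intervalIntegral.integral_div, integral_rpow (Or.inl (by linarith)),
      Real.zero_rpow (by linarith), Real.Gamma_add_one (by linarith)]
    have h2α : (2 - α : ℂ) ≠ 0 := by
      rw [← Complex.ofReal_ofNat, ← Complex.ofReal_sub]
      exact_mod_cast (by linarith : (0 : ℝ) < 2 - α).ne'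
    rw [show 1 - α + 1 = 2 - α by ring]
    push_cast
    field_simp
    ring
  -- inversion
  have hm : rlIntegral (α - 1) (rlIntegral (2 - α) dm) t =
      (∫ x, u t x * ψ x) - ∫ x, u₀ x * ψ x := by
    rw [rlIntegral_rlIntegral (by linarith) (by linarith) ht (hdmc.mono (hI t)),
      show α - 1 + (2 - α) = 1 by ring, rlIntegral_one]
    have hsw := (integral_intervalIntegral_mul_swap ht (k := fun _ => 1)
      intervalIntegrable_const (hu.continuousOn_halfLineDeriv.mono (prod_mono_left (hI t))) hψc hc).2
    simp only [one_mul] at hsw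
    rw [hdm, ← hsw]
    simp_rw [hu.integral_halfLineDeriv _ ht, ← hu.initial_zero, sub_mul]
    exact integral_sub (hmul (continuous_slice hu.continuousOn_uncurry ht))
      (hmul (continuous_slice hu.continuousOn_uncurry (mem_Ici.2 le_rfl)))
  -- I^{α-1} is applied to both sides. By the semigroup law I^{α-1}I^{2-α} = I¹ undoes the time
  -- derivative, while the right side becomes I^α h + b t.
  have hm2 : rlIntegral (α - 1) (rlIntegral (2 - α) dm) t = rlIntegral α h t + b * t := by
    rw [rlIntegral_congr ht fun τ hτ => hj2 τ hτ.1,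
      rlIntegral_add (by linarith) ht (f := rlIntegral 1 h)
        (g := fun τ => b * ((τ ^ (2 - α) / Real.Gamma (2 - α + 1) : ℝ) : ℂ)) ?_
        (continuousOn_const.mul (continuousOn_rpow_div (by linarith) _)),
      rlIntegral_rlIntegral (by linarith) one_pos ht (hhc.mono (hI t)),
      rlIntegral_smul_power (by linarith) (by linarith) ht]
    · rw [show α - 1 + 1 = α by ring, show α - 1 + (2 - α) = 1 by ring]
      norm_num
    · have := intervalIntegral.continuousOn_primitive_interval' (hhi t ht) left_mem_uIcc
      rw [uIcc_of_le ht] at this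
      exact this.congr fun τ _ => rlIntegral_one h τ
  rw [hm2] at hm
  linear_combination -hm

end IsClassicalSolution

namespace IsClassicalSolution

variable {n : ℕ} {α : ℝ} {u₀ u₁ : EuclideanSpace ℝ (Fin n) → ℂ}
  {u : ℝ → EuclideanSpace ℝ (Fin n) → ℂ}

/-- The Volterra equation for the heat extension of a bounded solution. -/
theorem heatExt_eq_rlIntegral {φ : ℝ → ℂ} {F : EuclideanSpace ℝ (Fin n) → ℂ}
    (hu : IsClassicalSolution α (fun t x => φ t * F x) u₀ u₁ u) (hα₁ : 1 < α) (hα₂ : α < 2)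
    (hφ : ContinuousOn φ (Ici 0)) (hF : Continuous F) (hu₀ : Continuous u₀) (hu₁ : Continuous u₁)
    {M₀ M₁ M₂ M t : ℝ} (hM₀ : ∀ x, ‖u₀ x‖ ≤ M₀) (hM₁ : ∀ x, ‖u₁ x‖ ≤ M₁) (hM₂ : ∀ x, ‖F x‖ ≤ M₂)
    (ht : 0 ≤ t) (hM : ∀ τ ∈ Icc 0 t, ∀ x, ‖u τ x‖ ≤ M) {ζ : ℂ} (hζ : 0 < ζ.re)
    (y : EuclideanSpace ℝ (Fin n)) :
    heatExt (u t) ζ y = heatExt u₀ ζ y + t * heatExt u₁ ζ y +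
      rlIntegral α (fun τ => deriv (fun ζ => heatExt (u τ) ζ y) ζ + φ τ * heatExt F ζ y) t := by
  -- The tested equation is applied to the truncated kernels ψ k. They and their Laplacians are
  -- dominated by one integrable B, so boundedness of u suffices for every limit.
  obtain ⟨ψ, B, h1, h2, h3, h4, h5, h6, h7⟩ := exists_approx_gaussProfile hζ y
  have hI : Icc 0 t ⊆ Ici (0 : ℝ) := Icc_subset_Ici_self
  have huc : ∀ τ ∈ Icc 0 t, Continuous (u τ) := fun τ hτ =>
    continuous_slice hu.continuousOn_uncurry (hI hτ)
  have lim : ∀ {g : EuclideanSpace ℝ (Fin n) → ℂ} {K : ℝ}, Continuous g → (∀ x, ‖g x‖ ≤ K) →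
      Tendsto (fun k => ∫ x, g x * ψ k x) atTop (𝓝 (heatExt g ζ y)) := fun hg hK =>
    tendsto_integral_mul_of_dominated hg.aestronglyMeasurable hK (fun k => (h1 k).continuous)
      h3 h4 h6
  have lim' : ∀ τ ∈ Icc 0 t, Tendsto (fun k => ∫ x, u τ x * (Δ (ψ k)) x) atTop
      (𝓝 (deriv (fun ζ => heatExt (u τ) ζ y) ζ)) := by
    intro τ hτ
    rw [(hasDerivAt_heatExt (huc τ hτ).aestronglyMeasurable (hM τ hτ) hζ y).deriv]
    exact tendsto_integral_mul_of_dominated (huc τ hτ).aestronglyMeasurable (hM τ hτ)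
      (fun k => continuous_laplacian (h1 k)) h3 h5 h7
  have hB0 : ∀ x, 0 ≤ B x := fun x => (norm_nonneg _).trans (h4 0 x)
  have bd : ∀ {g : EuclideanSpace ℝ (Fin n) → ℂ} {K : ℝ}
      {χ : EuclideanSpace ℝ (Fin n) → ℂ}, (∀ x, ‖g x‖ ≤ K) → (∀ x, ‖χ x‖ ≤ B x) →
      ‖∫ x, g x * χ x‖ ≤ ∫ x, K * B x := by
    intro g K χ hK hχ
    refine norm_integral_le_of_norm_le (h3.const_mul K) (Eventually.of_forall fun x => ?_)
    rw [norm_mul]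
    exact mul_le_mul (hK x) (hχ x) (norm_nonneg _) ((norm_nonneg _).trans (hK x))
  obtain ⟨Kφ, hKφ⟩ := isCompact_Icc.exists_bound_of_continuousOn (hφ.mono hI)
  have hrl : Tendsto (fun k => rlIntegral α
      (fun τ => (∫ x, u τ x * (Δ (ψ k)) x) + φ τ * ∫ x, F x * ψ k x) t) atTop
      (𝓝 (rlIntegral α (fun τ => deriv (fun ζ => heatExt (u τ) ζ y) ζ +
        φ τ * heatExt F ζ y) t)) := by
    refine tendsto_rlIntegral (K := (∫ x, M * B x) + Kφ * ∫ x, M₂ * B x) (by linarith) ht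
      (fun k => ?_) (fun k τ hτ => ?_) fun τ hτ => ?_
    · exact ((continuousOn_integral_mul hu.continuousOn_uncurry (continuous_laplacian (h1 k))
        (hasCompactSupport_laplacian (h2 k))).mono hI).add ((hφ.mono hI).mul continuousOn_const)
    · refine (norm_add_le _ _).trans (add_le_add (bd (hM τ hτ) (h5 k)) ?_)
      rw [norm_mul]
      exact mul_le_mul (hKφ τ hτ) (bd hM₂ (h4 k)) (norm_nonneg _)
        ((norm_nonneg _).trans (hKφ τ hτ))
    · exact (lim' τ hτ).add ((lim hF hM₂).const_mul _)
  have hrhs := ((lim hu₀ hM₀).add ((lim hu₁ hM₁).const_mul (t : ℂ))).add hrl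
  refine tendsto_nhds_unique (lim (huc t ⟨ht, le_rfl⟩) (hM t ⟨ht, le_rfl⟩)) ?_
  refine hrhs.congr fun k => ?_
  exact (hu.integral_mul_eq_rlIntegral hα₁ hα₂ hφ hF hu₁ (h1 k) (h2 k) ht).symm

/-- Time continuity of the `ζ`-derivative of the heat extension. -/
theorem continuousOn_deriv_heatExt {f : ℝ → EuclideanSpace ℝ (Fin n) → ℂ}
    (hu : IsClassicalSolution α f u₀ u₁ u) {M T : ℝ} (hM : ∀ τ ∈ Icc 0 T, ∀ x, ‖u τ x‖ ≤ M)
    {ζ : ℂ} (hζ : 0 < ζ.re) (y : EuclideanSpace ℝ (Fin n)) :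
    ContinuousOn (fun τ => deriv (fun ζ => heatExt (u τ) ζ y) ζ) (Icc 0 T) := by
  have hI : Icc 0 T ⊆ Ici (0 : ℝ) := Icc_subset_Ici_self
  have huc : ∀ τ ∈ Icc 0 T, Continuous (u τ) := fun τ hτ =>
    continuous_slice hu.continuousOn_uncurry (hI hτ)
  have h : ContinuousOn (fun τ => ∫ x, u τ x * gaussProfileDeriv n ζ (‖x - y‖ ^ 2))
      (Icc 0 T) := by
    have hg := (integrable_gaussProfile hζ y).2
    refine continuousOn_of_dominated (bound := fun x => M * ‖gaussProfileDeriv n ζ (‖x - y‖ ^ 2)‖)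
      (fun τ hτ => (huc τ hτ).aestronglyMeasurable.mul hg.1)
      (fun τ hτ => Eventually.of_forall fun x => ?_) (hg.norm.const_mul M)
      (Eventually.of_forall fun x => ?_)
    · rw [norm_mul]
      exact mul_le_mul_of_nonneg_right (hM τ hτ x) (norm_nonneg _)
    · exact ((continuousOn_section hu.continuousOn_uncurry x).mono hI).mul continuousOn_const
  refine h.congr fun τ hτ => ?_
  exact (hasDerivAt_heatExt (huc τ hτ).aestronglyMeasurable (hM τ hτ) hζ y).deriv

end IsClassicalSolution

/-! ### The resolvent of the Laplacian -/

/-- The kernel of the resolvent `(z - Δ)⁻¹`, as the Laplace integral of the heat kernel along the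
ray in the direction `e`. -/
noncomputable def resolventKernel (n : ℕ) (z e : ℂ) (x : EuclideanSpace ℝ (Fin n)) : ℂ :=
  ∫ r in Ioi (0 : ℝ), Complex.exp (-(z * e) * r) * e * gaussProfile n (r * e) (‖x‖ ^ 2)

/-- The resolvent `(z - Δ)⁻¹ h`. -/
noncomputable def resolventExt {n : ℕ} (z e : ℂ) (h : EuclideanSpace ℝ (Fin n) → ℂ)
    (y : EuclideanSpace ℝ (Fin n)) : ℂ :=
  ∫ x, h x * resolventKernel n z e (x - y)

section Resolvent

variable {n : ℕ} {z e : ℂ}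

theorem re_ofReal_mul_pos (he : 0 < e.re) {r : ℝ} (hr : 0 < r) : 0 < ((r : ℂ) * e).re := by
  rw [Complex.re_ofReal_mul]
  positivity

theorem norm_cexp_neg_mul (a : ℂ) (r : ℝ) : ‖Complex.exp (-a * r)‖ = Real.exp (-(a.re) * r) := by
  rw [Complex.norm_exp]
  simp

theorem norm_div_re_smul {r : ℝ} (hr : 0 < r) : ‖(r : ℂ) * e‖ / ((r : ℂ) * e).re = ‖e‖ / e.re := by
  rw [norm_mul, Complex.norm_real, Real.norm_of_nonneg hr.le, Complex.re_ofReal_mul]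
  field_simp

theorem integrableOn_cexp_neg_mul (hz : 0 < (z * e).re) :
    IntegrableOn (fun r : ℝ => Complex.exp (-(z * e) * r) * e) (Ioi 0) := by
  refine Integrable.mul_const ?_ _
  refine Integrable.mono' (exp_neg_integrableOn_Ioi 0 hz) (by fun_prop)
    (Eventually.of_forall fun r => ?_)
  rw [norm_cexp_neg_mul]

/-- On the ray the heat kernel has constant L¹ norm (‖e‖/Re e)^{n/2}, and the exponential decays
since Re(ze) > 0. This makes the resolvent kernel integrable, even when Re z is negative. -/
theorem integrable_prod_resolventKernel (he : 0 < e.re) (hz : 0 < (z * e).re)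
    (y : EuclideanSpace ℝ (Fin n)) :
    Integrable (Function.uncurry fun (r : ℝ) (x : EuclideanSpace ℝ (Fin n)) =>
      Complex.exp (-(z * e) * r) * e * gaussProfile n (r * e) (‖x - y‖ ^ 2))
      ((volume.restrict (Ioi 0)).prod volume) := by
  have hcont : ContinuousOn (Function.uncurry fun (r : ℝ) (x : EuclideanSpace ℝ (Fin n)) =>
      Complex.exp (-(z * e) * r) * e * gaussProfile n (r * e) (‖x - y‖ ^ 2))
      (Ioi 0 ×ˢ univ) := by
    intro p hp
    have hp1 : (0 : ℝ) < p.1 := hp.1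
    have hre := re_ofReal_mul_pos he hp1
    have h0 := ne_zero_of_re_pos hre
    have hs : (4 * Real.pi * (p.1 * e) : ℂ) ∈ Complex.slitPlane := by
      refine Or.inl ?_
      have : (4 * Real.pi * (p.1 * e) : ℂ) = ((4 * Real.pi : ℝ) : ℂ) * (p.1 * e) := by
        push_cast; ring
      rw [this, Complex.re_ofReal_mul]
      have := Real.pi_pos
      positivity
    refine ContinuousAt.continuousWithinAt ?_
    unfold Function.uncurry gaussProfile
    simp only
    refine ContinuousAt.mul (by fun_prop) (ContinuousAt.mul ?_ ?_)
    · exact ContinuousAt.cpow (by fun_prop) continuousAt_const hs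
    · refine Complex.continuous_exp.continuousAt.comp (ContinuousAt.div (by fun_prop) (by fun_prop) ?_)
      exact mul_ne_zero (by norm_num : (4 : ℂ) ≠ 0) h0
  have hm := hcont.aestronglyMeasurable (μ := (volume : Measure ℝ).prod volume)
    (measurableSet_Ioi.prod MeasurableSet.univ)
  rw [← Measure.prod_restrict, Measure.restrict_univ] at hm
  rw [integrable_prod_iff hm]
  constructor
  · filter_upwards [ae_restrict_mem measurableSet_Ioi] with r hr
    exact (integrable_gaussProfile (re_ofReal_mul_pos he hr) y).1.const_mul
      (Complex.exp (-(z * e) * r) * e)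
  · have hi := ((integrableOn_cexp_neg_mul hz).norm.mul_const ((‖e‖ / e.re) ^ (n / 2 : ℝ)))
    refine hi.congr ?_
    filter_upwards [ae_restrict_mem measurableSet_Ioi] with r hr
    simp only [Function.uncurry]
    simp_rw [norm_mul (Complex.exp _ * e)]
    rw [integral_const_mul, integral_norm_gaussProfile (re_ofReal_mul_pos he hr),
      norm_div_re_smul hr]

theorem integrable_resolventKernel (he : 0 < e.re) (hz : 0 < (z * e).re) :
    Integrable (resolventKernel n z e) := by
  have := (integrable_prod_resolventKernel (n := n) he hz 0).integral_prod_right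
  simp only [Function.uncurry, sub_zero] at this
  exact this

theorem resolventKernel_sub_comm (x y : EuclideanSpace ℝ (Fin n)) :
    resolventKernel n z e (x - y) = resolventKernel n z e (y - x) := by
  simp only [resolventKernel, norm_sub_rev x y]

theorem resolventExt_eq_integral_heatExt (he : 0 < e.re) (hz : 0 < (z * e).re)
    {h : EuclideanSpace ℝ (Fin n) → ℂ} {M : ℝ} (hm : AEStronglyMeasurable h)
    (hM : ∀ x, ‖h x‖ ≤ M) (y : EuclideanSpace ℝ (Fin n)) :
    resolventExt z e h y =
      ∫ r in Ioi (0 : ℝ), Complex.exp (-(z * e) * r) * e * heatExt h (r * e) y := by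
  have hi : Integrable (Function.uncurry fun (r : ℝ) (x : EuclideanSpace ℝ (Fin n)) =>
      h x * (Complex.exp (-(z * e) * r) * e * gaussProfile n (r * e) (‖x - y‖ ^ 2)))
      ((volume.restrict (Ioi 0)).prod volume) :=
    (integrable_prod_resolventKernel he hz y).bdd_mul hm.comp_snd
      (Eventually.of_forall fun p => hM p.2)
  have := integral_integral_swap hi
  simp only [resolventExt, resolventKernel, heatExt, ← integral_const_mul]
  rw [← this]
  refine integral_congr_ae (Eventually.of_forall fun r => ?_)
  refine integral_congr_ae (Eventually.of_forall fun x => ?_)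
  simp only
  ring

theorem norm_resolventExt_le (he : 0 < e.re) (hz : 0 < (z * e).re)
    {h : EuclideanSpace ℝ (Fin n) → ℂ} {M : ℝ}
    (hM : ∀ x, ‖h x‖ ≤ M) (y : EuclideanSpace ℝ (Fin n)) :
    ‖resolventExt z e h y‖ ≤ M * ∫ x, ‖resolventKernel n z e x‖ := by
  rw [← integral_sub_right_eq_self (fun x => ‖resolventKernel n z e x‖) y, ← integral_const_mul]
  refine norm_integral_le_of_norm_le
    (((integrable_resolventKernel he hz).comp_sub_right y).norm.const_mul M)
    (Eventually.of_forall fun x => ?_)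
  rw [norm_mul]
  exact mul_le_mul_of_nonneg_right (hM x) (norm_nonneg _)

theorem continuous_resolventExt (he : 0 < e.re) (hz : 0 < (z * e).re)
    {h : EuclideanSpace ℝ (Fin n) → ℂ} {M : ℝ} (hc : Continuous h)
    (hM : ∀ x, ‖h x‖ ≤ M) : Continuous (resolventExt z e h) := by
  have hk := integrable_resolventKernel (n := n) he hz
  have e1 : resolventExt z e h = fun y => ∫ x, h (x + y) * resolventKernel n z e x := by
    funext y
    rw [resolventExt, ← integral_add_right_eq_self _ y]
    simp only [add_sub_cancel_right]
  rw [e1]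
  refine continuous_of_dominated (bound := fun x => M * ‖resolventKernel n z e x‖)
    (fun y => ?_) (fun y => Eventually.of_forall fun x => ?_) (hk.norm.const_mul M)
    (Eventually.of_forall fun x => by fun_prop)
  · exact (by fun_prop : Continuous fun x => h (x + y)).aestronglyMeasurable.mul hk.1
  · rw [norm_mul]
    exact mul_le_mul_of_nonneg_right (hM _) (norm_nonneg _)

theorem integrable_prod_resolventExt (he : 0 < e.re) (hz : 0 < (z * e).re)
    {F : EuclideanSpace ℝ (Fin n) → ℂ} (hF : Integrable F) :
    Integrable (fun p : EuclideanSpace ℝ (Fin n) × EuclideanSpace ℝ (Fin n) =>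
      F p.2 * resolventKernel n z e (p.2 - p.1)) (volume.prod volume) := by
  simp_rw [resolventKernel_sub_comm]
  exact hF.convolution_integrand (ContinuousLinearMap.mul ℝ ℂ) (integrable_resolventKernel he hz)

theorem integrable_resolventExt (he : 0 < e.re) (hz : 0 < (z * e).re)
    {F : EuclideanSpace ℝ (Fin n) → ℂ} (hF : Integrable F) : Integrable (resolventExt z e F) :=
  (integrable_prod_resolventExt he hz hF).integral_prod_left

/-- The kernel is even, so the resolvent is symmetric for the bilinear pairing. -/
theorem integral_resolventExt_mul (he : 0 < e.re) (hz : 0 < (z * e).re)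
    {F h : EuclideanSpace ℝ (Fin n) → ℂ} {M : ℝ} (hF : Integrable F)
    (hm : AEStronglyMeasurable h) (hM : ∀ x, ‖h x‖ ≤ M) :
    ∫ y, resolventExt z e F y * h y = ∫ x, F x * resolventExt z e h x := by
  have hi : Integrable (Function.uncurry fun y x : EuclideanSpace ℝ (Fin n) =>
      h y * (F x * resolventKernel n z e (x - y))) (volume.prod volume) :=
    (integrable_prod_resolventExt he hz hF).bdd_mul hm.comp_fst
      (Eventually.of_forall fun p => hM p.1)
  have := integral_integral_swap hi
  simp only [resolventExt, ← integral_const_mul, ← integral_mul_const]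
  simp only [resolventKernel_sub_comm] at this ⊢
  convert! this using 5 <;> ring

/-- Along the ray, e^{-zer} times the heat extension of ψ has derivative equal to the difference of
the two Laplace integrands. It runs from ψ(y) at r = 0 to 0 at infinity, so the fundamental theorem
of calculus gives the resolvent identity. -/
theorem resolventExt_laplacian (he : 0 < e.re) (hz : 0 < (z * e).re)
    {ψ : EuclideanSpace ℝ (Fin n) → ℂ} {M M' : ℝ} (hψ : ContDiff ℝ 2 ψ)
    (hM : ∀ x, ‖ψ x‖ ≤ M) (hM' : ∀ x, ‖(Δ ψ) x‖ ≤ M') (y : EuclideanSpace ℝ (Fin n)) :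
    resolventExt z e (Δ ψ) y = z * resolventExt z e ψ y - ψ y := by
  have hψm := hψ.continuous.aestronglyMeasurable (μ := volume)
  have hΔm := (continuous_laplacian hψ).aestronglyMeasurable (μ := volume)
  have key : ∀ {h : EuclideanSpace ℝ (Fin n) → ℂ} {K : ℝ}, AEStronglyMeasurable h →
      (∀ x, ‖h x‖ ≤ K) → IntegrableOn
        (fun r : ℝ => Complex.exp (-(z * e) * r) * e * heatExt h (r * e) y) (Ioi 0) := by
    intro h K hm hK
    refine (((integrable_prod_resolventKernel he hz y).bdd_mul hm.comp_snd
      (Eventually.of_forall fun p => hK p.2)).integral_prod_left).congr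
      (Eventually.of_forall fun r => ?_)
    simp only [Function.uncurry, heatExt, ← integral_const_mul]
    refine integral_congr_ae (Eventually.of_forall fun x => ?_)
    simp only
    ring
  rw [resolventExt_eq_integral_heatExt he hz hΔm hM', resolventExt_eq_integral_heatExt he hz hψm hM]
  set G : ℝ → ℂ := fun r => Complex.exp (-(z * e) * r) * heatExt ψ (r * e) y with hG
  have hd : ∀ r ∈ Ioi (0 : ℝ), HasDerivAt G
      (Complex.exp (-(z * e) * r) * e * heatExt (Δ ψ) (r * e) y -
        z * (Complex.exp (-(z * e) * r) * e * heatExt ψ (r * e) y)) r := by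
    intro r hr
    have hre := re_ofReal_mul_pos he hr
    have h1 := hasDerivAt_heatExt hψm hM hre y
    rw [← integral_laplacian_mul_gaussProfile hψ hM hM' hre y] at h1
    have h2 : HasDerivAt (fun r : ℝ => (r : ℂ) * e) e r := by
      simpa using (Complex.ofRealCLM.hasDerivAt (x := r)).mul_const e
    have h3 : HasDerivAt (fun r : ℝ => Complex.exp (-(z * e) * r))
        (Complex.exp (-(z * e) * r) * (-(z * e))) r := by
      have := (Complex.ofRealCLM.hasDerivAt (x := r)).const_mul (-(z * e))
      simpa using this.cexp
    have h4 := HasDerivAt.comp r h1 h2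
    refine (h3.mul h4).congr_deriv ?_
    simp only [Function.comp]
    ring
  have l0 : Tendsto G (𝓝[>] 0) (𝓝 (ψ y)) := by
    have h1 := tendsto_heatExt hψ.continuous hM he y
    have h2 : Tendsto (fun r : ℝ => Complex.exp (-(z * e) * r)) (𝓝[>] 0) (𝓝 1) := by
      have : Continuous fun r : ℝ => Complex.exp (-(z * e) * r) := by fun_prop
      have := this.tendsto 0
      simp only [Complex.ofReal_zero, mul_zero, Complex.exp_zero] at this
      exact this.mono_left nhdsWithin_le_nhds
    simpa only [one_mul] using h2.mul h1
  have l1 : Tendsto G atTop (𝓝 0) := by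
    have h1 : Tendsto (fun r : ℝ => Real.exp (-((z * e).re) * r) * (M * (‖e‖ / e.re) ^ (n / 2 : ℝ)))
        atTop (𝓝 0) := by
      have : Tendsto (fun r : ℝ => -((z * e).re) * r) atTop atBot :=
        tendsto_id.const_mul_atTop_of_neg (by linarith)
      simpa using (Real.tendsto_exp_atBot.comp this).mul_const (M * (‖e‖ / e.re) ^ (n / 2 : ℝ))
    refine squeeze_zero_norm' ?_ h1
    filter_upwards [eventually_gt_atTop 0] with r hr
    rw [hG]
    simp only
    rw [norm_mul, norm_cexp_neg_mul, ← norm_div_re_smul (e := e) hr]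
    exact mul_le_mul_of_nonneg_left (norm_heatExt_le hM (re_ofReal_mul_pos he hr) y)
      (Real.exp_pos _).le
  have hint := (key hΔm hM').sub ((key hψm hM).const_mul z)
  -- The heat extension at time 0 does not return the initial value, so G is redefined at 0 by its
  -- limit ψ(y).
  have hu : ∀ r ∈ Ioi (0 : ℝ), Function.update G 0 (ψ y) =ᶠ[𝓝 r] G := by
    intro r hr
    filter_upwards [isOpen_Ioi.mem_nhds hr] with s hs
    exact Function.update_of_ne (ne_of_gt hs) _ _
  have hI := integral_Ioi_of_hasDerivAt_of_tendsto (f := Function.update G 0 (ψ y)) (a := 0)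
    (by
      rw [continuousWithinAt_update_same]
      exact l0.mono_left (nhdsWithin_mono _ fun r hr => lt_of_le_of_ne hr.1 (Ne.symm hr.2)))
    (fun r hr => (hd r hr).congr_of_eventuallyEq (hu r hr)) hint
    (l1.congr' (by
      filter_upwards [eventually_gt_atTop 0] with r hr
      exact ((hu r hr).eq_of_nhds).symm))
  rw [Function.update_self, integral_sub (key hΔm hM') ((key hψm hM).const_mul z),
    integral_const_mul] at hI
  linear_combination hI

/-- The equation for the resolvent, tested against a bounded function with bounded Laplacian. -/
theorem integral_resolventExt_mul_laplacian (he : 0 < e.re) (hz : 0 < (z * e).re)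
    {F ψ : EuclideanSpace ℝ (Fin n) → ℂ} {M M' : ℝ} (hF : Integrable F) (hψ : ContDiff ℝ 2 ψ)
    (hM : ∀ x, ‖ψ x‖ ≤ M) (hM' : ∀ x, ‖(Δ ψ) x‖ ≤ M') :
    ∫ y, resolventExt z e F y * (Δ ψ) y =
      z * (∫ y, resolventExt z e F y * ψ y) - ∫ x, F x * ψ x := by
  have hψm := hψ.continuous.aestronglyMeasurable (μ := volume)
  have hψr := continuous_resolventExt (z := z) he hz hψ.continuous hM
  rw [integral_resolventExt_mul he hz hF (continuous_laplacian hψ).aestronglyMeasurable hM',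
    integral_resolventExt_mul he hz hF hψm hM, ← integral_const_mul, ← integral_sub]
  · refine integral_congr_ae (Eventually.of_forall fun x => ?_)
    simp only [resolventExt_laplacian he hz hψ hM hM']
    ring
  · exact (hF.mul_bdd hψr.aestronglyMeasurable
      (Eventually.of_forall (norm_resolventExt_le he hz hM))).const_mul z
  · exact hF.mul_bdd hψm (Eventually.of_forall hM)

/-- The weak equation Δv = zv - F, tested with the heat kernel. Pairing with truncated kernels
avoids any pointwise second derivative of v, so continuity of F is enough. -/
theorem deriv_heatExt_resolventExt (he : 0 < e.re) (hz : 0 < (z * e).re)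
    {F : EuclideanSpace ℝ (Fin n) → ℂ} {M : ℝ} (hF : Integrable F) (hc : Continuous F)
    (hM : ∀ x, ‖F x‖ ≤ M) {ζ : ℂ} (hζ : 0 < ζ.re) (y : EuclideanSpace ℝ (Fin n)) :
    deriv (fun ζ => heatExt (resolventExt z e F) ζ y) ζ =
      z * heatExt (resolventExt z e F) ζ y - heatExt F ζ y := by
  have hv := continuous_resolventExt (z := z) he hz hc hM
  have hvM := norm_resolventExt_le (z := z) he hz hM
  rw [(hasDerivAt_heatExt hv.aestronglyMeasurable hvM hζ y).deriv]
  obtain ⟨ψ, B, h1, h2, h3, h4, h5, h6, h7⟩ := exists_approx_gaussProfile hζ y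
  have l1 := tendsto_integral_mul_of_dominated hv.aestronglyMeasurable hvM
    (fun k => continuous_laplacian (h1 k)) h3 h5 h7
  have l2 := tendsto_integral_mul_of_dominated hv.aestronglyMeasurable hvM
    (fun k => (h1 k).continuous) h3 h4 h6
  have l3 := tendsto_integral_mul_of_dominated hc.aestronglyMeasurable hM
    (fun k => (h1 k).continuous) h3 h4 h6
  refine tendsto_nhds_unique l1 (((l2.const_mul z).sub l3).congr fun k => ?_)
  obtain ⟨K, hK⟩ := (h2 k).exists_bound_of_continuous (h1 k).continuous
  obtain ⟨K', hK'⟩ := (hasCompactSupport_laplacian (h2 k)).exists_bound_of_continuous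
    (continuous_laplacian (h1 k))
  exact (integral_resolventExt_mul_laplacian he hz hF (h1 k) hK hK').symm

end Resolvent

/-! ### Sobolev regularity -/

theorem MeasureTheory.Integrable.memLp_two_of_bounded {X : Type*} [MeasurableSpace X]
    {μ : Measure X} {f : X → ℂ} {M : ℝ} (hf : Integrable f μ) (hM : ∀ x, ‖f x‖ ≤ M) :
    MemLp f 2 μ := by
  rw [memLp_two_iff_integrable_sq_norm hf.1]
  simp_rw [pow_two]
  exact hf.norm.bdd_mul (c := M) hf.1.norm (Eventually.of_forall fun x => by simpa using hM x)

/-- The weight is 1 + |ξ|² in a Fourier normalisation where Δ has symbol -(2π)²|ξ|², hence the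
factor (2π)^{-2}. -/
theorem besselPotential_two_eq {n : ℕ} (f : 𝓢'(EuclideanSpace ℝ (Fin n), ℂ)) :
    TemperedDistribution.besselPotential _ _ 2 f =
      f - (((2 * Real.pi) ^ 2)⁻¹ : ℂ) • Δ f := by
  have h1 : (fun x : EuclideanSpace ℝ (Fin n) => (((1 + ‖x‖ ^ 2) ^ ((2 : ℝ) / 2) : ℝ) : ℂ)) =
      (fun _ => (1 : ℂ)) + fun x => Complex.ofReal (‖x‖ ^ 2) := by
    ext x
    simp
  rw [TemperedDistribution.laplacian_eq_fourierMultiplierCLM, TemperedDistribution.besselPotential,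
    h1, TemperedDistribution.fourierMultiplierCLM_apply,
    TemperedDistribution.smulLeftCLM_add (by fun_prop) (by fun_prop), add_apply,
    FourierTransform.fourierInv_add,
    ← TemperedDistribution.fourierMultiplierCLM_apply,
    ← TemperedDistribution.fourierMultiplierCLM_apply,
    TemperedDistribution.fourierMultiplierCLM_const]
  have hpi : (Real.pi : ℂ) ≠ 0 := by exact_mod_cast Real.pi_ne_zero
  have h2 : (((2 * Real.pi) ^ 2)⁻¹ : ℂ) * ((-(2 * Real.pi) ^ 2 : ℝ) : ℂ) = -1 := by
    push_cast
    field_simp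
  rw [← Complex.coe_smul, smul_smul, h2, neg_one_smul, sub_neg_eq_add, one_smul]
  rfl

theorem laplacian_toLp_of_integral_eq {n : ℕ} {v F : EuclideanSpace ℝ (Fin n) → ℂ} {z : ℂ}
    (hv : MemLp v 2) (hF : MemLp F 2)
    (h : ∀ ψ : 𝓢(EuclideanSpace ℝ (Fin n), ℂ),
      ∫ x, v x * (Δ (ψ : EuclideanSpace ℝ (Fin n) → ℂ)) x = z * (∫ x, v x * ψ x) - ∫ x, F x * ψ x) :
    Δ ((hv.toLp v : Lp ℂ 2 (volume : Measure (EuclideanSpace ℝ (Fin n)))) :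
          𝓢'(EuclideanSpace ℝ (Fin n), ℂ))
        - z • ((hv.toLp v : Lp ℂ 2 (volume : Measure (EuclideanSpace ℝ (Fin n)))) :
            𝓢'(EuclideanSpace ℝ (Fin n), ℂ))
        = -((hF.toLp F : Lp ℂ 2 (volume : Measure (EuclideanSpace ℝ (Fin n)))) :
          𝓢'(EuclideanSpace ℝ (Fin n), ℂ)) := by
  have key : ∀ {g : EuclideanSpace ℝ (Fin n) → ℂ} (hg : MemLp g 2)
      (ψ : 𝓢(EuclideanSpace ℝ (Fin n), ℂ)),
      ((hg.toLp g : Lp ℂ 2 (volume : Measure (EuclideanSpace ℝ (Fin n)))) :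
          𝓢'(EuclideanSpace ℝ (Fin n), ℂ)) ψ = ∫ x, g x * ψ x := by
    intro g hg ψ
    rw [Lp.toTemperedDistribution_apply]
    refine integral_congr_ae ?_
    filter_upwards [hg.coeFn_toLp] with x hx
    rw [hx, smul_eq_mul, mul_comm]
  ext ψ
  have h2 := h ψ
  have h3 := key hv (Δ ψ)
  simp only [SchwartzMap.laplacian_apply] at h3
  rw [← h3] at h2
  rw [← key hv ψ, ← key hF ψ] at h2
  simp only [sub_apply, smul_apply, neg_apply, TemperedDistribution.laplacian_apply_apply]
  rw [h2, smul_eq_mul]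
  ring

/-- The equation exhibits Δv as zv - F, which is in L²; the Bessel potential of v is then in L² as
well. -/
theorem memSobolev_two_of_laplacian_eq {n : ℕ} {v F : Lp ℂ 2 (volume : Measure (EuclideanSpace ℝ (Fin n)))}
    {z : ℂ} (h : Δ (v : 𝓢'(EuclideanSpace ℝ (Fin n), ℂ)) - z • (v : 𝓢'(EuclideanSpace ℝ (Fin n), ℂ))
      = -(F : 𝓢'(EuclideanSpace ℝ (Fin n), ℂ))) :
    TemperedDistribution.MemSobolev 2 2 (v : 𝓢'(EuclideanSpace ℝ (Fin n), ℂ)) := by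
  refine ⟨v - (((2 * Real.pi) ^ 2)⁻¹ : ℂ) • (z • v - F), ?_⟩
  rw [besselPotential_two_eq, ← Lp.toTemperedDistributionCLM_apply, ← Lp.toTemperedDistributionCLM_apply]
  simp only [map_sub, map_smul, Lp.toTemperedDistributionCLM_apply]
  rw [sub_eq_iff_eq_add.1 h, neg_add_eq_sub]

theorem exists_memSobolev_resolventExt {n : ℕ} {z e : ℂ} (he : 0 < e.re) (hz : 0 < (z * e).re)
    {F : EuclideanSpace ℝ (Fin n) → ℂ} {M : ℝ} (hF : Integrable F)
    (hM : ∀ x, ‖F x‖ ≤ M) :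
    ∃ (hF₂ : MemLp F 2) (hv : MemLp (resolventExt z e F) 2),
      TemperedDistribution.MemSobolev 2 2
        ((hv.toLp _ : Lp ℂ 2 (volume : Measure (EuclideanSpace ℝ (Fin n)))) :
          𝓢'(EuclideanSpace ℝ (Fin n), ℂ)) ∧
      Δ ((hv.toLp _ : Lp ℂ 2 (volume : Measure (EuclideanSpace ℝ (Fin n)))) :
          𝓢'(EuclideanSpace ℝ (Fin n), ℂ))
        - z • ((hv.toLp _ : Lp ℂ 2 (volume : Measure (EuclideanSpace ℝ (Fin n)))) :
            𝓢'(EuclideanSpace ℝ (Fin n), ℂ))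
        = -((hF₂.toLp F : Lp ℂ 2 (volume : Measure (EuclideanSpace ℝ (Fin n)))) :
          𝓢'(EuclideanSpace ℝ (Fin n), ℂ)) := by
  have hF₂ := hF.memLp_two_of_bounded hM
  have hv := (integrable_resolventExt (z := z) he hz hF).memLp_two_of_bounded
    (norm_resolventExt_le he hz hM)
  have hΔ := laplacian_toLp_of_integral_eq hv hF₂ (z := z) fun ψ => by
    obtain ⟨K, hK⟩ : ∃ K, ∀ x, ‖ψ x‖ ≤ K := ⟨_, SchwartzMap.norm_le_seminorm ℝ ψ⟩
    obtain ⟨K', hK'⟩ : ∃ K, ∀ x, ‖(Δ ψ) x‖ ≤ K := ⟨_, SchwartzMap.norm_le_seminorm ℝ (Δ ψ)⟩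
    exact integral_resolventExt_mul_laplacian he hz hF (ψ.smooth 2) hK
      fun x => by simpa only [SchwartzMap.laplacian_apply] using hK' x
  exact ⟨hF₂, hv, memSobolev_two_of_laplacian_eq hΔ, hΔ⟩

/-! ### Comparison of a solution with the oscillation -/

theorem exists_rotation_iomegaPow {α ω : ℝ} (hα₁ : 1 < α) (hα₂ : α < 2) (hω : 0 < ω) :
    ∃ e : ℂ, 0 < e.re ∧ 0 < (iomegaPow α ω * e).re := by
  have hpi := Real.pi_pos
  have hcos : 0 < Real.cos (Real.pi * α / 4) :=
    Real.cos_pos_of_mem_Ioo ⟨by nlinarith, by nlinarith⟩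
  -- The rotation by -πα/4 splits arg z = πα/2 evenly: both e and ze have argument of modulus πα/4 <
  -- π/2.
  refine ⟨Complex.exp ((-(Real.pi * α / 4) : ℝ) * Complex.I), ?_, ?_⟩
  · rw [Complex.exp_ofReal_mul_I_re, Real.cos_neg]
    exact hcos
  · have h : iomegaPow α ω * Complex.exp ((-(Real.pi * α / 4) : ℝ) * Complex.I) =
        ((ω ^ α : ℝ) : ℂ) * Complex.exp ((Real.pi * α / 4 : ℝ) * Complex.I) := by
      rw [iomegaPow, Complex.cpow_def_of_ne_zero Complex.I_ne_zero, Complex.log_I, mul_right_comm,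
        ← Complex.exp_add, mul_comm]
      congr 2
      push_cast
      ring
    rw [h, Complex.re_ofReal_mul, Complex.exp_ofReal_mul_I_re]
    exact mul_pos (Real.rpow_pos_of_pos hω α) hcos

theorem LocallyHolderContinuous.continuous {X Y : Type*} [PseudoEMetricSpace X]
    [PseudoEMetricSpace Y] {F : X → Y} (hF : LocallyHolderContinuous F) : Continuous F := by
  refine continuous_iff_continuousAt.2 fun x => ?_
  obtain ⟨s, hs, C, δ, hδ, h⟩ := hF x
  exact (h.continuousOn hδ).continuousAt hs

theorem heatExt_sub {n : ℕ} {g h : EuclideanSpace ℝ (Fin n) → ℂ} {M K : ℝ} (hg : Continuous g)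
    (hh : Continuous h) (hM : ∀ x, ‖g x‖ ≤ M) (hK : ∀ x, ‖h x‖ ≤ K) {ζ : ℂ} (hζ : 0 < ζ.re)
    (y : EuclideanSpace ℝ (Fin n)) :
    heatExt (fun x => g x - h x) ζ y = heatExt g ζ y - heatExt h ζ y := by
  simp only [heatExt, sub_mul]
  exact integral_sub (integrable_mul_gaussProfile hg.aestronglyMeasurable hM hζ y).1
    (integrable_mul_gaussProfile hh.aestronglyMeasurable hK hζ y).1

/-- On this disc Re ζ > s/2 and ‖ζ‖ < 3s/2, so heat extensions of bounded functions are uniformly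
bounded there, as the Volterra iteration requires. -/
theorem re_pos_and_norm_div_re_le_of_mem_ball {s : ℝ} (hs : 0 < s) {ζ : ℂ}
    (hζ : ζ ∈ Metric.ball (s : ℂ) (s / 2)) : 0 < ζ.re ∧ ‖ζ‖ / ζ.re ≤ 3 := by
  rw [Metric.mem_ball, dist_eq_norm] at hζ
  have h1 := (Complex.abs_re_le_norm (ζ - s)).trans hζ.le
  rw [Complex.sub_re, Complex.ofReal_re] at h1
  have h2 := (abs_le.1 h1).1
  have h3 := norm_sub_norm_le ζ s
  rw [Complex.norm_real, Real.norm_of_nonneg hs.le] at h3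
  have h4 : 0 < ζ.re := by linarith
  refine ⟨h4, ?_⟩
  rw [div_le_iff₀ h4]
  linarith

namespace IsClassicalSolution

variable {n : ℕ} {α ω : ℝ} {u₀ u₁ F : EuclideanSpace ℝ (Fin n) → ℂ}
  {u : ℝ → EuclideanSpace ℝ (Fin n) → ℂ}

/-- Two relations cancel the source: ∂/∂ζ of the heat extension of v is z times that extension minus
the extension of F, and φ - z I^α φ = 1. The remaining 1 turns the initial value into u⁰ - v, and
the initial velocity stays u¹. -/
theorem heatExt_sub_eq_rlIntegral
    (hu : IsClassicalSolution α (fun t x => mlOscillation α ω t * F x) u₀ u₁ u)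
    (hα₁ : 1 < α) (hα₂ : α < 2) (hF : Continuous F) (hFi : Integrable F) (hu₀ : Continuous u₀)
    (hu₁ : Continuous u₁) {M₀ M₁ M₂ M t : ℝ} (hM₀ : ∀ x, ‖u₀ x‖ ≤ M₀) (hM₁ : ∀ x, ‖u₁ x‖ ≤ M₁)
    (hM₂ : ∀ x, ‖F x‖ ≤ M₂) (ht : 0 ≤ t) (hM : ∀ τ ∈ Icc 0 t, ∀ x, ‖u τ x‖ ≤ M)
    {e : ℂ} (he : 0 < e.re) (hz : 0 < (iomegaPow α ω * e).re) {ζ : ℂ} (hζ : 0 < ζ.re)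
    (y : EuclideanSpace ℝ (Fin n)) :
    heatExt (u t) ζ y - mlOscillation α ω t * heatExt (resolventExt (iomegaPow α ω) e F) ζ y =
      heatExt (fun x => u₀ x - resolventExt (iomegaPow α ω) e F x) ζ y + t * heatExt u₁ ζ y +
      rlIntegral α (fun τ => deriv (fun ζ => heatExt (u τ) ζ y -
        mlOscillation α ω τ * heatExt (resolventExt (iomegaPow α ω) e F) ζ y) ζ) t := by
  set z := iomegaPow α ω with hzdef
  have hα0 : 0 < α := by linarith
  have hv := continuous_resolventExt (z := z) he hz hF hM₂
  have hvM := norm_resolventExt_le (z := z) he hz hM₂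
  have hφ := continuousOn_mlOscillation (ω := ω) hα₁ (Icc 0 t)
  have hD := hu.continuousOn_deriv_heatExt hM hζ y
  have h1 := hu.heatExt_eq_rlIntegral hα₁ hα₂ (continuousOn_mlOscillation hα₁ _) hF hu₀ hu₁
    hM₀ hM₁ hM₂ ht hM hζ y
  have h2 := mlOscillation_volterra (ω := ω) hα₁ ht
  have h3 : rlIntegral α (fun τ => deriv (fun ζ => heatExt (u τ) ζ y -
      mlOscillation α ω τ * heatExt (resolventExt z e F) ζ y) ζ) t =
      rlIntegral α (fun τ => (deriv (fun ζ => heatExt (u τ) ζ y) ζ +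
        mlOscillation α ω τ * heatExt F ζ y) -
        (z * heatExt (resolventExt z e F) ζ y) * mlOscillation α ω τ) t := by
    refine rlIntegral_congr ht fun τ hτ => ?_
    have huc : Continuous (u τ) := continuous_slice hu.continuousOn_uncurry hτ.1
    have d1 := hasDerivAt_heatExt huc.aestronglyMeasurable (hM τ hτ) hζ y
    have d2 := hasDerivAt_heatExt hv.aestronglyMeasurable hvM hζ y
    have d3 := deriv_heatExt_resolventExt he hz hFi hF hM₂ hζ y
    refine (d1.sub (d2.const_mul (mlOscillation α ω τ))).deriv.trans ?_
    rw [d1.deriv, ← d2.deriv, d3]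
    ring
  rw [h3, rlIntegral_sub hα0 ht
      (f := fun τ => deriv (fun ζ => heatExt (u τ) ζ y) ζ + mlOscillation α ω τ * heatExt F ζ y)
      (g := fun τ => z * heatExt (resolventExt z e F) ζ y * mlOscillation α ω τ)
      (hD.add (hφ.mul continuousOn_const)) (continuousOn_const.mul hφ),
    rlIntegral_const_mul, heatExt_sub hu₀ hv hM₀ hvM hζ, h1]
  rw [← hzdef] at h2
  linear_combination -(heatExt (resolventExt z e F) ζ y) * h2

/-- The abstract iteration is applied on the disc of radius s/2 about s; the bound needed there
comes from boundedness of u on [0, t] and of v. -/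
theorem tendsto_sum_heatExt
    (hu : IsClassicalSolution α (fun t x => mlOscillation α ω t * F x) u₀ u₁ u)
    (hα₁ : 1 < α) (hα₂ : α < 2) (hF : Continuous F) (hFi : Integrable F) (hu₀ : Continuous u₀)
    (hu₁ : Continuous u₁) {M₀ M₁ M₂ M t : ℝ} (hM₀ : ∀ x, ‖u₀ x‖ ≤ M₀) (hM₁ : ∀ x, ‖u₁ x‖ ≤ M₁)
    (hM₂ : ∀ x, ‖F x‖ ≤ M₂) (ht : 0 ≤ t) (hM : ∀ τ ∈ Icc 0 t, ∀ x, ‖u τ x‖ ≤ M)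
    {e : ℂ} (he : 0 < e.re) (hz : 0 < (iomegaPow α ω * e).re) {s : ℝ} (hs : 0 < s)
    (y : EuclideanSpace ℝ (Fin n)) :
    Tendsto (fun N : ℕ => ∑ k ∈ Finset.range N,
      (((t ^ (α * k + 1 - 1) / Real.Gamma (α * k + 1) : ℝ) : ℂ) *
          deriv^[k] (fun ζ => heatExt (fun x => u₀ x - resolventExt (iomegaPow α ω) e F x) ζ y) s +
        ((t ^ (α * k + 2 - 1) / Real.Gamma (α * k + 2) : ℝ) : ℂ) *
          deriv^[k] (fun ζ => heatExt u₁ ζ y) s)) atTop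
      (𝓝 (heatExt (u t) s y -
        mlOscillation α ω t * heatExt (resolventExt (iomegaPow α ω) e F) s y)) := by
  have hv := continuous_resolventExt (z := iomegaPow α ω) he hz hF hM₂
  have hvM := norm_resolventExt_le (z := iomegaPow α ω) he hz hM₂
  have hφ := continuousOn_mlOscillation (ω := ω) hα₁ (Icc 0 t)
  obtain ⟨Φ, hΦ⟩ := isCompact_Icc.exists_bound_of_continuousOn hφ
  have huc : ∀ τ ∈ Icc 0 t, Continuous (u τ) := fun τ hτ =>
    continuous_slice hu.continuousOn_uncurry hτ.1
  have hd : ∀ {g : EuclideanSpace ℝ (Fin n) → ℂ} {K : ℝ}, Continuous g → (∀ x, ‖g x‖ ≤ K) →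
      ∀ ζ ∈ Metric.ball (s : ℂ) (s / 2), DifferentiableAt ℂ (fun ζ => heatExt g ζ y) ζ :=
    fun hg hK ζ hζ => (hasDerivAt_heatExt hg.aestronglyMeasurable hK
      (re_pos_and_norm_div_re_le_of_mem_ball hs hζ).1 y).differentiableAt
  have hb : ∀ {g : EuclideanSpace ℝ (Fin n) → ℂ} {K : ℝ}, (∀ x, ‖g x‖ ≤ K) →
      ∀ ζ ∈ Metric.ball (s : ℂ) (s / 2), ‖heatExt g ζ y‖ ≤ K * 3 ^ (n / 2 : ℝ) := by
    intro g K hK ζ hζ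
    obtain ⟨h1, h2⟩ := re_pos_and_norm_div_re_le_of_mem_ball hs hζ
    have hK0 : 0 ≤ K := (norm_nonneg _).trans (hK 0)
    exact (norm_heatExt_le hK h1 y).trans (by gcongr)
  refine tendsto_sum_of_volterra hα₁ (half_pos hs) ht
    (w := fun τ ζ => heatExt (u τ) ζ y -
      mlOscillation α ω τ * heatExt (resolventExt (iomegaPow α ω) e F) ζ y)
    (A := fun ζ => heatExt (fun x => u₀ x - resolventExt (iomegaPow α ω) e F x) ζ y)
    (b := fun ζ => heatExt u₁ ζ y)
    (M := M * 3 ^ (n / 2 : ℝ) + Φ * ((M₂ * ∫ x, ‖resolventKernel n (iomegaPow α ω) e x‖) *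
      3 ^ (n / 2 : ℝ))) ?_ ?_ ?_ ?_ ?_ ?_
  · exact fun τ hτ ζ hζ => ((hd (huc τ hτ) (hM τ hτ) ζ hζ).sub
      ((hd hv hvM ζ hζ).const_mul _)).differentiableWithinAt
  · intro ζ hζ
    have hre := (re_pos_and_norm_div_re_le_of_mem_ball hs hζ).1
    refine ((hu.continuousOn_deriv_heatExt hM hre y).sub (hφ.mul (continuousOn_const
      (c := deriv (fun ζ => heatExt (resolventExt (iomegaPow α ω) e F) ζ y) ζ)))).congr
      fun τ hτ => ?_
    exact ((hd (huc τ hτ) (hM τ hτ) ζ hζ).hasDerivAt.sub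
      ((hd hv hvM ζ hζ).hasDerivAt.const_mul _)).deriv
  · exact fun ζ hζ => (hd (hu₀.sub hv) (fun x => (norm_sub_le _ _).trans
      (add_le_add (hM₀ x) (hvM x))) ζ hζ).differentiableWithinAt
  · exact fun ζ hζ => (hd hu₁ hM₁ ζ hζ).differentiableWithinAt
  · intro τ hτ ζ hζ
    refine (norm_sub_le _ _).trans (add_le_add (hb (hM τ hτ) ζ hζ) ?_)
    rw [norm_mul]
    exact mul_le_mul (hΦ τ hτ) (hb hvM ζ hζ) (norm_nonneg _)
      ((norm_nonneg _).trans (hΦ τ hτ))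
  · intro τ hτ ζ hζ
    exact hu.heatExt_sub_eq_rlIntegral hα₁ hα₂ hF hFi hu₀ hu₁ hM₀ hM₁ hM₂ hτ.1
      (fun τ' hτ' => hM τ' ⟨hτ'.1, hτ'.2.trans hτ.2⟩) he hz
      (re_pos_and_norm_div_re_le_of_mem_ball hs hζ).1 y

/-- The distance of the solution to the oscillation with the limit amplitude decays. -/
theorem exists_norm_sub_mlOscillation_mul_le (hn : 3 ≤ n)
    (hu : IsClassicalSolution α (fun t x => mlOscillation α ω t * F x) u₀ u₁ u)
    (hα₁ : 1 < α) (hα₂ : α < 2) (hF : Continuous F) (hFi : Integrable F) (hu₀ : Continuous u₀)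
    (hu₀i : Integrable u₀) (hu₁ : Continuous u₁) (hu₁i : Integrable u₁)
    {M₀ M₁ M₂ : ℝ} (hM₀ : ∀ x, ‖u₀ x‖ ≤ M₀) (hM₁ : ∀ x, ‖u₁ x‖ ≤ M₁)
    (hM₂ : ∀ x, ‖F x‖ ≤ M₂) (hM : ∀ T : ℝ, ∃ M : ℝ, ∀ τ ∈ Icc 0 T, ∀ x, ‖u τ x‖ ≤ M)
    {e : ℂ} (he : 0 < e.re) (hz : 0 < (iomegaPow α ω * e).re) (y : EuclideanSpace ℝ (Fin n)) :
    ∃ C : ℝ, ∀ t > 0,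
      ‖u t y - mlOscillation α ω t * resolventExt (iomegaPow α ω) e F y‖ ≤
        C * t ^ ((5 - α) / 2 - 2) := by
  have hpi := Real.pi_pos
  have hv := continuous_resolventExt (z := iomegaPow α ω) he hz hF hM₂
  have hvM := norm_resolventExt_le (z := iomegaPow α ω) he hz hM₂
  have hvi := integrable_resolventExt (z := iomegaPow α ω) he hz hFi
  have hη : Real.pi / 2 - 2 * (Real.pi * (2 - α) / 8) < Real.pi / 2 := by nlinarith
  obtain ⟨C₀, hC₀⟩ := sectorDecay_heatExt hn (hu₀i.sub hvi) (fun x => (norm_sub_le _ _).trans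
      (add_le_add (hM₀ x) (hvM x))) hη y
  obtain ⟨C₁, hC₁⟩ := sectorDecay_heatExt hn hu₁i hM₁ hη y
  -- The series of u⁰ - v has b = 1 and that of u¹ has b = 2. The latter needs μ > 3 - α, decay
  -- needs μ < 2, and α > 1 leaves room: μ is the midpoint.
  obtain ⟨K₀, hK₀⟩ := exists_norm_hasSum_le (b := 1) (μ := (5 - α) / 2) hα₁ hα₂ le_rfl rfl
    (by linarith) (by linarith) (by linarith) hC₀
  obtain ⟨K₁, hK₁⟩ := exists_norm_hasSum_le (b := 2) (μ := (5 - α) / 2) hα₁ hα₂ (by norm_num) rfl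
    (by linarith) (by linarith) (by linarith) hC₁
  refine ⟨K₀ + K₁, fun t ht => ?_⟩
  obtain ⟨M, hMt⟩ := hM t
  have huc : Continuous (u t) := continuous_slice hu.continuousOn_uncurry ht.le
  have hle : ∀ s : ℝ, 0 < s → ‖heatExt (u t) s y -
      mlOscillation α ω t * heatExt (resolventExt (iomegaPow α ω) e F) s y‖ ≤
        (K₀ + K₁) * t ^ ((5 - α) / 2 - 2) := by
    intro s hs
    obtain ⟨S₀, h0, h0'⟩ := hK₀ t ht s hs
    obtain ⟨S₁, h1, h1'⟩ := hK₁ t ht s hs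
    have h2 := hu.tendsto_sum_heatExt hα₁ hα₂ hF hFi hu₀ hu₁ hM₀ hM₁ hM₂ ht.le hMt he hz hs y
    rw [tendsto_nhds_unique h2 (h0.add h1).tendsto_sum_nat, add_mul]
    exact norm_add_le_of_le h0' h1'
  -- The estimate is uniform in the smoothing time s, so s → 0+ carries it to the unsmoothed
  -- difference.
  have hlim : ∀ {g : EuclideanSpace ℝ (Fin n) → ℂ} {K : ℝ}, Continuous g → (∀ x, ‖g x‖ ≤ K) →
      Tendsto (fun s : ℝ => heatExt g s y) (𝓝[>] 0) (𝓝 (g y)) := by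
    intro g K hg hK
    simpa using tendsto_heatExt hg hK (e := 1) (by simp) y
  refine le_of_tendsto ((hlim huc (hMt t ⟨ht.le, le_rfl⟩)).sub
    ((hlim hv hvM).const_mul (mlOscillation α ω t))).norm ?_
  filter_upwards [self_mem_nhdsWithin] with s hs
  exact hle s hs

end IsClassicalSolution

/-! ### The limit amplitude principle -/

theorem theorem1 (n : ℕ) (hn : 3 ≤ n) (α ω : ℝ) (hα₁ : 1 < α) (hα₂ : α < 2) (hω : 0 < ω)
    (u₀ u₁ F : EuclideanSpace ℝ (Fin n) → ℂ)
    -- boundedness of the data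
    (hu₀_bdd : ∃ M : ℝ, ∀ x, ‖u₀ x‖ ≤ M)
    (hu₁_bdd : ∃ M : ℝ, ∀ x, ‖u₁ x‖ ≤ M)
    (hF_bdd : ∃ M : ℝ, ∀ x, ‖F x‖ ≤ M)
    -- smoothness of the data
    (hF_holder : LocallyHolderContinuous F)
    (hu₀_C1 : ContDiff ℝ 1 u₀)
    (hu₀_deriv_bdd : ∃ M : ℝ, ∀ x, ‖fderiv ℝ u₀ x‖ ≤ M)
    (hu₀_deriv_holder : ∃ C γ : ℝ≥0, (2 - α) / α < (γ : ℝ) ∧ HolderWith C γ (fderiv ℝ u₀))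
    (hu₁_holder : ∃ C δ : ℝ≥0, 0 < δ ∧ HolderWith C δ u₁)
    -- integrability of the data
    (hu₀_int : Integrable u₀) (hu₁_int : Integrable u₁) (hF_int : Integrable F)
    -- the classical solution, bounded for `t` in bounded intervals
    (u : ℝ → EuclideanSpace ℝ (Fin n) → ℂ)
    (hu : IsClassicalSolution α (fun t x => mlOscillation α ω t * F x) u₀ u₁ u)
    (hu_bdd : ∀ T : ℝ, ∃ M : ℝ, ∀ t ∈ Icc 0 T, ∀ x, ‖u t x‖ ≤ M) :
    ∃ (hF₂ : MemLp F 2) (v : EuclideanSpace ℝ (Fin n) → ℂ) (hv : MemLp v 2),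
      TemperedDistribution.MemSobolev 2 2
        ((hv.toLp v : Lp ℂ 2 (volume : Measure (EuclideanSpace ℝ (Fin n)))) :
          𝓢'(EuclideanSpace ℝ (Fin n), ℂ)) ∧
      Δ ((hv.toLp v : Lp ℂ 2 (volume : Measure (EuclideanSpace ℝ (Fin n)))) :
          𝓢'(EuclideanSpace ℝ (Fin n), ℂ))
        - iomegaPow α ω •
          ((hv.toLp v : Lp ℂ 2 (volume : Measure (EuclideanSpace ℝ (Fin n)))) :
            𝓢'(EuclideanSpace ℝ (Fin n), ℂ))
        = -((hF₂.toLp F : Lp ℂ 2 (volume : Measure (EuclideanSpace ℝ (Fin n)))) :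
          𝓢'(EuclideanSpace ℝ (Fin n), ℂ)) ∧
      ∀ x, Tendsto (fun t : ℝ => u t x / mlOscillation α ω t) atTop (𝓝 (v x)) := by
  obtain ⟨M₀, hM₀⟩ := hu₀_bdd
  obtain ⟨M₁, hM₁⟩ := hu₁_bdd
  obtain ⟨M₂, hM₂⟩ := hF_bdd
  obtain ⟨C, δ, hδ, hC⟩ := hu₁_holder
  have hF := hF_holder.continuous
  obtain ⟨e, he, hz⟩ := exists_rotation_iomegaPow hα₁ hα₂ hω
  obtain ⟨hF₂, hv, hS, hΔ⟩ := exists_memSobolev_resolventExt he hz hF_int hM₂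
  refine ⟨hF₂, resolventExt (iomegaPow α ω) e F, hv, hS, hΔ, fun x => ?_⟩
  obtain ⟨K, hK⟩ := hu.exists_norm_sub_mlOscillation_mul_le hn hα₁ hα₂ hF hF_int
    hu₀_C1.continuous hu₀_int (hC.continuous hδ) hu₁_int hM₀ hM₁ hM₂ hu_bdd he hz x
  obtain ⟨c, hc, hlow⟩ := eventually_le_norm_mlOscillation hα₁ hα₂ hω
  have hlim : Tendsto (fun t : ℝ => K * t ^ (-(2 - (5 - α) / 2)) / c) atTop (𝓝 0) := by
    simpa using ((tendsto_rpow_neg_atTop (by linarith : 0 < 2 - (5 - α) / 2)).const_mul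
      K).div_const c
  rw [tendsto_iff_norm_sub_tendsto_zero]
  refine squeeze_zero' (Eventually.of_forall fun _ => norm_nonneg _) ?_ hlim
  filter_upwards [hlow, eventually_gt_atTop 0] with t h1 ht
  have h0 : mlOscillation α ω t ≠ 0 := norm_pos_iff.1 (hc.trans_le h1)
  have h2 := hK t ht
  -- The error is (u - φv)/φ: a decaying numerator over a denominator bounded below.
  rw [div_sub' h0, norm_div, neg_sub]
  exact div_le_div₀ ((norm_nonneg _).trans h2) h2 hc h1
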